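/- Let $\alpha,\beta\in\mathbb{R}$ with $\alpha>\tfrac12$ and $\alpha>\beta>-\tfrac12$, and put $\rho=\alpha+\beta+1$, $d\mu(t)=(2\sinh t)^{2\alpha+1}(2\cosh t)^{2\beta+1}\,dt$ on $(0,\infty)$, and $$\varphi_\lambda(t)={}_2F_1\bigl(\tfrac12(\rho-i\lambda),\tfrac12(\rho+i\lambda);\alpha+1;-\sinh^2t\bigr),\qquad \mathbf c(\lambda)=\frac{2^{\rho}\,\Gamma(\tfrac12 i\lambda)\,\Gamma(\tfrac12(1+i\lambda))}{\Gamma(\tfrac12(\rho+i\lambda))\,\Gamma(\tfrac12(\rho+i\lambda)-\beta)} ,$$ where ${}_2F_1$ is continued analytically to $\mathbb{C}\setminus[1,\infty)$. Let $\Omega_1=\{\lambda\in\mathbb{C}:|\operatorname{Im}\lambda|<\rho\}$ and let $N$ be the least integer $\ge\alpha+\tfrac32$. Let $R_0>1$ and let $\psi:\mathbb{R}\to[0,1]$ be an even $C^\infty$ function with $\psi(t)=1$ for $|t|\le R_0^{1/2}$ and $\psi(t)=0$ for $|t|\ge R_0$. Let $m$ be an even holomorphic function on $\Omega_1$ which is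 bounded on every closed substrip $\{|\operatorname{Im}\lambda|\le\eta\}$, $0\le\eta<\rho$, and which satisfies: for every integer $0\le a\le N$ and every real $y$ with $|y|<\rho$ there is a constant $c_{a,y}$ such that $$\Bigl|\frac{d^a}{dx^a}m(x+iy)\Bigr|\le c_{a,y}(1+|x|)^{-a}\qquad\text{for all }x\in\mathbb{R}.$$ Let $m^\vee$ be the inverse Jacobi transform of $m$, $$m^\vee(t)=\int_0^\infty m(\lambda)\varphi_\lambda(t)\,\frac{d\lambda}{\mathbf c(\lambda)\mathbf c(-\lambda)},$$ understood in general in the sense of distributions, that is, as the functional $g\mapsto\langle m^\vee,g\rangle=\int_0^\infty m(\lambda)\bigl(\int_0^\infty g\,\varphi_\lambda\,d\mu\bigr)\frac{d\lambda}{\mathbf c(\lambda)\mathbf c(-\lambda)}$. Then $m^\vee(1-\psi)$ belongs to $L^s(d\mu)$ for every $s\in(1,2)$. More precisely: 1. There is a function $k$ on $(0,\infty)$ which belongs to $L^s(d\mu)$ for every $s\in(1,2)$ and satisfies, for every $f\in C_c^\infty(\mathbb{R})$, $\int_0^\infty k f\,d\mu=\langle m^\vee,(1-\psi)f\rangle$,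 where the integral in $\lambda$ on the right converges absolutely and $kf$ is $\mu$-integrable. 2. If $m(\lambda)/(\mathbf c(\lambda)\mathbf c(-\lambda))$ is integrable on $(0,\infty)$ (for instance, if $m$ is rapidly decreasing on $\mathbb{R}$), then the function $t\mapsto m^\vee(t)(1-\psi(t))$, with $m^\vee(t)$ given by the integral above, belongs to $L^s(d\mu)$ for every $s\in(1,2)$. -/

import Mathlib

open MeasureTheory Set
open scoped ContDiff

noncomputable section

/-- `ρ = α + β + 1`. -/
def jacobiRho (α β : ℝ) : ℝ := α + β + 1

/-- Gauss' hypergeometric function `₂F₁(a, b; c; z)`: the power series in the unit disc; for `z`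
outside the unit disc with `re z < 1/2` (in particular for `z ≤ -1`) the analytic continuation of
the series to `ℂ \ [1, ∞)`, given by Pfaff's formula
`₂F₁(a, b; c; z) = (1 - z)^(-a) ₂F₁(a, c - b; c; z / (z - 1))`. Only `z ≤ 0` is used. -/
def gaussHypergeometric (a b c z : ℂ) : ℂ :=
  if ‖z‖ < 1 then ordinaryHypergeometric a b c z
  else (1 - z) ^ (-a) * ordinaryHypergeometric a (c - b) c (z / (z - 1))

/-- The Jacobi function
`φ_ξ(t) = ₂F₁((ρ - iξ)/2, (ρ + iξ)/2; α + 1; -sinh² t)`, for a complex spectral parameter `ξ`. -/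
def jacobiPhi (α β : ℝ) (ξ : ℂ) (t : ℝ) : ℂ :=
  gaussHypergeometric (((jacobiRho α β : ℂ) - Complex.I * ξ) / 2)
    (((jacobiRho α β : ℂ) + Complex.I * ξ) / 2) ((α : ℂ) + 1) (-((Real.sinh t : ℂ) ^ 2))

/-- The weight `Δ(t) = (2 sinh t)^(2α+1) (2 cosh t)^(2β+1)`, for `t > 0`. -/
def jacobiWeight (α β t : ℝ) : ℝ :=
  (2 * Real.sinh t) ^ (2 * α + 1) * (2 * Real.cosh t) ^ (2 * β + 1)

/-- The measure `dμ(t) = Δ(t) dt` on the half-line `(0, ∞)`, as a measure on `ℝ`. -/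
def jacobiMeasure (α β : ℝ) : Measure ℝ :=
  (volume.restrict (Ioi (0 : ℝ))).withDensity fun t => ENNReal.ofReal (jacobiWeight α β t)

/-- The Harish-Chandra function
`c(ξ) = 2^ρ Γ(iξ/2) Γ((1 + iξ)/2) / (Γ((ρ + iξ)/2) Γ((ρ + iξ)/2 - β))`. -/
def jacobiC (α β : ℝ) (ξ : ℂ) : ℂ :=
  (2 : ℂ) ^ (jacobiRho α β : ℂ) * Complex.Gamma (Complex.I * ξ / 2) *
      Complex.Gamma ((1 + Complex.I * ξ) / 2) /
    (Complex.Gamma (((jacobiRho α β : ℂ) + Complex.I * ξ) / 2) *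
      Complex.Gamma (((jacobiRho α β : ℂ) + Complex.I * ξ) / 2 - (β : ℂ)))

/-- The density `1 / (c(ξ) c(-ξ))`, which is `|c(ξ)|⁻²` for real `ξ`. -/
def plancherelDensity (α β : ℝ) (ξ : ℂ) : ℂ := (jacobiC α β ξ * jacobiC α β (-ξ))⁻¹

/-- The strip `Ω₁ = {ξ : |Im ξ| < ρ}`. -/
def stripOmegaOne (α β : ℝ) : Set ℂ := {ξ | |ξ.im| < jacobiRho α β}

/-- The inverse Jacobi transform as an integral,
`m^∨(t) = ∫₀^∞ m(ξ) φ_ξ(t) dξ / (c(ξ) c(-ξ))`; meaningful if `m` is integrable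
with respect to `dξ / (c(ξ) c(-ξ))` on `(0, ∞)`. -/
def inverseJacobi (α β : ℝ) (m : ℂ → ℂ) (t : ℝ) : ℂ :=
  ∫ ξ in Ioi (0 : ℝ), m ξ * jacobiPhi α β ξ t * plancherelDensity α β ξ

/-- The (unnormalised) Jacobi transform `∫₀^∞ g(t) φ_ξ(t) dμ(t)`. -/
def jacobiTransform (α β : ℝ) (g : ℝ → ℂ) (ξ : ℂ) : ℂ :=
  ∫ t, g t * jacobiPhi α β ξ t ∂(jacobiMeasure α β)

/-- The function `k` on `(0, ∞)` is the product `m^∨ · χ`, where `m^∨` is the inverse Jacobi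
transform of `m` in the sense of distributions: `m^∨` is the functional
`g ↦ ∫₀^∞ m(ξ) (∫₀^∞ g φ_ξ dμ) dξ / (c(ξ) c(-ξ))` (an absolutely convergent integral), and the
functional `f ↦ m^∨(χ f)` is integration against `k dμ`. -/
def IsInverseJacobiMul (α β : ℝ) (m : ℂ → ℂ) (χ : ℝ → ℝ) (k : ℝ → ℂ) : Prop :=
  ∀ f : ℝ → ℂ, ContDiff ℝ ∞ f → HasCompactSupport f →
    IntegrableOn (fun ξ : ℝ =>
      m ξ * jacobiTransform α β (fun t => (χ t : ℂ) * f t) ξ * plancherelDensity α β ξ)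
      (Ioi (0 : ℝ)) ∧
    Integrable (fun t => k t * f t) (jacobiMeasure α β) ∧
    ∫ t, k t * f t ∂(jacobiMeasure α β) =
      ∫ ξ in Ioi (0 : ℝ),
        m ξ * jacobiTransform α β (fun t => (χ t : ℂ) * f t) ξ * plancherelDensity α β ξ

end

/-! The function v = √Δ φ_λ solves the Schrödinger equation v'' = (q - λ²) v, whose potential q is a
power series in e^{-2t} without constant term. The same equation has the Jost solutions Φ_λ(t) = ∑
a_k(λ) e^{(iλ - 2k)t} and Φ_{-λ}, and for real λ ≠ 0 the connection formula `jacobiY_eq` reads √Δ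
φ_λ = C (c(λ) Φ_λ + c(-λ) Φ_{-λ}). After division by c(λ) c(-λ), evenness of m folds the two terms
into one integral over ℝ. With G = √Δ g and σ_k = a_k / c(-·), the pairing of m^∨ with g becomes C
∑_k ∫ m(x) σ_k(x) Ĝ(x + 2ki) dx.

The poles of 1/c(-·) and of a_k lie in the open lower half-plane. Hence the σ_k are symbols of order
α + 1/2 on the closed upper half-plane, with constants of polynomial growth in k
(`norm_iteratedDeriv_jacobiSymbol_le`). The line of integration can therefore be raised to height η
for any 0 < η < ρ, which gains a factor e^{-ηt}. Then N integrations by parts gain (it)^{-N}, which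
is bounded for t ≥ 1, and replace m σ_k by a function of size (1 + |x|)^{-1}, since N ≥ α + 3/2.
Such a function is in L²(ℝ), hence so is its Fourier transform, and the factors e^{-2kt} with t ≥ 1
make the sum over k converge in L² (`exists_Lp_hasSum_integral_jacobiSymbol`). So m^∨ (1 - ψ) is
Δ^{-1/2} e^{-ηt} times an L² function.

Since Δ(t) = O(e^{2ρt}), Hölder's inequality puts this in L^s(μ) as soon as (2/s - 1)ρ < η, and s >
1 leaves room for such an η below ρ. The construction depends on η, but the representing function is
unique almost everywhere (`IsInverseJacobiMul.ae_eq`), so one function serves all s. If the defining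
integral converges absolutely, Fubini's theorem shows that it is a representing function too. -/

open Filter Topology

/-! ### Estimates for quotients of Gamma functions -/

/-- Comparison of two complex Gamma quotients with the quotient at a real point. -/
theorem norm_Gamma_div_Gamma_le {z : ℂ} {r κ L a b : ℝ} (hr : 1 ≤ r) (hκ : 0 < κ)
    (hL : ‖z - r‖ ≤ L * r)
    (hza : ∀ j : ℕ, κ * (r + j) ≤ ‖z + a + j‖) (hrb : ∀ j : ℕ, κ * (r + j) ≤ r + b + j)
    (hra : ∀ j : ℕ, 0 < r + a + j) :
    ‖Complex.Gamma (z + a)‖ * ‖(Complex.Gamma (z + b))⁻¹‖ ≤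
      Real.exp (2 * (|a - b| * L / κ ^ 2)) * (Real.Gamma (r + a) / Real.Gamma (r + b)) := by
  have hL0 : 0 ≤ L := by
    by_contra h
    have : L * r < 0 := mul_neg_of_neg_of_pos (not_le.1 h) (by linarith)
    linarith [norm_nonneg (z - r)]
  have hrj : ∀ j : ℕ, 0 < r + j := fun j => by positivity
  have hrb' : ∀ j : ℕ, 0 < r + b + j := fun j => (mul_pos hκ (hrj j)).trans_le (hrb j)
  have hza' : ∀ j : ℕ, z + a + j ≠ 0 := fun j =>
    norm_pos_iff.1 ((mul_pos hκ (hrj j)).trans_le (hza j))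
  have hGb : 0 < Real.Gamma (r + b) := Real.Gamma_pos_of_pos (by simpa using hrb' 0)
  have hGa : 0 < Real.Gamma (r + a) := Real.Gamma_pos_of_pos (by simpa using hra 0)
  -- At a pole `Complex.Gamma` has the value 0, and so has its inverse, in agreement with the entire
  -- function 1/Γ.
  by_cases hzb : Complex.Gamma (z + b) = 0
  · rw [hzb]; simp; positivity
  have hzb' : ∀ j : ℕ, z + b + j ≠ 0 := by
    intro j hj
    exact hzb ((Complex.Gamma_eq_zero_iff _).2 ⟨j, by linear_combination hj⟩)
  set E := |a - b| * L / κ ^ 2 with hE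
  have hE0 : 0 ≤ E := by positivity
  -- one factor of the products
  have hfac : ∀ j : ℕ, ‖z + b + j‖ * (r + a + j) ≤
      Real.exp (E * (r / (r + j) ^ 2)) * (‖z + a + j‖ * (r + b + j)) := by
    intro j
    -- The two cross products differ by (a - b)(z - r), which does not involve j. Relative to the
    -- main term this is O(r / (r + j)²), whose sum over j is bounded uniformly in r.
    have h1 : (z + b + j) * ((r + a + j : ℝ) : ℂ) =
        (z + a + j) * ((r + b + j : ℝ) : ℂ) + ((a - b : ℝ) : ℂ) * (z - r) := by
      push_cast; ring
    have h2 : ‖z + b + j‖ * (r + a + j) ≤ ‖z + a + j‖ * (r + b + j) + |a - b| * (L * r) := by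
      calc ‖z + b + j‖ * (r + a + j) = ‖(z + b + j) * ((r + a + j : ℝ) : ℂ)‖ := by
            rw [norm_mul, Complex.norm_real, Real.norm_of_nonneg (hra j).le]
        _ ≤ ‖(z + a + j) * ((r + b + j : ℝ) : ℂ)‖ + ‖((a - b : ℝ) : ℂ) * (z - r)‖ := by
            rw [h1]; exact norm_add_le _ _
        _ ≤ _ := by
            rw [norm_mul, norm_mul, Complex.norm_real, Complex.norm_real,
              Real.norm_of_nonneg (hrb' j).le, Real.norm_eq_abs]
            gcongr
    have h3 : (κ * (r + j)) * (κ * (r + j)) ≤ ‖z + a + j‖ * (r + b + j) :=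
      mul_le_mul (hza j) (hrb j) (mul_pos hκ (hrj j)).le (norm_nonneg _)
    have h4 : |a - b| * (L * r) = E * (r / (r + j) ^ 2) * ((κ * (r + j)) * (κ * (r + j))) := by
      have := (hrj j).ne'
      rw [hE]; field_simp
    have h5 : 0 ≤ E * (r / (r + j) ^ 2) := by positivity
    calc _ ≤ _ := h2
      _ ≤ (E * (r / (r + j) ^ 2) + 1) * (‖z + a + j‖ * (r + b + j)) := by
          rw [h4]; nlinarith [mul_le_mul_of_nonneg_left h3 h5]
      _ ≤ _ := by
          gcongr
          · exact mul_nonneg (norm_nonneg _) (hrb' j).le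
          · exact Real.add_one_le_exp _
  have hsum : ∀ n : ℕ, ∑ j ∈ Finset.range n, r / (r + j) ^ 2 ≤ 2 := by
    intro n
    have : ∀ n : ℕ, ∑ j ∈ Finset.range n, r / (r + j) ^ 2 ≤ 2 * r * (1 / r - 1 / (r + n)) := by
      intro n
      induction n with
      | zero => simp
      | succ n ih =>
        rw [Finset.sum_range_succ]
        have h0 := hrj n
        -- Telescoping; the factor 2 absorbs (r + n + 1)/(r + n), because r + n ≥ 1.
        have : r / (r + n) ^ 2 ≤ 2 * r * (1 / (r + n) - 1 / (r + (n + 1 : ℕ))) := by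
          push_cast
          rw [div_sub_div _ _ h0.ne' (by positivity), mul_div_assoc', div_le_div_iff₀ (by positivity)
            (by positivity)]
          have h1 : 1 ≤ r + n := by linarith [(Nat.cast_nonneg n : (0:ℝ) ≤ n)]
          nlinarith [mul_nonneg (mul_nonneg (by linarith : (0:ℝ) ≤ r) h0.le) (sub_nonneg.2 h1)]
        calc _ ≤ 2 * r * (1 / r - 1 / (r + n)) + _ := add_le_add ih this
          _ = _ := by ring
    refine (this n).trans ?_
    have h0 := hrj n
    have : 2 * r * (1 / r - 1 / (r + n)) = 2 - 2 * r / (r + n) := by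
      field_simp
    rw [this]
    have : 0 ≤ 2 * r / (r + n) := by positivity
    linarith
  have hprod : ∀ n : ℕ, (∏ j ∈ Finset.range n, ‖z + b + j‖) * ∏ j ∈ Finset.range n, (r + a + j) ≤
      Real.exp (2 * E) * ((∏ j ∈ Finset.range n, ‖z + a + j‖) *
        ∏ j ∈ Finset.range n, (r + b + j)) := by
    intro n
    rw [← Finset.prod_mul_distrib, ← Finset.prod_mul_distrib]
    calc _ ≤ ∏ j ∈ Finset.range n, (Real.exp (E * (r / (r + j) ^ 2)) *
          (‖z + a + j‖ * (r + b + j))) :=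
          Finset.prod_le_prod (fun j _ => mul_nonneg (norm_nonneg _) (hra j).le) fun j _ => hfac j
      _ = Real.exp (E * ∑ j ∈ Finset.range n, r / (r + j) ^ 2) *
          ∏ j ∈ Finset.range n, (‖z + a + j‖ * (r + b + j)) := by
          rw [Finset.prod_mul_distrib, ← Real.exp_sum, Finset.mul_sum]
      _ ≤ _ := by
          have := Finset.prod_nonneg (s := Finset.range n)
            (fun j _ => mul_nonneg (norm_nonneg (z + a + j)) (hrb' j).le)
          refine mul_le_mul_of_nonneg_right (Real.exp_le_exp.2 ?_) this
          linarith [mul_le_mul_of_nonneg_left (hsum n) hE0]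
  -- The approximants of Euler's limit carry the same powers of n and the same factorials on both
  -- sides, so only the finite products have to be compared.
  have hseq : ∀ n : ℕ, 0 < n → ‖Complex.GammaSeq (z + a) n‖ * Real.GammaSeq (r + b) n ≤
      Real.exp (2 * E) * (Real.GammaSeq (r + a) n * ‖Complex.GammaSeq (z + b) n‖) := by
    intro n hn
    have hn' : (0 : ℝ) < n := by exact_mod_cast hn
    unfold Complex.GammaSeq Real.GammaSeq
    simp only [norm_div, norm_mul, norm_prod]
    rw [← Complex.ofReal_natCast n, Complex.norm_cpow_eq_rpow_re_of_pos hn',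
      Complex.norm_cpow_eq_rpow_re_of_pos hn']
    have p1 : 0 < ∏ j ∈ Finset.range (n + 1), ‖z + a + j‖ :=
      Finset.prod_pos fun j _ => norm_pos_iff.2 (hza' j)
    have p2 : 0 < ∏ j ∈ Finset.range (n + 1), ‖z + b + j‖ :=
      Finset.prod_pos fun j _ => norm_pos_iff.2 (hzb' j)
    have p3 : 0 < ∏ j ∈ Finset.range (n + 1), (r + a + j) := Finset.prod_pos fun j _ => hra j
    have p4 : 0 < ∏ j ∈ Finset.range (n + 1), (r + b + j) := Finset.prod_pos fun j _ => hrb' j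
    have e1 : (n : ℝ) ^ (z + (a : ℂ)).re = (n : ℝ) ^ z.re * (n : ℝ) ^ a := by
      rw [← Real.rpow_add hn']; simp
    have e2 : (n : ℝ) ^ (z + (b : ℂ)).re = (n : ℝ) ^ z.re * (n : ℝ) ^ b := by
      rw [← Real.rpow_add hn']; simp
    rw [e1, e2, Real.rpow_add hn', Real.rpow_add hn', div_mul_div_comm, div_mul_div_comm,
      mul_div_assoc', div_le_div_iff₀ (by positivity) (by positivity)]
    have := mul_le_mul_of_nonneg_left (hprod (n + 1)) (by positivity :
      0 ≤ (n : ℝ) ^ z.re * (n : ℝ) ^ a * ‖((Nat.factorial n : ℕ) : ℂ)‖ *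
        ((n : ℝ) ^ r * (n : ℝ) ^ b * (Nat.factorial n : ℕ)))
    have e3 : ‖((Nat.factorial n : ℕ) : ℂ)‖ = (Nat.factorial n : ℕ) := by simp
    rw [e3] at this ⊢
    calc _ = _ := by ring
      _ ≤ _ := this
      _ = _ := by ring
  have hlim : ‖Complex.Gamma (z + a)‖ * Real.Gamma (r + b) ≤
      Real.exp (2 * E) * (Real.Gamma (r + a) * ‖Complex.Gamma (z + b)‖) := by
    refine le_of_tendsto_of_tendsto (b := atTop)
      (((Complex.GammaSeq_tendsto_Gamma _).norm).mul (Real.GammaSeq_tendsto_Gamma _))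
      (((Real.GammaSeq_tendsto_Gamma _).mul (Complex.GammaSeq_tendsto_Gamma _).norm).const_mul _) ?_
    filter_upwards [eventually_gt_atTop 0] with n hn using hseq n hn
  have hzb0 : 0 < ‖Complex.Gamma (z + b)‖ := norm_pos_iff.2 hzb
  rw [norm_inv, ← div_eq_mul_inv, mul_div_assoc', div_le_div_iff₀ hzb0 hGb]
  linarith

/-- Log-convexity of Γ settles 0 ≤ δ ≤ 1, and the functional equation adds the integer part of δ. -/
theorem Real.Gamma_add_le_rpow_mul_Gamma {x δ : ℝ} (hx : 0 < x) (hδ : 0 ≤ δ) :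
    Real.Gamma (x + δ) ≤ (x + δ) ^ δ * Real.Gamma x := by
  have base : ∀ θ : ℝ, 0 ≤ θ → θ ≤ 1 → Real.Gamma (x + θ) ≤ (x + θ) ^ θ * Real.Gamma x := by
    intro θ h0 h1
    rcases h0.eq_or_lt with rfl | h0
    · simp
    rcases h1.eq_or_lt with rfl | h1
    · rw [Real.Gamma_add_one hx.ne', Real.rpow_one]
      have := Real.Gamma_pos_of_pos hx
      gcongr; linarith
    have hG := Real.Gamma_pos_of_pos hx
    have := Real.Gamma_mul_add_mul_le_rpow_Gamma_mul_rpow_Gamma hx (by linarith : 0 < x + 1)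
      (sub_pos.2 h1) h0 (by ring)
    rw [Real.Gamma_add_one hx.ne', Real.mul_rpow hx.le hG.le] at this
    have e : (1 - θ) * x + θ * (x + 1) = x + θ := by ring
    have e2 : Real.Gamma x ^ (1 - θ) * (x ^ θ * Real.Gamma x ^ θ) = x ^ θ * Real.Gamma x := by
      rw [mul_left_comm, ← Real.rpow_add hG]; simp
    rw [e, e2] at this
    refine this.trans ?_
    gcongr; linarith
  have step : ∀ (n : ℕ) (θ : ℝ), 0 ≤ θ → θ ≤ 1 →
      Real.Gamma (x + (θ + n)) ≤ (x + (θ + n)) ^ (θ + n) * Real.Gamma x := by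
    intro n θ h0 h1
    induction n with
    | zero => simpa using base θ h0 h1
    | succ n ih =>
      have hp : 0 < x + (θ + n) := by positivity
      have hG := Real.Gamma_pos_of_pos hx
      push_cast
      rw [show x + (θ + (n + 1 : ℝ)) = x + (θ + n) + 1 by ring, Real.Gamma_add_one hp.ne',
        show θ + (n + 1 : ℝ) = (θ + n) + 1 by ring, Real.rpow_add_one (by positivity)]
      calc _ ≤ (x + (θ + n)) * ((x + (θ + n)) ^ (θ + n) * Real.Gamma x) := by gcongr
        _ ≤ (x + (θ + n) + 1) * ((x + (θ + n) + 1) ^ (θ + n) * Real.Gamma x) := by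
            have h2 : (x + (θ + n)) ^ (θ + n) ≤ (x + (θ + n) + 1) ^ (θ + n) :=
              Real.rpow_le_rpow hp.le (by linarith) (by positivity)
            exact mul_le_mul (by linarith) (mul_le_mul_of_nonneg_right h2 hG.le) (by positivity)
              (by linarith)
        _ = _ := by ring
  have := step ⌊δ⌋₊ (δ - ⌊δ⌋₊) (sub_nonneg.2 (Nat.floor_le hδ))
    (by linarith [Nat.lt_floor_add_one δ])
  simpa using this

/-- Γ decreases on part of [1, 2], and the factor 2 pays for the dip. For a shift θ ≤ 1 it is
`Real.Gamma_add_le_rpow_mul_Gamma` from x + θ up to x + 1, together with (x + 1)^{1-θ} ≤ 2x. -/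
theorem Real.Gamma_le_two_mul_Gamma_add {x δ : ℝ} (hx : 1 ≤ x) (hδ : 0 ≤ δ) :
    Real.Gamma x ≤ 2 * Real.Gamma (x + δ) := by
  have hx0 : 0 < x := by linarith
  have base : ∀ θ : ℝ, 0 ≤ θ → θ ≤ 1 → Real.Gamma x ≤ 2 * Real.Gamma (x + θ) := by
    intro θ h0 h1
    have h := Real.Gamma_add_le_rpow_mul_Gamma (x := x + θ) (δ := 1 - θ) (by linarith) (by linarith)
    have hG := Real.Gamma_pos_of_pos (show 0 < x + θ by linarith)
    rw [show x + θ + (1 - θ) = x + 1 by ring, Real.Gamma_add_one hx0.ne'] at h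
    have h2 : (x + 1) ^ (1 - θ) ≤ x * 2 := by
      calc (x + 1) ^ (1 - θ) ≤ (x + 1) ^ (1 : ℝ) :=
            Real.rpow_le_rpow_of_exponent_le (by linarith) (by linarith)
        _ ≤ _ := by rw [Real.rpow_one]; linarith
    have h3 : x * Real.Gamma x ≤ x * (2 * Real.Gamma (x + θ)) := by
      calc _ ≤ _ := h
        _ ≤ x * 2 * Real.Gamma (x + θ) := by gcongr
        _ = _ := by ring
    exact le_of_mul_le_mul_left h3 hx0
  have step : ∀ (n : ℕ) (θ : ℝ), 0 ≤ θ → θ ≤ 1 →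
      Real.Gamma x ≤ 2 * Real.Gamma (x + (θ + n)) := by
    intro n θ h0 h1
    induction n with
    | zero => simpa using base θ h0 h1
    | succ n ih =>
      have hp : 1 ≤ x + (θ + n) := by have : (0:ℝ) ≤ n := by positivity
                                      linarith
      have hG := Real.Gamma_pos_of_pos (by linarith : 0 < x + (θ + n))
      push_cast
      rw [show x + (θ + (n + 1 : ℝ)) = x + (θ + n) + 1 by ring,
        Real.Gamma_add_one (by linarith)]
      nlinarith
  have := step ⌊δ⌋₊ (δ - ⌊δ⌋₊) (sub_nonneg.2 (Nat.floor_le hδ))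
    (by linarith [Nat.lt_floor_add_one δ])
  simpa using this

/-! ### Size and holomorphy of the c-function -/

/-- A disc around a point ξ of the closed upper half-plane stays away from the poles of Γ(a - iζ/2)
even if its radius is proportional to 1 + ‖ξ‖. Cauchy's estimate on such discs will give one power
of (1 + ‖ξ‖)⁻¹ per derivative. -/
theorem le_norm_neg_I_mul_div_two_add {ξ ζ : ℂ} (hξ : 0 ≤ ξ.im) (hζ : ‖ζ - ξ‖ ≤ (1 + ‖ξ‖) / 4)
    {a : ℝ} (ha : 1 / 2 ≤ a) :
    1 / 8 * (1 + ‖ξ‖ + (a - 1 / 2)) ≤ ‖-Complex.I * ζ / 2 + a‖ := by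
  have h1 : ‖-Complex.I * ξ / 2 + a‖ ≤ ‖-Complex.I * ζ / 2 + a‖ + (1 + ‖ξ‖) / 8 := by
    have e : -Complex.I * ξ / 2 + a = (-Complex.I * ζ / 2 + a) + Complex.I * (ζ - ξ) / 2 := by ring
    rw [e]
    refine (norm_add_le _ _).trans ?_
    have : ‖Complex.I * (ζ - ξ) / 2‖ ≤ (1 + ‖ξ‖) / 8 := by
      simp only [norm_div, norm_mul, Complex.norm_I, one_mul, Complex.norm_ofNat]
      linarith
    linarith
  have h2 : |(-Complex.I * ξ / 2 + a).re| ≤ ‖-Complex.I * ξ / 2 + a‖ := Complex.abs_re_le_norm _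
  have h3 : |(-Complex.I * ξ / 2 + a).im| ≤ ‖-Complex.I * ξ / 2 + a‖ := Complex.abs_im_le_norm _
  have e2 : (-Complex.I * ξ / 2 + a).re = ξ.im / 2 + a := by simp
  have e3 : (-Complex.I * ξ / 2 + a).im = -ξ.re / 2 := by simp
  rw [e2, abs_of_nonneg (by linarith)] at h2
  rw [e3, abs_div, abs_neg, abs_two] at h3
  have h4 := Complex.norm_le_abs_re_add_abs_im ξ
  rw [abs_of_nonneg hξ] at h4
  linarith

theorem jacobiC_neg_eq (α β : ℝ) (ζ : ℂ) :
    jacobiC α β (-ζ) = (2 : ℂ) ^ (jacobiRho α β : ℂ) * Complex.Gamma (-Complex.I * ζ / 2 + (0 : ℝ)) *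
      Complex.Gamma (-Complex.I * ζ / 2 + (1 / 2 : ℝ)) /
    (Complex.Gamma (-Complex.I * ζ / 2 + (jacobiRho α β / 2 : ℝ)) *
      Complex.Gamma (-Complex.I * ζ / 2 + ((α - β + 1) / 2 : ℝ))) := by
  unfold jacobiC jacobiRho
  push_cast
  congr 3 <;> ring_nf

theorem inv_jacobiC_neg_eq (α β : ℝ) (ζ : ℂ) :
    (jacobiC α β (-ζ))⁻¹ = ((2 : ℂ) ^ (jacobiRho α β : ℂ))⁻¹ *
      (Complex.Gamma (-Complex.I * ζ / 2 + (jacobiRho α β / 2 : ℝ)) *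
        (Complex.Gamma (-Complex.I * ζ / 2 + (0 : ℝ)))⁻¹) *
      (Complex.Gamma (-Complex.I * ζ / 2 + ((α - β + 1) / 2 : ℝ)) *
        (Complex.Gamma (-Complex.I * ζ / 2 + (1 / 2 : ℝ)))⁻¹) := by
  rw [jacobiC_neg_eq, inv_div, div_eq_mul_inv, mul_inv, mul_inv]
  ring

/-- The two Gamma quotients in 1/c(-ζ) have orders ρ/2 and (α - β)/2, which add up to α + 1/2. -/
theorem norm_inv_jacobiC_neg_le {α β : ℝ} (hβα : β < α) (hβ : -(1 / 2) < β) (hα : 1 / 2 < α) :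
    ∃ C : ℝ, 0 ≤ C ∧ ∀ ξ ζ : ℂ, 0 ≤ ξ.im → ‖ζ - ξ‖ ≤ (1 + ‖ξ‖) / 4 →
      ‖(jacobiC α β (-ζ))⁻¹‖ ≤ C * (1 + ‖ξ‖) ^ (α + 1 / 2) := by
  have hρ : 1 < jacobiRho α β := by unfold jacobiRho; linarith
  have key : ∀ a b : ℝ, 1 / 2 ≤ a → 0 ≤ b → b ≤ a → ∃ C : ℝ, 0 ≤ C ∧ ∀ ξ ζ : ℂ, 0 ≤ ξ.im →
      ‖ζ - ξ‖ ≤ (1 + ‖ξ‖) / 4 →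
      ‖Complex.Gamma (-Complex.I * ζ / 2 + a) * (Complex.Gamma (-Complex.I * ζ / 2 + b))⁻¹‖ ≤
        C * (1 + ‖ξ‖) ^ (a - b) := by
    intro a b ha hb hab
    refine ⟨Real.exp (2 * (|a - b| * 2 / (1 / 8) ^ 2)) * (1 + a) ^ (a - b), by positivity, ?_⟩
    intro ξ ζ hξ hζ
    have hr : 1 ≤ 1 + ‖ξ‖ := by linarith [norm_nonneg ξ]
    rw [norm_mul]
    have hn : ‖-Complex.I * ζ / 2‖ ≤ 1 + ‖ξ‖ := by
      have : ‖ζ‖ ≤ ‖ζ - ξ‖ + ‖ξ‖ := by simpa using norm_add_le (ζ - ξ) ξ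
      simp only [norm_div, norm_mul, norm_neg, Complex.norm_I, one_mul, Complex.norm_ofNat]
      linarith
    refine (norm_Gamma_div_Gamma_le (r := 1 + ‖ξ‖) (κ := 1 / 8) (L := 2) hr (by norm_num) ?_ ?_ ?_
      ?_).trans ?_
    · refine (norm_sub_le _ _).trans ?_
      rw [Complex.norm_real, Real.norm_of_nonneg (by linarith)]
      linarith
    · intro j
      have hj : (0 : ℝ) ≤ j := Nat.cast_nonneg j
      have := le_norm_neg_I_mul_div_two_add hξ hζ (a := a + j) (by linarith)
      push_cast at this
      rw [add_assoc (-Complex.I * ζ / 2)]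
      refine le_trans ?_ this
      linarith
    · intro j
      have hj : (0 : ℝ) ≤ j := Nat.cast_nonneg j
      linarith
    · intro j
      have hj : (0 : ℝ) ≤ j := Nat.cast_nonneg j
      linarith
    · have hb' : 0 < Real.Gamma (1 + ‖ξ‖ + b) := Real.Gamma_pos_of_pos (by linarith)
      rw [mul_assoc]
      refine mul_le_mul_of_nonneg_left ?_ (Real.exp_pos _).le
      rw [div_le_iff₀ hb']
      have := Real.Gamma_add_le_rpow_mul_Gamma (x := 1 + ‖ξ‖ + b) (δ := a - b) (by linarith)
        (by linarith)
      rw [show 1 + ‖ξ‖ + b + (a - b) = 1 + ‖ξ‖ + a by ring] at this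
      refine this.trans (mul_le_mul_of_nonneg_right ?_ hb'.le)
      rw [← Real.mul_rpow (by linarith) (by linarith)]
      refine Real.rpow_le_rpow (by linarith [norm_nonneg ξ]) ?_ (by linarith)
      nlinarith [norm_nonneg ξ]
  obtain ⟨C₁, hC₁, h₁⟩ := key (jacobiRho α β / 2) 0 (by linarith) le_rfl (by linarith)
  obtain ⟨C₂, hC₂, h₂⟩ := key ((α - β + 1) / 2) (1 / 2) (by linarith) (by norm_num) (by linarith)
  refine ⟨‖((2 : ℂ) ^ (jacobiRho α β : ℂ))⁻¹‖ * C₁ * C₂, by positivity, fun ξ ζ hξ hζ => ?_⟩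
  have hr : 0 < 1 + ‖ξ‖ := by linarith [norm_nonneg ξ]
  rw [inv_jacobiC_neg_eq, norm_mul, norm_mul]
  have e : (1 + ‖ξ‖) ^ (α + 1 / 2) = (1 + ‖ξ‖) ^ (jacobiRho α β / 2 - 0) *
      (1 + ‖ξ‖) ^ ((α - β + 1) / 2 - 1 / 2) := by
    rw [← Real.rpow_add hr]; congr 1; unfold jacobiRho; ring
  rw [e]
  calc _ ≤ ‖((2 : ℂ) ^ (jacobiRho α β : ℂ))⁻¹‖ * (C₁ * (1 + ‖ξ‖) ^ (jacobiRho α β / 2 - 0)) *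
        (C₂ * (1 + ‖ξ‖) ^ ((α - β + 1) / 2 - 1 / 2)) := by
        gcongr
        · exact h₁ ξ ζ hξ hζ
        · exact h₂ ξ ζ hξ hζ
    _ = _ := by ring

theorem differentiableAt_inv_jacobiC_neg {α β : ℝ} (hβα : β < α) (hβ : -(1 / 2) < β)
    (hα : 1 / 2 < α) {ξ ζ : ℂ} (hξ : 0 ≤ ξ.im) (hζ : ‖ζ - ξ‖ ≤ (1 + ‖ξ‖) / 4) :
    DifferentiableAt ℂ (fun ζ => (jacobiC α β (-ζ))⁻¹) ζ := by
  have hρ : 1 < jacobiRho α β := by unfold jacobiRho; linarith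
  have hG : ∀ a : ℝ, 1 / 2 ≤ a →
      DifferentiableAt ℂ (fun ζ => Complex.Gamma (-Complex.I * ζ / 2 + a)) ζ := by
    intro a ha
    refine DifferentiableAt.comp (f := fun ζ => -Complex.I * ζ / 2 + a) (g := Complex.Gamma) ζ
      (Complex.differentiableAt_Gamma _ fun j hj => ?_) (by fun_prop)
    have hj' : (0 : ℝ) ≤ j := Nat.cast_nonneg j
    have := le_norm_neg_I_mul_div_two_add hξ hζ (a := a + j) (by linarith)
    push_cast at this
    rw [← add_assoc, hj, neg_add_cancel, norm_zero] at this
    linarith [norm_nonneg ξ]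
  have hG' : ∀ a : ℝ,
      DifferentiableAt ℂ (fun ζ => (Complex.Gamma (-Complex.I * ζ / 2 + a))⁻¹) ζ := by
    intro a
    exact DifferentiableAt.comp (f := fun ζ => -Complex.I * ζ / 2 + a)
      (g := fun z => (Complex.Gamma z)⁻¹) ζ (Complex.differentiable_one_div_Gamma _) (by fun_prop)
  simp_rw [inv_jacobiC_neg_eq]
  exact (((hG _ (by linarith)).mul (hG' _)).const_mul _).mul
    ((hG _ (by linarith)).mul (hG' _))

/-- Here the quotients are inverted: the Gamma factor with the smaller shift is in the numerator, so
they stay bounded. The condition on |x| keeps away from the pole at 0. The bound serves the uniform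
estimate of the Jacobi function, `exists_norm_jacobiY_le`. -/
theorem norm_jacobiC_le {α β : ℝ} (hβα : β < α) (hβ : -(1 / 2) < β) (hα : 1 / 2 < α) :
    ∃ C : ℝ, ∀ x : ℝ, 1 ≤ |x| → ‖jacobiC α β x‖ ≤ C := by
  have hρ : 1 < jacobiRho α β := by unfold jacobiRho; linarith
  have key : ∀ a b : ℝ, 0 ≤ a → a ≤ b → ∃ C : ℝ, 0 ≤ C ∧ ∀ x : ℝ, 1 ≤ |x| →
      ‖Complex.Gamma (-Complex.I * (-x : ℂ) / 2 + a) *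
        (Complex.Gamma (-Complex.I * (-x : ℂ) / 2 + b))⁻¹‖ ≤ C := by
    intro a b ha hab
    refine ⟨Real.exp (2 * (|a - b| * 2 / (1 / 8) ^ 2)) * 2, by positivity, fun x hx => ?_⟩
    rw [norm_mul]
    have hr : 1 ≤ 1 + |x| := by linarith
    refine (norm_Gamma_div_Gamma_le (r := 1 + |x|) (κ := 1 / 8) (L := 2) hr (by norm_num) ?_ ?_ ?_
      ?_).trans ?_
    · refine (norm_sub_le _ _).trans ?_
      rw [Complex.norm_real, Real.norm_of_nonneg (by linarith)]
      simp only [norm_div, norm_mul, norm_neg, Complex.norm_I, one_mul, Complex.norm_ofNat,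
        Complex.norm_real, Real.norm_eq_abs]
      linarith
    · intro j
      have hj : (0 : ℝ) ≤ j := Nat.cast_nonneg j
      have h2 := Complex.abs_re_le_norm (-Complex.I * (-x : ℂ) / 2 + a + j)
      have h3 := Complex.abs_im_le_norm (-Complex.I * (-x : ℂ) / 2 + a + j)
      have e2 : (-Complex.I * (-x : ℂ) / 2 + a + j).re = a + j := by simp
      have e3 : (-Complex.I * (-x : ℂ) / 2 + a + j).im = x / 2 := by simp
      rw [e2, abs_of_nonneg (by linarith)] at h2
      rw [e3, abs_div, abs_two] at h3
      linarith
    · intro j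
      have hj : (0 : ℝ) ≤ j := Nat.cast_nonneg j
      linarith
    · intro j
      have hj : (0 : ℝ) ≤ j := Nat.cast_nonneg j
      linarith
    · have hb' : 0 < Real.Gamma (1 + |x| + b) := Real.Gamma_pos_of_pos (by linarith)
      refine mul_le_mul_of_nonneg_left ?_ (Real.exp_pos _).le
      rw [div_le_iff₀ hb']
      have := Real.Gamma_le_two_mul_Gamma_add (x := 1 + |x| + a) (δ := b - a) (by linarith)
        (by linarith)
      rwa [show 1 + |x| + a + (b - a) = 1 + |x| + b by ring] at this
  obtain ⟨C₁, hC₁, h₁⟩ := key 0 (jacobiRho α β / 2) le_rfl (by linarith)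
  obtain ⟨C₂, hC₂, h₂⟩ := key (1 / 2) ((α - β + 1) / 2) (by norm_num) (by linarith)
  refine ⟨‖((2 : ℂ) ^ (jacobiRho α β : ℂ))‖ * C₁ * C₂, fun x hx => ?_⟩
  have e := jacobiC_neg_eq α β (-x)
  rw [neg_neg, mul_assoc, ← mul_div, mul_div_mul_comm, div_eq_mul_inv, div_eq_mul_inv,
    ← mul_assoc] at e
  rw [e, norm_mul, norm_mul]
  gcongr
  · exact h₁ x hx
  · exact h₂ x hx

theorem jacobiC_ne_zero {α β : ℝ} {x : ℝ} (hx : x ≠ 0) : jacobiC α β x ≠ 0 := by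
  have e := jacobiC_neg_eq α β (-x)
  rw [neg_neg] at e
  have hG : ∀ a : ℝ, Complex.Gamma (-Complex.I * (-x : ℂ) / 2 + a) ≠ 0 := by
    intro a
    refine Complex.Gamma_ne_zero fun j hj => ?_
    have := congrArg Complex.im hj
    simp at this
    exact hx this
  rw [e]
  refine div_ne_zero (mul_ne_zero (mul_ne_zero ?_ (hG _)) (hG _)) (mul_ne_zero (hG _) (hG _))
  simp [Complex.cpow_eq_zero_iff]

/-! ### Calculus of power series on the unit disc -/

/-- The coefficients `f n` define a power series that converges absolutely on the unit disc. -/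
def SummableOnDisc (f : ℕ → ℂ) : Prop :=
  ∀ r : ℝ, 0 ≤ r → r < 1 → Summable fun n => ‖f n‖ * r ^ n

/-- The sum of a power series. -/
noncomputable def powSum (f : ℕ → ℂ) (z : ℂ) : ℂ := ∑' n, f n * z ^ n

namespace SummableOnDisc

variable {f g : ℕ → ℂ}

theorem summable_norm (hf : SummableOnDisc f) {z : ℂ} (hz : ‖z‖ < 1) :
    Summable fun n => ‖f n * z ^ n‖ := by
  simpa using hf ‖z‖ (norm_nonneg z) hz

theorem summable (hf : SummableOnDisc f) {z : ℂ} (hz : ‖z‖ < 1) :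
    Summable fun n => f n * z ^ n :=
  (hf.summable_norm hz).of_norm

theorem add (hf : SummableOnDisc f) (hg : SummableOnDisc g) :
    SummableOnDisc fun n => f n + g n := fun r h0 h1 => by
  refine Summable.of_nonneg_of_le (fun n => by positivity) (fun n => ?_)
    ((hf r h0 h1).add (hg r h0 h1))
  rw [← add_mul]
  exact mul_le_mul_of_nonneg_right (norm_add_le _ _) (by positivity)

theorem const_mul (hf : SummableOnDisc f) (c : ℂ) : SummableOnDisc fun n => c * f n :=
  fun r h0 h1 => by simpa [mul_assoc] using (hf r h0 h1).mul_left ‖c‖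

theorem nat_mul (hf : SummableOnDisc f) : SummableOnDisc fun n => n * f n := fun r h0 h1 => by
  obtain ⟨r', h2, h3⟩ := exists_between h1
  have hr' : 0 < r' := h0.trans_lt h2
  have hq : r / r' < 1 := (div_lt_one hr').2 h2
  obtain ⟨C, hC⟩ := (hf r' hr'.le h3).tendsto_atTop_zero.bddAbove_range
  have hs := (summable_pow_mul_geometric_of_norm_lt_one (R := ℝ) 1
    (by rwa [Real.norm_of_nonneg (by positivity)] : ‖r / r'‖ < 1)).mul_left C
  refine Summable.of_nonneg_of_le (fun n => by positivity) (fun n => ?_) hs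
  have h4 : ‖f n‖ * r' ^ n ≤ C := hC ⟨n, rfl⟩
  rw [norm_mul, Complex.norm_natCast, pow_one, div_pow]
  have h5 : (n : ℝ) * ‖f n‖ * r ^ n = ‖f n‖ * r' ^ n * (n * (r ^ n / r' ^ n)) := by field_simp
  rw [h5]
  exact mul_le_mul_of_nonneg_right h4 (by positivity)

theorem shift (hf : SummableOnDisc f) : SummableOnDisc fun n => f (n + 1) := fun r h0 h1 => by
  obtain ⟨r', h2, h3⟩ := exists_between h1
  have hr' : 0 < r' := h0.trans_lt h2
  have := ((summable_nat_add_iff 1).2 (hf r' hr'.le h3)).mul_left r'⁻¹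
  refine Summable.of_nonneg_of_le (fun n => by positivity) (fun n => ?_) this
  rw [pow_succ]
  have : r'⁻¹ * (‖f (n + 1)‖ * (r' ^ n * r')) = ‖f (n + 1)‖ * r' ^ n := by field_simp
  rw [this]
  gcongr

theorem deriv (hf : SummableOnDisc f) : SummableOnDisc fun n => ((n : ℂ) + 1) * f (n + 1) := by
  simpa using hf.nat_mul.shift

theorem hasDerivAt_powSum (hf : SummableOnDisc f) {z : ℂ} (hz : ‖z‖ < 1) :
    HasDerivAt (powSum f) (powSum (fun n => ((n : ℂ) + 1) * f (n + 1)) z) z := by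
  obtain ⟨r, h1, h2⟩ := exists_between hz
  have hr : 0 ≤ r := (norm_nonneg z).trans h1.le
  have hu := (summable_nat_add_iff (f := fun n : ℕ => ‖(n : ℂ) * f n‖ * r ^ (n - 1)) 1).1
    (by simpa using hf.deriv r hr h2)
  have key := hasDerivAt_tsum_of_isPreconnected (g := fun n z => f n * z ^ n)
    (g' := fun n z => f n * (n * z ^ (n - 1))) (y₀ := 0) (y := z) hu (Metric.isOpen_ball (x := 0) (ε := r))
    (convex_ball _ _).isPreconnected (fun n y _ => (hasDerivAt_pow n y).const_mul (f n)) ?_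
    (by simpa using (norm_nonneg z).trans_lt h1) (hf.summable (by simp)) (by simpa using h1)
  · have e : powSum (fun n => ((n : ℂ) + 1) * f (n + 1)) z = ∑' n, f n * (n * z ^ (n - 1)) := by
      rw [Summable.tsum_eq_zero_add]
      · simp only [powSum, CharP.cast_eq_zero, zero_mul, mul_zero, zero_add, Nat.cast_add,
          Nat.cast_one, add_tsub_cancel_right]
        exact tsum_congr fun n => by ring
      · refine (summable_nat_add_iff 1).1 ?_
        refine (hf.deriv.summable hz).congr fun n => ?_
        push_cast [add_tsub_cancel_right]; ring
    rw [e]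
    exact key
  · intro n y hy
    rw [mem_ball_zero_iff] at hy
    rw [norm_mul, norm_mul, norm_mul, norm_pow, ← mul_assoc, mul_comm ‖f n‖]
    gcongr

/-- This turns d/dz into the Euler operator z d/dz, which acts on coefficients as multiplication by
n. All differential equations below are verified in this form. -/
theorem mul_powSum_deriv (hf : SummableOnDisc f) {z : ℂ} (hz : ‖z‖ < 1) :
    z * powSum (fun n => ((n : ℂ) + 1) * f (n + 1)) z = powSum (fun n => n * f n) z := by
  unfold powSum
  rw [(hf.nat_mul.summable hz).tsum_eq_zero_add, ← tsum_mul_left]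
  simp only [CharP.cast_eq_zero, zero_mul, zero_add, Nat.cast_add, Nat.cast_one]
  exact tsum_congr fun n => by ring

theorem powSum_add (hf : SummableOnDisc f) (hg : SummableOnDisc g) {z : ℂ} (hz : ‖z‖ < 1) :
    powSum (fun n => f n + g n) z = powSum f z + powSum g z := by
  unfold powSum
  rw [← (hf.summable hz).tsum_add (hg.summable hz)]
  exact tsum_congr fun n => by ring

theorem powSum_mul (hf : SummableOnDisc f) (hg : SummableOnDisc g) {z : ℂ} (hz : ‖z‖ < 1) :
    powSum f z * powSum g z =
      powSum (fun n => ∑ k ∈ Finset.range (n + 1), f k * g (n - k)) z := by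
  unfold powSum
  rw [tsum_mul_tsum_eq_tsum_sum_range_of_summable_norm (hf.summable_norm hz) (hg.summable_norm hz)]
  refine tsum_congr fun n => ?_
  rw [Finset.sum_mul]
  refine Finset.sum_congr rfl fun k hk => ?_
  rw [← Nat.add_sub_of_le (Finset.mem_range_succ_iff.1 hk)]
  simp only [add_tsub_cancel_left, pow_add]
  ring

end SummableOnDisc

theorem powSum_const_mul (f : ℕ → ℂ) (c z : ℂ) : powSum (fun n => c * f n) z = c * powSum f z := by
  unfold powSum
  rw [← tsum_mul_left]
  exact tsum_congr fun n => by ring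

theorem powSum_zero (f : ℕ → ℂ) : powSum f 0 = f 0 := by
  unfold powSum
  rw [tsum_eq_single 0 (fun n hn => by simp [hn])]
  simp

/-! ### Exponential sums and Jost solutions -/

/-- The exponential sum `∑ f n e^{(iξ - 2n)t}`. -/
noncomputable def expSum (f : ℕ → ℂ) (ξ : ℂ) (t : ℝ) : ℂ :=
  Complex.exp (Complex.I * ξ * t) * powSum f (Complex.exp (-2 * t))

theorem norm_cexp_neg_two_mul (t : ℝ) : ‖Complex.exp (-2 * t)‖ = Real.exp (-2 * t) := by
  rw [Complex.norm_exp]; simp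

theorem norm_cexp_neg_two_mul_lt {t : ℝ} (ht : 0 < t) : ‖Complex.exp (-2 * t)‖ < 1 := by
  rw [norm_cexp_neg_two_mul, Real.exp_lt_one_iff]; linarith

theorem SummableOnDisc.hasDerivAt_expSum {f : ℕ → ℂ} (hf : SummableOnDisc f) (ξ : ℂ) {t : ℝ}
    (ht : 0 < t) :
    HasDerivAt (expSum f ξ) (expSum (fun n => (Complex.I * ξ - 2 * n) * f n) ξ t) t := by
  have hz := norm_cexp_neg_two_mul_lt ht
  have h1 : HasDerivAt (fun t : ℝ => Complex.exp (Complex.I * ξ * t))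
      (Complex.exp (Complex.I * ξ * t) * (Complex.I * ξ)) t := by
    have := ((hasDerivAt_id (t : ℂ)).const_mul (Complex.I * ξ)).cexp.comp_ofReal
    simpa using this
  have h2 : HasDerivAt (fun t : ℝ => Complex.exp (-2 * t)) (Complex.exp (-2 * t) * (-2)) t := by
    have := ((hasDerivAt_id (t : ℂ)).const_mul (-2)).cexp.comp_ofReal
    simpa using this
  have h3 := h1.mul ((hf.hasDerivAt_powSum hz).comp t h2)
  unfold expSum
  convert! h3 using 1
  have e1 : powSum (fun n => (Complex.I * ξ - 2 * n) * f n) (Complex.exp (-2 * t)) =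
      Complex.I * ξ * powSum f (Complex.exp (-2 * t)) +
        (-2) * powSum (fun n => n * f n) (Complex.exp (-2 * t)) := by
    rw [← powSum_const_mul, ← powSum_const_mul, ← (hf.const_mul _).powSum_add (hf.nat_mul.const_mul _) hz]
    congr 1; funext n; ring
  rw [e1, ← hf.mul_powSum_deriv hz]
  simp only [Function.comp_apply]
  ring

theorem SummableOnDisc.tendsto_expSum {f : ℕ → ℂ} (hf : SummableOnDisc f) (ξ : ℂ) :
    Tendsto (fun t : ℝ => Complex.exp (-(Complex.I * ξ * t)) * expSum f ξ t) atTop (𝓝 (f 0)) := by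
  have e : ∀ t : ℝ, Complex.exp (-(Complex.I * ξ * t)) * expSum f ξ t =
      powSum f (Complex.exp (-2 * t)) := by
    intro t
    rw [expSum, ← mul_assoc, ← Complex.exp_add]; simp
  simp_rw [e]
  rw [← powSum_zero f]
  refine ((hf.hasDerivAt_powSum (z := 0) (by simp)).continuousAt.tendsto).comp ?_
  rw [tendsto_zero_iff_norm_tendsto_zero]
  simp_rw [norm_cexp_neg_two_mul]
  exact Real.tendsto_exp_atBot.comp (tendsto_id.const_mul_atTop_of_neg (by norm_num))

/-- The potential of the Jacobi operator in Liouville normal form. -/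
noncomputable def jacobiPot (α β t : ℝ) : ℝ :=
  (α ^ 2 - 1 / 4) / Real.sinh t ^ 2 - (β ^ 2 - 1 / 4) / Real.cosh t ^ 2

/-- The coefficients of `jacobiPot` as a power series in `e^{-2t}`. -/
noncomputable def jacobiPotCoeff (α β : ℝ) (n : ℕ) : ℂ :=
  4 * n * ((α ^ 2 - 1 / 4 : ℝ) + (-1) ^ n * (β ^ 2 - 1 / 4 : ℝ))

/-- The coefficients of the solution of `v'' = (q - ξ²) v` asymptotic to `e^{iξt}`. -/
noncomputable def jostCoeff (α β : ℝ) (ξ : ℂ) : ℕ → ℂ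
  | 0 => 1
  | n + 1 => (∑ j : Fin (n + 1), jostCoeff α β ξ j * jacobiPotCoeff α β (n + 1 - j)) /
      (4 * (n + 1) * ((n + 1) - Complex.I * ξ))

theorem jostCoeff_zero (α β : ℝ) (ξ : ℂ) : jostCoeff α β ξ 0 = 1 := by
  rw [jostCoeff]

theorem jostCoeff_succ (α β : ℝ) (ξ : ℂ) (n : ℕ) : jostCoeff α β ξ (n + 1) =
    (∑ j ∈ Finset.range (n + 1), jostCoeff α β ξ j * jacobiPotCoeff α β (n + 1 - j)) /
      (4 * (n + 1) * ((n + 1) - Complex.I * ξ)) := by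
  rw [jostCoeff, Finset.sum_range]

/-- The Jost solution of `v'' = (q - ξ²) v`. -/
noncomputable def jost (α β : ℝ) (ξ : ℂ) (t : ℝ) : ℂ := expSum (jostCoeff α β ξ) ξ t

theorem norm_jacobiPotCoeff_le (α β : ℝ) (n : ℕ) :
    ‖jacobiPotCoeff α β n‖ ≤ 4 * n * (|α ^ 2 - 1 / 4| + |β ^ 2 - 1 / 4|) := by
  unfold jacobiPotCoeff
  rw [norm_mul, norm_mul, Complex.norm_natCast, Complex.norm_ofNat]
  gcongr
  refine (norm_add_le _ _).trans ?_
  rw [norm_mul, norm_pow, norm_neg, norm_one, one_pow, one_mul, Complex.norm_real,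
    Complex.norm_real, Real.norm_eq_abs, Real.norm_eq_abs]

/-- Since ‖q_k‖ ≤ 4kB, the recursion bounds a_{n+1} by Q/(n+1) times the sum of the preceding ‖a_j‖.
These partial sums thus grow at most by the factors 1 + Q/(n+1), whose product is the binomial
coefficient. The growth is polynomial in n and uniform in ξ, given the lower bound on the
denominators. -/
theorem norm_jostCoeff_le {α β κ : ℝ} (hκ : 0 < κ) {Q : ℕ}
    (hQ : (|α ^ 2 - 1 / 4| + |β ^ 2 - 1 / 4|) / κ ≤ Q) {ξ : ℂ}
    (hξ : ∀ k : ℕ, κ * (k + 1) ≤ ‖((k : ℂ) + 1) - Complex.I * ξ‖) (n : ℕ) :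
    ‖jostCoeff α β ξ n‖ ≤ (n + Q).choose Q := by
  set B := |α ^ 2 - 1 / 4| + |β ^ 2 - 1 / 4| with hB
  have hB0 : 0 ≤ B := by positivity
  have hstep : ∀ n : ℕ, ‖jostCoeff α β ξ (n + 1)‖ ≤
      Q / (n + 1) * ∑ j ∈ Finset.range (n + 1), ‖jostCoeff α β ξ j‖ := by
    intro n
    have hn : (0 : ℝ) < n + 1 := by positivity
    rw [jostCoeff_succ, norm_div]
    have hnum : ‖∑ j ∈ Finset.range (n + 1), jostCoeff α β ξ j * jacobiPotCoeff α β (n + 1 - j)‖ ≤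
        4 * (n + 1) * B * ∑ j ∈ Finset.range (n + 1), ‖jostCoeff α β ξ j‖ := by
      rw [Finset.mul_sum]
      refine (norm_sum_le _ _).trans (Finset.sum_le_sum fun j hj => ?_)
      rw [norm_mul, mul_comm]
      refine mul_le_mul_of_nonneg_right ((norm_jacobiPotCoeff_le α β _).trans ?_) (norm_nonneg _)
      gcongr
      have : ((n + 1 - j : ℕ) : ℝ) ≤ ((n + 1 : ℕ) : ℝ) := by exact_mod_cast Nat.sub_le _ _
      simpa using this
    have hden : 4 * (n + 1 : ℝ) * (κ * (n + 1)) ≤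
        ‖4 * ((n : ℂ) + 1) * (((n : ℂ) + 1) - Complex.I * ξ)‖ := by
      rw [norm_mul, norm_mul, Complex.norm_ofNat]
      have : ‖(n : ℂ) + 1‖ = n + 1 := by
        have := Complex.norm_natCast (n + 1); push_cast at this; exact this
      rw [this]
      gcongr
      exact hξ n
    have hS : 0 ≤ ∑ j ∈ Finset.range (n + 1), ‖jostCoeff α β ξ j‖ :=
      Finset.sum_nonneg fun _ _ => norm_nonneg _
    calc _ ≤ 4 * (n + 1) * B * (∑ j ∈ Finset.range (n + 1), ‖jostCoeff α β ξ j‖) /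
          (4 * (n + 1 : ℝ) * (κ * (n + 1))) := by gcongr
      _ = B / κ / (n + 1) * ∑ j ∈ Finset.range (n + 1), ‖jostCoeff α β ξ j‖ := by
          field_simp
      _ ≤ _ := by gcongr
  have hsum : ∀ n : ℕ, ∑ j ∈ Finset.range (n + 1), ‖jostCoeff α β ξ j‖ ≤ (n + Q).choose Q := by
    intro n
    induction n with
    | zero => simp [jostCoeff_zero]
    | succ n ih =>
      rw [Finset.sum_range_succ]
      have h1 := hstep n
      have hn : (0 : ℝ) < n + 1 := by positivity
      have h2 : ((n + 1 + Q).choose Q : ℝ) * (n + 1) = (n + Q).choose Q * (n + 1 + Q) := by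
        have := Nat.choose_mul_succ_eq (n + Q) Q
        rw [show n + Q + 1 - Q = n + 1 by omega, show n + Q + 1 = n + 1 + Q by ring] at this
        exact_mod_cast this.symm
      have h3 : ((n + 1 + Q).choose Q : ℝ) = (n + Q).choose Q + Q / (n + 1) * (n + Q).choose Q := by
        field_simp; linarith
      rw [h3]
      refine add_le_add ih (h1.trans ?_)
      gcongr
  refine le_trans ?_ (hsum n)
  exact Finset.single_le_sum (f := fun j => ‖jostCoeff α β ξ j‖) (fun _ _ => norm_nonneg _)
    (Finset.self_mem_range_succ n)

theorem summable_choose_mul_pow (Q : ℕ) {r : ℝ} (h0 : 0 ≤ r) (h1 : r < 1) :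
    Summable fun n : ℕ => ((n + Q).choose Q : ℝ) * r ^ n :=
  summable_choose_mul_geometric_of_norm_lt_one Q (by rwa [Real.norm_of_nonneg h0])

theorem summableOnDisc_of_norm_le_choose {f : ℕ → ℂ} {Q : ℕ}
    (h : ∀ n, ‖f n‖ ≤ (n + Q).choose Q) : SummableOnDisc f := fun r h0 h1 =>
  Summable.of_nonneg_of_le (fun n => by positivity)
    (fun n => mul_le_mul_of_nonneg_right (h n) (by positivity)) (summable_choose_mul_pow Q h0 h1)

/-- The half-plane Im ξ ≥ -1/2 leaves a strip around the real axis in which both ξ and -ξ are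
admissible, so that two Jost solutions are available there. -/
theorem half_mul_le_norm_sub_I_mul {ξ : ℂ} (hξ : -(1 / 2) ≤ ξ.im) (k : ℕ) :
    1 / 2 * ((k : ℝ) + 1) ≤ ‖((k : ℂ) + 1) - Complex.I * ξ‖ := by
  have h := Complex.re_le_norm (((k : ℂ) + 1) - Complex.I * ξ)
  have e : (((k : ℂ) + 1) - Complex.I * ξ).re = k + 1 + ξ.im := by simp
  rw [e] at h
  have : (0 : ℝ) ≤ k := Nat.cast_nonneg k
  linarith

theorem summableOnDisc_jostCoeff (α β : ℝ) {ξ : ℂ} (hξ : -(1 / 2) ≤ ξ.im) :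
    SummableOnDisc (jostCoeff α β ξ) := by
  obtain ⟨Q, hQ⟩ := exists_nat_ge ((|α ^ 2 - 1 / 4| + |β ^ 2 - 1 / 4|) / (1 / 2))
  exact summableOnDisc_of_norm_le_choose
    (norm_jostCoeff_le (by norm_num) hQ (half_mul_le_norm_sub_I_mul hξ))

theorem summableOnDisc_jacobiPotCoeff (α β : ℝ) : SummableOnDisc (jacobiPotCoeff α β) := by
  have h1 : SummableOnDisc fun _ => 1 := fun r h0 h1 => by
    simpa using summable_geometric_of_lt_one h0 h1
  have h2 : SummableOnDisc fun n => (-1) ^ n := fun r h0 h1 => by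
    simpa using summable_geometric_of_lt_one h0 h1
  have h3 := ((h1.const_mul ((α ^ 2 - 1 / 4 : ℝ) : ℂ)).add
    (h2.const_mul ((β ^ 2 - 1 / 4 : ℝ) : ℂ))).nat_mul.const_mul 4
  convert h3 using 2 with n
  unfold jacobiPotCoeff
  ring

/-- With x = e^{-2t} one has sinh² t = (1 - x)²/(4x) and cosh² t = (1 + x)²/(4x); the rest is ∑ n
x^n = x/(1 - x)², at x and at -x. -/
theorem powSum_jacobiPotCoeff (α β : ℝ) {t : ℝ} (ht : 0 < t) :
    powSum (jacobiPotCoeff α β) (Complex.exp (-2 * t)) = jacobiPot α β t := by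
  set x : ℝ := Real.exp (-2 * t) with hx
  have hx0 : 0 < x := Real.exp_pos _
  have hx1 : x < 1 := by rw [hx, Real.exp_lt_one_iff]; linarith
  have e0 : Complex.exp (-2 * t) = (x : ℂ) := by rw [hx]; push_cast; rfl
  have hxn : ‖(x : ℂ)‖ < 1 := by rwa [Complex.norm_real, Real.norm_of_nonneg hx0.le]
  have h1 := hasSum_coe_mul_geometric_of_norm_lt_one hxn
  have h2 := hasSum_coe_mul_geometric_of_norm_lt_one (r := -(x : ℂ)) (by rwa [norm_neg])
  have h3 := (h1.mul_left (4 * ((α ^ 2 - 1 / 4 : ℝ) : ℂ))).add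
    (h2.mul_left (4 * ((β ^ 2 - 1 / 4 : ℝ) : ℂ)))
  have e1 : (fun n : ℕ => 4 * ((α ^ 2 - 1 / 4 : ℝ) : ℂ) * (n * (x : ℂ) ^ n) +
      4 * ((β ^ 2 - 1 / 4 : ℝ) : ℂ) * (n * (-(x : ℂ)) ^ n)) =
      fun n => jacobiPotCoeff α β n * (x : ℂ) ^ n := by
    funext n
    unfold jacobiPotCoeff
    rw [neg_pow]; ring
  rw [e1] at h3
  rw [e0, powSum, h3.tsum_eq]
  have hs : Real.sinh t ^ 2 = (1 - x) ^ 2 / (4 * x) := by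
    rw [Real.sinh_eq, hx, show -2 * t = -t + -t by ring, Real.exp_add]
    have := Real.exp_pos (-t)
    have h := Real.exp_neg t
    have : Real.exp t = (Real.exp (-t))⁻¹ := by rw [h, inv_inv]
    rw [this]; field_simp; ring
  have hc : Real.cosh t ^ 2 = (1 + x) ^ 2 / (4 * x) := by
    rw [Real.cosh_eq, hx, show -2 * t = -t + -t by ring, Real.exp_add]
    have := Real.exp_pos (-t)
    have h := Real.exp_neg t
    have : Real.exp t = (Real.exp (-t))⁻¹ := by rw [h, inv_inv]
    rw [this]; field_simp; norm_num
  unfold jacobiPot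
  rw [hs, hc]
  have g1 : (1 - x : ℂ) ≠ 0 := by
    rw [← Complex.ofReal_one, ← Complex.ofReal_sub]; exact_mod_cast (by linarith : (1 - x) ≠ 0)
  have g2 : (1 + x : ℂ) ≠ 0 := by
    rw [← Complex.ofReal_one, ← Complex.ofReal_add]; exact_mod_cast (by linarith : (1 + x) ≠ 0)
  have g3 : (x : ℂ) ≠ 0 := by exact_mod_cast hx0.ne'
  push_cast
  rw [sub_neg_eq_add]
  field_simp
  ring

theorem jostCoeff_recurrence (α β : ℝ) {ξ : ℂ} (hξ : -(1 / 2) ≤ ξ.im) (n : ℕ) :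
    4 * n * (n - Complex.I * ξ) * jostCoeff α β ξ n =
      ∑ j ∈ Finset.range (n + 1), jostCoeff α β ξ j * jacobiPotCoeff α β (n - j) := by
  have hq : jacobiPotCoeff α β 0 = 0 := by simp [jacobiPotCoeff]
  cases n with
  | zero => simp [hq]
  | succ n =>
    rw [Finset.sum_range_succ, Nat.sub_self, hq, mul_zero, add_zero, jostCoeff_succ]
    have h := half_mul_le_norm_sub_I_mul hξ n
    have h1 : ((n : ℂ) + 1) - Complex.I * ξ ≠ 0 := norm_pos_iff.1 (lt_of_lt_of_le (by positivity) h)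
    have h2 : (n : ℂ) + 1 ≠ 0 := by exact_mod_cast n.succ_ne_zero
    push_cast
    rw [mul_div_cancel₀]
    exact mul_ne_zero (mul_ne_zero (by norm_num) h2) h1

/-- The derivative of the Jost solution. -/
noncomputable def jostDeriv (α β : ℝ) (ξ : ℂ) (t : ℝ) : ℂ :=
  expSum (fun n => (Complex.I * ξ - 2 * n) * jostCoeff α β ξ n) ξ t

theorem hasDerivAt_jost (α β : ℝ) {ξ : ℂ} (hξ : -(1 / 2) ≤ ξ.im) {t : ℝ} (ht : 0 < t) :
    HasDerivAt (jost α β ξ) (jostDeriv α β ξ t) t :=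
  (summableOnDisc_jostCoeff α β hξ).hasDerivAt_expSum ξ ht

theorem summableOnDisc_jostDeriv (α β : ℝ) {ξ : ℂ} (hξ : -(1 / 2) ≤ ξ.im) :
    SummableOnDisc fun n => (Complex.I * ξ - 2 * n) * jostCoeff α β ξ n := by
  have h := summableOnDisc_jostCoeff α β hξ
  convert (h.const_mul (Complex.I * ξ)).add (h.nat_mul.const_mul (-2)) using 2 with n
  ring

/-- Two differentiations multiply the nth coefficient by (iξ - 2n)² = -ξ² + 4n(n - iξ). By the
recurrence the second summand produces the Cauchy product of the series of the potential and of the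
solution. -/
theorem hasDerivAt_jostDeriv (α β : ℝ) {ξ : ℂ} (hξ : -(1 / 2) ≤ ξ.im) {t : ℝ} (ht : 0 < t) :
    HasDerivAt (jostDeriv α β ξ) ((jacobiPot α β t - ξ ^ 2) * jost α β ξ t) t := by
  have hg := summableOnDisc_jostCoeff α β hξ
  have hz := norm_cexp_neg_two_mul_lt ht
  convert! (summableOnDisc_jostDeriv α β hξ).hasDerivAt_expSum ξ ht using 1
  unfold jost expSum
  rw [mul_left_comm]
  congr 1
  rw [← powSum_jacobiPotCoeff α β ht]
  have e : (fun n : ℕ => (Complex.I * ξ - 2 * n) * ((Complex.I * ξ - 2 * n) * jostCoeff α β ξ n)) =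
      fun n => (-ξ ^ 2) * jostCoeff α β ξ n +
        ∑ j ∈ Finset.range (n + 1), jostCoeff α β ξ j * jacobiPotCoeff α β (n - j) := by
    funext n
    rw [← jostCoeff_recurrence α β hξ n]
    linear_combination (ξ ^ 2 * jostCoeff α β ξ n) * Complex.I_sq
  rw [e]
  have hconv : SummableOnDisc fun n =>
      ∑ j ∈ Finset.range (n + 1), jostCoeff α β ξ j * jacobiPotCoeff α β (n - j) := by
    have : (fun n => ∑ j ∈ Finset.range (n + 1), jostCoeff α β ξ j * jacobiPotCoeff α β (n - j)) =
        fun n : ℕ => 4 * (n * (n * jostCoeff α β ξ n)) +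
          (-(4 * Complex.I * ξ)) * (n * jostCoeff α β ξ n) := by
      funext n; rw [← jostCoeff_recurrence α β hξ n]; ring
    rw [this]
    exact (hg.nat_mul.nat_mul.const_mul 4).add (hg.nat_mul.const_mul _)
  rw [(hg.const_mul _).powSum_add hconv hz, powSum_const_mul,
    ← hg.powSum_mul (summableOnDisc_jacobiPotCoeff α β) hz]
  ring

theorem differentiableAt_jostCoeff (α β : ℝ) {ξ : ℂ}
    (hξ : ∀ k : ℕ, ((k : ℂ) + 1) - Complex.I * ξ ≠ 0) (n : ℕ) :
    DifferentiableAt ℂ (fun ξ => jostCoeff α β ξ n) ξ := by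
  induction n using Nat.strong_induction_on with
  | _ n ih =>
    cases n with
    | zero => simp_rw [jostCoeff_zero]; fun_prop
    | succ n =>
      simp_rw [jostCoeff_succ]
      refine DifferentiableAt.div ?_ (by fun_prop) ?_
      · refine DifferentiableAt.fun_sum fun j hj => ?_
        exact (ih j (Finset.mem_range.1 hj)).mul_const _
      · have h2 : (n : ℂ) + 1 ≠ 0 := by exact_mod_cast n.succ_ne_zero
        exact mul_ne_zero (mul_ne_zero (by norm_num) h2) (hξ n)

/-! ### Hypergeometric series: equation, Euler integral, limit at 1, transformations -/

theorem ordinaryHypergeometric_eq_powSum (a b c z : ℂ) :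
    ordinaryHypergeometric a b c z = powSum (ordinaryHypergeometricCoefficient a b c) z := by
  rw [ordinaryHypergeometric_eq_tsum]
  rfl

theorem norm_ascPochhammer_eval_le {a : ℂ} {A : ℝ} (h : ‖a‖ ≤ A) (n : ℕ) :
    ‖(ascPochhammer ℂ n).eval a‖ ≤ (ascPochhammer ℝ n).eval A := by
  have hA : 0 ≤ A := (norm_nonneg a).trans h
  induction n with
  | zero => simp
  | succ n ih =>
    rw [ascPochhammer_succ_eval, ascPochhammer_succ_eval, norm_mul]
    have h1 : ‖a + n‖ ≤ A + n := by
      refine (norm_add_le _ _).trans ?_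
      rw [Complex.norm_natCast]; gcongr
    have h2 := (norm_nonneg _).trans ih
    gcongr

theorem ascPochhammer_eval_ofReal (c : ℝ) (n : ℕ) :
    (ascPochhammer ℂ n).eval (c : ℂ) = ((ascPochhammer ℝ n).eval c : ℝ) := by
  induction n with
  | zero => simp
  | succ n ih =>
    rw [ascPochhammer_succ_eval, ascPochhammer_succ_eval, ih]; push_cast; rfl

/-- A majorant with positive parameters, locally uniform in a and b; it gives convergence on the
disc and joint continuity in parameters and argument. -/
theorem norm_ordinaryHypergeometricCoefficient_le {a b : ℂ} {A B c : ℝ} (ha : ‖a‖ ≤ A)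
    (hb : ‖b‖ ≤ B) (hc : 0 < c) (n : ℕ) :
    ‖ordinaryHypergeometricCoefficient a b (c : ℂ) n‖ ≤
      ordinaryHypergeometricCoefficient A B c n := by
  have hc' := ascPochhammer_pos n c hc
  unfold ordinaryHypergeometricCoefficient
  rw [norm_mul, norm_mul, norm_mul, norm_inv, norm_inv, Complex.norm_natCast,
    ascPochhammer_eval_ofReal, Complex.norm_real, Real.norm_of_nonneg hc'.le]
  have h1 := norm_ascPochhammer_eval_le ha n
  have h2 := norm_ascPochhammer_eval_le hb n
  have h3 := (norm_nonneg _).trans h1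
  gcongr

theorem summable_ordinaryHypergeometricCoefficient {A B c : ℝ} (hA : 0 < A) (hB : 0 < B)
    (hc : 0 < c) {r : ℝ} (h0 : 0 ≤ r) (h1 : r < 1) :
    Summable fun n => ordinaryHypergeometricCoefficient A B c n * r ^ n := by
  have hrad := ordinaryHypergeometricSeries_radius_eq_one ℝ A B c (fun k => by
    have : (0 : ℝ) ≤ k := Nat.cast_nonneg k
    refine ⟨?_, ?_, ?_⟩ <;> intro h <;> linarith)
  have := (ordinaryHypergeometricSeries ℝ A B c).summable_norm_apply (x := r) (by
    rw [hrad, Metric.mem_eball, edist_zero_right, enorm_eq_nnnorm]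
    exact_mod_cast (by rwa [← NNReal.coe_lt_coe, coe_nnnorm, Real.norm_of_nonneg h0] : ‖r‖₊ < 1))
  refine this.of_norm.congr fun n => ?_
  rw [ordinaryHypergeometricSeries_apply_eq]
  rfl

theorem summableOnDisc_ordinaryHypergeometricCoefficient (a b : ℂ) {c : ℝ} (hc : 0 < c) :
    SummableOnDisc (ordinaryHypergeometricCoefficient a b (c : ℂ)) := fun r h0 h1 =>
  Summable.of_nonneg_of_le (fun n => by positivity)
    (fun n => mul_le_mul_of_nonneg_right (norm_ordinaryHypergeometricCoefficient_le
      (A := ‖a‖ + 1) (B := ‖b‖ + 1) (by linarith) (by linarith) hc n) (by positivity))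
    (summable_ordinaryHypergeometricCoefficient (by positivity) (by positivity) hc h0 h1)

theorem ordinaryHypergeometricCoefficient_succ (a b : ℂ) {c : ℝ} (hc : 0 < c) (n : ℕ) :
    ((n : ℂ) + 1) * (n + c) * ordinaryHypergeometricCoefficient a b (c : ℂ) (n + 1) =
      (n + a) * (n + b) * ordinaryHypergeometricCoefficient a b (c : ℂ) n := by
  have h1 : (n : ℂ) + 1 ≠ 0 := by exact_mod_cast n.succ_ne_zero
  have h2 : (c : ℂ) + n ≠ 0 := by exact_mod_cast (by positivity : c + n ≠ 0)
  have h3 : (ascPochhammer ℂ n).eval (c : ℂ) ≠ 0 := by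
    rw [ascPochhammer_eval_ofReal]; exact_mod_cast (ascPochhammer_pos n c hc).ne'
  have h4 : ((Nat.factorial n : ℕ) : ℂ) ≠ 0 := by exact_mod_cast Nat.factorial_ne_zero n
  unfold ordinaryHypergeometricCoefficient
  rw [ascPochhammer_succ_eval, ascPochhammer_succ_eval, ascPochhammer_succ_eval, Nat.factorial_succ]
  push_cast
  rw [add_comm (n : ℂ) (c : ℂ)]
  field_simp
  ring

/-- The hypergeometric equation in terms of the Euler operator `θ = z d/dz`. -/
theorem hypergeometric_euler_equation (a b : ℂ) {c : ℝ} (hc : 0 < c) {z : ℂ} (hz : ‖z‖ < 1) :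
    let f := ordinaryHypergeometricCoefficient a b (c : ℂ)
    (1 - z) * powSum (fun n => n * (n * f n)) z =
      (z * (a + b) - (c - 1)) * powSum (fun n => n * f n) z + z * (a * b) * powSum f z := by
  intro f
  have hf : SummableOnDisc f := summableOnDisc_ordinaryHypergeometricCoefficient a b hc
  have e1 : powSum (fun n => n * (n * f n)) z + (c - 1) * powSum (fun n => n * f n) z =
      powSum (fun n => n * ((n + (c - 1)) * f n)) z := by
    rw [← powSum_const_mul, ← hf.nat_mul.nat_mul.powSum_add (hf.nat_mul.const_mul _) hz]
    congr 1; funext n; ring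
  have hg : SummableOnDisc fun n => ((n : ℂ) + (c - 1)) * f n := by
    convert hf.nat_mul.add (hf.const_mul (c - 1)) using 2 with n; ring
  have e2 : powSum (fun n => n * ((n + (c - 1)) * f n)) z =
      z * powSum (fun n => (n + a) * (n + b) * f n) z := by
    rw [← hg.mul_powSum_deriv hz]
    congr 2; funext n
    rw [← ordinaryHypergeometricCoefficient_succ a b hc n]
    push_cast; ring
  have e3 : powSum (fun n => ((n : ℂ) + a) * (n + b) * f n) z =
      powSum (fun n => n * (n * f n)) z + ((a + b) * powSum (fun n => n * f n) z +
        a * b * powSum f z) := by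
    rw [← powSum_const_mul, ← powSum_const_mul,
      ← (hf.nat_mul.const_mul _).powSum_add (hf.const_mul _) hz,
      ← hf.nat_mul.nat_mul.powSum_add ((hf.nat_mul.const_mul _).add (hf.const_mul _)) hz]
    congr 1; funext n; ring
  rw [e3] at e2
  linear_combination e1 + e2

/-- The binomial series is ₂F₁(a, 1; 1; w), where the last two parameters cancel. -/
theorem one_sub_cpow_neg_eq_tsum (a : ℂ) {w : ℂ} (hw : ‖w‖ < 1) :
    HasSum (fun n : ℕ => ((Nat.factorial n : ℂ))⁻¹ * (ascPochhammer ℂ n).eval a * w ^ n)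
      ((1 - w) ^ (-a)) := by
  have h := (Complex.one_add_cpow_hasFPowerSeriesOnBall_zero (a := -a)).hasSum (y := -w) (by
    rw [Metric.mem_eball, edist_zero_right, enorm_eq_nnnorm]
    exact_mod_cast (by rwa [← NNReal.coe_lt_coe, coe_nnnorm, norm_neg] : ‖-w‖₊ < 1))
  rw [binomialSeries_eq_ordinaryHypergeometricSeries (b := 1)
    (fun k hk => by have : ((k : ℂ) + 1) = 0 := by rw [hk]; ring
                    exact absurd this (by exact_mod_cast k.succ_ne_zero))] at h
  simp only [neg_neg, zero_add, FormalMultilinearSeries.compContinuousLinearMap_apply] at h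
  rw [← sub_eq_add_neg] at h
  convert! h using 2 with n
  have h1 : (ascPochhammer ℂ n).eval 1 ≠ 0 := by
    rw [← Complex.ofReal_one, ascPochhammer_eval_ofReal]
    exact_mod_cast (ascPochhammer_pos n (1 : ℝ) one_pos).ne'
  have e : (⇑(-ContinuousLinearMap.id ℂ ℂ) ∘ fun _ : Fin n => -w) = fun _ => w := by
    funext i; simp
  rw [e, ordinaryHypergeometricSeries_apply_eq, smul_eq_mul, mul_assoc _ _ ((_ : ℂ)⁻¹),
    mul_inv_cancel₀ h1, mul_one]

theorem betaIntegral_add_nat {b d : ℂ} (hb : 0 < b.re) (hd : 0 < d.re) (n : ℕ) :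
    Complex.betaIntegral (b + n) d = (ascPochhammer ℂ n).eval b *
      ((ascPochhammer ℂ n).eval (b + d))⁻¹ * Complex.betaIntegral b d := by
  have hne : ∀ u : ℂ, 0 < u.re → ∀ k : ℕ, u ≠ -k := by
    intro u hu k hk
    rw [hk] at hu; simp at hu
    exact absurd hu (not_lt.2 (Nat.cast_nonneg k))
  have hbd : 0 < (b + d).re := by rw [Complex.add_re]; linarith
  have hn : (0 : ℝ) ≤ n := Nat.cast_nonneg n
  rw [Complex.betaIntegral_eq_Gamma_mul_div _ _ (by simp; linarith) hd,
    Complex.betaIntegral_eq_Gamma_mul_div _ _ hb hd,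
    ← Complex.Gamma_add_nat_div_Gamma_eq b (hne b hb),
    ← Complex.Gamma_add_nat_div_Gamma_eq (b + d) (hne _ hbd), add_right_comm]
  have h1 := Complex.Gamma_ne_zero_of_re_pos hb
  have h2 := Complex.Gamma_ne_zero_of_re_pos hbd
  field_simp

/-- Euler's integral: (1 - zx)^{-a} is expanded by the binomial series and integrated term by term
against the Beta density. The series at |z| dominates. -/
theorem betaIntegral_mul_ordinaryHypergeometric (a : ℂ) {b : ℂ} {c : ℝ} (hb : 0 < b.re)
    (hcb : 0 < ((c : ℂ) - b).re) {z : ℝ} (hz : |z| < 1) :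
    Complex.betaIntegral b (c - b) * ordinaryHypergeometric a b (c : ℂ) (z : ℂ) =
      ∫ x : ℝ in (0 : ℝ)..1, (x : ℂ) ^ (b - 1) * (1 - (x : ℂ)) ^ ((c : ℂ) - b - 1) *
        (1 - (z : ℂ) * x) ^ (-a) := by
  set w : ℝ → ℂ := fun x => (x : ℂ) ^ (b - 1) * (1 - (x : ℂ)) ^ ((c : ℂ) - b - 1) with hw
  set k : ℕ → ℂ := fun n => ((Nat.factorial n : ℂ))⁻¹ * (ascPochhammer ℂ n).eval a with hk
  have hwi : IntervalIntegrable w volume 0 1 := Complex.betaIntegral_convergent hb hcb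
  have hzx : ∀ x ∈ Ioc (0 : ℝ) 1, ‖(z : ℂ) * x‖ < 1 := by
    intro x hx
    rw [norm_mul, Complex.norm_real, Complex.norm_real, Real.norm_of_nonneg hx.1.le,
      Real.norm_eq_abs]
    nlinarith [hx.1, hx.2, abs_nonneg z]
  have hsum := (one_sub_cpow_neg_eq_tsum a (w := (|z| : ℝ)) (by simpa using hz)).summable.norm
  have key := intervalIntegral.hasSum_integral_of_dominated_convergence (μ := volume) (a := 0)
    (b := 1) (F := fun n x => w x * (k n * ((z : ℂ) * x) ^ n))
    (f := fun x => w x * (1 - (z : ℂ) * x) ^ (-a))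
    (fun n x => ‖k n * ((|z| : ℝ) : ℂ) ^ n‖ * ‖w x‖) ?_ ?_ ?_ ?_ ?_
  · refine Eq.trans ?_ key.tsum_eq
    rw [ordinaryHypergeometric_eq_powSum, powSum, ← tsum_mul_left]
    refine tsum_congr fun n => ?_
    have e : ∀ x ∈ uIoc (0 : ℝ) 1, w x * (k n * ((z : ℂ) * x) ^ n) =
        (k n * (z : ℂ) ^ n) * ((x : ℂ) ^ (b + n - 1) * (1 - (x : ℂ)) ^ ((c : ℂ) - b - 1)) := by
      intro x hx
      rw [uIoc_of_le zero_le_one] at hx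
      have hx0 : (x : ℂ) ≠ 0 := by exact_mod_cast hx.1.ne'
      rw [hw, show b + n - 1 = b - 1 + n by ring, Complex.cpow_add _ _ hx0, Complex.cpow_natCast,
        mul_pow]
      ring
    rw [intervalIntegral.integral_congr_ae (Eventually.of_forall e), intervalIntegral.integral_const_mul]
    have hB := betaIntegral_add_nat hb hcb n
    rw [add_sub_cancel] at hB
    change _ = k n * (z : ℂ) ^ n * Complex.betaIntegral (b + n) (c - b)
    rw [hB]
    ring
  · intro n
    refine (hwi.def'.aestronglyMeasurable).mul ?_
    exact Continuous.aestronglyMeasurable (by fun_prop)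
  · intro n
    refine Eventually.of_forall fun x hx => ?_
    rw [uIoc_of_le zero_le_one] at hx
    rw [norm_mul, mul_comm]
    refine mul_le_mul_of_nonneg_right ?_ (norm_nonneg _)
    rw [norm_mul (k n), norm_mul (k n), norm_pow, norm_pow]
    refine mul_le_mul_of_nonneg_left (pow_le_pow_left₀ (norm_nonneg _) ?_ _) (norm_nonneg _)
    rw [norm_mul, Complex.norm_real, Complex.norm_real, Complex.norm_real, Real.norm_eq_abs,
      Real.norm_eq_abs, Real.norm_eq_abs, abs_abs, abs_of_pos hx.1]
    exact mul_le_of_le_one_right (abs_nonneg z) hx.2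
  · exact Eventually.of_forall fun x _ => hsum.mul_right _
  · simp_rw [tsum_mul_right]
    exact hwi.norm.const_mul _
  · refine Eventually.of_forall fun x hx => ?_
    rw [uIoc_of_le zero_le_one] at hx
    exact (one_sub_cpow_neg_eq_tsum a (hzx x hx)).mul_left _

/-- Gauss' value at 1 as a one-sided limit. In Euler's integral |(1 - zx)^{-a}| ≤ |(1 - x)^{-a}|
because Re a > 0, so dominated convergence leads to a Beta integral with parameters b and c - b - a.
-/
theorem tendsto_ordinaryHypergeometric_one {a b : ℂ} {c : ℝ} (ha : 0 < a.re) (hb : 0 < b.re)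
    (hcb : 0 < ((c : ℂ) - b).re) (hcab : 0 < ((c : ℂ) - b - a).re) :
    Tendsto (fun z : ℝ => ordinaryHypergeometric a b (c : ℂ) (z : ℂ)) (𝓝[<] 1)
      (𝓝 (Complex.Gamma c * Complex.Gamma (c - b - a) /
        (Complex.Gamma (c - a) * Complex.Gamma (c - b)))) := by
  have hlim : Tendsto (fun z : ℝ => ∫ x : ℝ in (0 : ℝ)..1, (x : ℂ) ^ (b - 1) *
      (1 - (x : ℂ)) ^ ((c : ℂ) - b - 1) * (1 - (z : ℂ) * x) ^ (-a)) (𝓝[<] 1)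
      (𝓝 (∫ x : ℝ in (0 : ℝ)..1, (x : ℂ) ^ (b - 1) * (1 - (x : ℂ)) ^ ((c : ℂ) - b - a - 1))) := by
    have hwi := Complex.betaIntegral_convergent hb hcb
    have hwi2 := Complex.betaIntegral_convergent hb hcab
    have hev : ∀ᶠ z : ℝ in 𝓝[<] 1, z ∈ Ioo (0 : ℝ) 1 := Ioo_mem_nhdsLT zero_lt_one
    have hne1 : ∀ᵐ x : ℝ ∂volume, x ≠ 1 := by simp [ae_iff]
    refine intervalIntegral.tendsto_integral_filter_of_dominated_convergence
      (fun x => ‖(x : ℂ) ^ (b - 1) * (1 - (x : ℂ)) ^ ((c : ℂ) - b - a - 1)‖) ?_ ?_ hwi2.norm ?_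
    · filter_upwards [hev] with z hz
      refine (hwi.def'.aestronglyMeasurable).mul ?_
      refine ContinuousOn.aestronglyMeasurable ?_ measurableSet_uIoc
      intro x hx
      rw [uIoc_of_le zero_le_one] at hx
      refine ContinuousAt.continuousWithinAt ?_
      refine ContinuousAt.cpow (f := fun x : ℝ => 1 - (z : ℂ) * x) (by fun_prop)
        continuousAt_const ?_
      rw [← Complex.ofReal_mul, ← Complex.ofReal_one, ← Complex.ofReal_sub,
        Complex.ofReal_mem_slitPlane]
      nlinarith [hx.1, hx.2, hz.1, hz.2]
    · filter_upwards [hev] with z hz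
      filter_upwards [hne1] with x hx1 hx
      rw [uIoc_of_le zero_le_one] at hx
      have hx1' : 0 < 1 - x := sub_pos.2 (lt_of_le_of_ne hx.2 hx1)
      have hx1c : (1 - (x : ℂ)) ≠ 0 := by exact_mod_cast hx1'.ne'
      rw [show (c : ℂ) - b - a - 1 = ((c : ℂ) - b - 1) + -a by ring, Complex.cpow_add _ _ hx1c,
        ← mul_assoc, norm_mul, norm_mul _ ((1 - (x : ℂ)) ^ (-a))]
      refine mul_le_mul_of_nonneg_left ?_ (norm_nonneg _)
      rw [← Complex.ofReal_mul, ← Complex.ofReal_one, ← Complex.ofReal_sub, ← Complex.ofReal_sub,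
        Complex.norm_cpow_eq_rpow_re_of_pos hx1', Complex.norm_cpow_eq_rpow_re_of_pos (by nlinarith [hz.2, hx.1])]
      refine Real.rpow_le_rpow_of_nonpos hx1' (by nlinarith [hz.2, hx.1]) ?_
      simp; exact ha.le
    · filter_upwards [hne1] with x hx1 hx
      rw [uIoc_of_le zero_le_one] at hx
      have hx1' : 0 < 1 - x := sub_pos.2 (lt_of_le_of_ne hx.2 hx1)
      have hx1c : (1 - (x : ℂ)) ≠ 0 := by exact_mod_cast hx1'.ne'
      rw [show (c : ℂ) - b - a - 1 = ((c : ℂ) - b - 1) + -a by ring, Complex.cpow_add _ _ hx1c,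
        ← mul_assoc]
      refine Tendsto.const_mul _ ?_
      refine Tendsto.mono_left ?_ nhdsWithin_le_nhds
      have : ContinuousAt (fun z : ℝ => (1 - (z : ℂ) * x) ^ (-a)) 1 := by
        refine ContinuousAt.cpow (f := fun z : ℝ => 1 - (z : ℂ) * x) (by fun_prop)
          continuousAt_const ?_
        rw [← Complex.ofReal_mul, ← Complex.ofReal_one, ← Complex.ofReal_sub,
          Complex.ofReal_mem_slitPlane]
        simpa using hx1'
      have h2 := this.tendsto
      simpa using h2
  have hB : Complex.betaIntegral b (c - b) ≠ 0 := by
    rw [Complex.betaIntegral_eq_Gamma_mul_div _ _ hb hcb]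
    refine div_ne_zero (mul_ne_zero (Complex.Gamma_ne_zero_of_re_pos hb)
      (Complex.Gamma_ne_zero_of_re_pos hcb)) (Complex.Gamma_ne_zero_of_re_pos ?_)
    rw [Complex.add_re]; linarith
  have hval : (∫ x : ℝ in (0 : ℝ)..1, (x : ℂ) ^ (b - 1) * (1 - (x : ℂ)) ^ ((c : ℂ) - b - a - 1)) =
      Complex.betaIntegral b (c - b) * (Complex.Gamma c * Complex.Gamma (c - b - a) /
        (Complex.Gamma (c - a) * Complex.Gamma (c - b))) := by
    change Complex.betaIntegral b (c - b - a) = _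
    rw [Complex.betaIntegral_eq_Gamma_mul_div _ _ hb hcb,
      Complex.betaIntegral_eq_Gamma_mul_div _ _ hb hcab, add_sub_cancel,
      show b + ((c : ℂ) - b - a) = c - a by ring]
    have h1 := Complex.Gamma_ne_zero_of_re_pos hcb
    have h2 : Complex.Gamma (c : ℂ) ≠ 0 := Complex.Gamma_ne_zero_of_re_pos (by
      rw [Complex.sub_re] at hcb; linarith)
    field_simp
  rw [hval] at hlim
  have h3 := hlim.const_mul (Complex.betaIntegral b (c - b))⁻¹
  rw [inv_mul_cancel_left₀ hB] at h3
  refine h3.congr' ?_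
  filter_upwards [Ioo_mem_nhdsLT (zero_lt_one : (0:ℝ) < 1)] with z hz
  rw [← betaIntegral_mul_ordinaryHypergeometric a hb hcb (abs_lt.2 ⟨by linarith [hz.1], hz.2⟩),
    inv_mul_cancel_left₀ hB]

/-- Pfaff's transformation for small positive arguments. -/
theorem ordinaryHypergeometric_pfaff {a b : ℂ} {c : ℝ} (hb : 0 < b.re)
    (hcb : 0 < ((c : ℂ) - b).re) {z : ℝ} (hz : z ∈ Ioo (0 : ℝ) (1 / 2)) :
    ordinaryHypergeometric a (c - b) (c : ℂ) (z : ℂ) =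
      (1 - (z : ℂ)) ^ (-a) * ordinaryHypergeometric a b (c : ℂ) ((z / (z - 1) : ℝ) : ℂ) := by
  have hB : Complex.betaIntegral b (c - b) ≠ 0 := by
    rw [Complex.betaIntegral_eq_Gamma_mul_div _ _ hb hcb]
    refine div_ne_zero (mul_ne_zero (Complex.Gamma_ne_zero_of_re_pos hb)
      (Complex.Gamma_ne_zero_of_re_pos hcb)) (Complex.Gamma_ne_zero_of_re_pos ?_)
    rw [Complex.add_re]; linarith
  have h1z : 0 < 1 - z := by linarith [hz.2]
  have hw : |z / (z - 1)| < 1 := by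
    rw [abs_div, abs_of_pos hz.1, abs_of_neg (by linarith [hz.2] : z - 1 < 0), div_lt_one (by linarith)]
    linarith [hz.2]
  have e1 := betaIntegral_mul_ordinaryHypergeometric a (b := (c : ℂ) - b) (c := c) hcb
    (by simpa using hb) (z := z) (abs_lt.2 ⟨by linarith [hz.1], by linarith [hz.2]⟩)
  have e2 := betaIntegral_mul_ordinaryHypergeometric a hb hcb hw
  refine mul_left_cancel₀ hB ?_
  rw [sub_sub_cancel, Complex.betaIntegral_symm] at e1
  rw [e1, mul_left_comm, e2, ← intervalIntegral.integral_const_mul]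
  -- The substitution x ↦ 1 - x exchanges the two Beta exponents and takes 1 - zx to (1 - z)(1 -
  -- z/(z - 1) · x).
  have := intervalIntegral.integral_comp_sub_left (a := 0) (b := 1) (fun x : ℝ => (x : ℂ) ^ ((c : ℂ) - b - 1) *
    (1 - (x : ℂ)) ^ (b - 1) * (1 - (z : ℂ) * x) ^ (-a)) 1
  rw [sub_self, sub_zero] at this
  rw [← this]
  refine intervalIntegral.integral_congr fun x hx => ?_
  rw [uIcc_of_le zero_le_one] at hx
  have e3 : (1 - (z : ℂ) * ((1 - x : ℝ) : ℂ)) ^ (-a) = (1 - (z : ℂ)) ^ (-a) *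
      (1 - ((z / (z - 1) : ℝ) : ℂ) * x) ^ (-a) := by
    have h2 : 1 - z / (z - 1) * x = 1 + z / (1 - z) * x := by
      rw [← neg_sub 1 z, div_neg]; ring
    have h3 : 0 ≤ 1 + z / (1 - z) * x := by
      have := hz.1; have := hx.1; positivity
    have h4 : 1 - z * (1 - x) = (1 - z) * (1 + z / (1 - z) * x) := by field_simp; ring
    have := Complex.mul_cpow_ofReal_nonneg h1z.le h3 (-a)
    rw [← Complex.ofReal_mul, ← h4] at this
    rw [← Complex.ofReal_mul, ← Complex.ofReal_mul, ← Complex.ofReal_one, ← Complex.ofReal_sub,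
      ← Complex.ofReal_sub, ← Complex.ofReal_sub, h2, ← this]
  rw [e3]
  push_cast
  rw [sub_sub_cancel]
  ring

/-- Euler's transformation. -/
theorem ordinaryHypergeometric_euler {a b : ℂ} {c : ℝ} (ha : 0 < a.re) (hb : 0 < b.re)
    (hca : 0 < ((c : ℂ) - a).re) (hcb : 0 < ((c : ℂ) - b).re) {z : ℂ} (hz : ‖z‖ < 1) :
    (1 - z) ^ a * ordinaryHypergeometric a (c - b) (c : ℂ) z =
      (1 - z) ^ b * ordinaryHypergeometric b (c - a) (c : ℂ) z := by
  have hc : 0 < c := by rw [Complex.sub_re] at hca; simp at hca; linarith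
  have han : ∀ a b : ℂ, DifferentiableOn ℂ
      (fun z => (1 - z) ^ a * ordinaryHypergeometric a (c - b) (c : ℂ) z) (Metric.ball (0 : ℂ) 1) := by
    intro a b z hz
    rw [mem_ball_zero_iff] at hz
    refine DifferentiableAt.differentiableWithinAt ?_
    refine DifferentiableAt.mul ?_ ?_
    · refine DifferentiableAt.cpow (by fun_prop) (by fun_prop) ?_
      refine Complex.mem_slitPlane_of_norm_lt_one (z := -z) (by simpa using hz)
    · have e : (ordinaryHypergeometric a (c - b) (c : ℂ) : ℂ → ℂ) =
          powSum (ordinaryHypergeometricCoefficient a (c - b) (c : ℂ)) :=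
        funext fun z => ordinaryHypergeometric_eq_powSum _ _ _ z
      change DifferentiableAt ℂ (ordinaryHypergeometric a (c - b) (c : ℂ)) z
      rw [e]
      exact ((summableOnDisc_ordinaryHypergeometricCoefficient _ _ hc).hasDerivAt_powSum
        hz).differentiableAt
  have h1 := (han a b).analyticOnNhd Metric.isOpen_ball
  have h2 := (han b a).analyticOnNhd Metric.isOpen_ball
  -- By the identity theorem small positive arguments suffice. There Pfaff's formula makes both
  -- sides equal to ₂F₁(a, b; c; z/(z - 1)), which is symmetric in a and b.
  refine h1.eqOn_of_preconnected_of_frequently_eq h2 (convex_ball _ _).isPreconnected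
    (z₀ := 0) (by simp) ?_ (by simpa using hz)
  have h3 : Tendsto (fun x : ℝ => (x : ℂ)) (𝓝[>] 0) (𝓝[≠] 0) := by
    refine tendsto_nhdsWithin_of_tendsto_nhds_of_eventually_within _ ?_ ?_
    · exact (Complex.continuous_ofReal.tendsto' 0 0 (by simp)).mono_left nhdsWithin_le_nhds
    · filter_upwards [self_mem_nhdsWithin] with x hx
      simpa using (mem_Ioi.1 hx).ne'
  refine h3.frequently (Eventually.frequently ?_)
  filter_upwards [Ioo_mem_nhdsGT (by norm_num : (0 : ℝ) < 1 / 2)] with x hx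
  have hne : (1 - (x : ℂ)) ≠ 0 := by
    exact_mod_cast (by linarith [hx.2] : (1 - x) ≠ 0)
  rw [ordinaryHypergeometric_pfaff hb hcb hx, ordinaryHypergeometric_pfaff ha hca hx,
    ← mul_assoc, ← mul_assoc, ← Complex.cpow_add _ _ hne, ← Complex.cpow_add _ _ hne,
    ordinaryHypergeometric, ordinaryHypergeometric, ordinaryHypergeometricSeries_symm]
  simp

theorem continuousAt_ordinaryHypergeometric {X : Type*} [TopologicalSpace X] {a b z : X → ℂ}
    {c : ℝ} (hc : 0 < c) {x : X} (ha : ContinuousAt a x) (hb : ContinuousAt b x)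
    (hz : ContinuousAt z x) (hzx : ‖z x‖ < 1) :
    ContinuousAt (fun x => ordinaryHypergeometric (a x) (b x) (c : ℂ) (z x)) x := by
  obtain ⟨r, h1, h2⟩ := exists_between hzx
  have h0 : 0 ≤ r := (norm_nonneg _).trans h1.le
  suffices ContinuousAt (fun p : ℂ × ℂ × ℂ => ordinaryHypergeometric p.1 p.2.1 (c : ℂ) p.2.2)
      (a x, b x, z x) from
    ContinuousAt.comp (f := fun x => (a x, b x, z x)) this (ha.prodMk (hb.prodMk hz))
  set A := ‖a x‖ + 1
  set B := ‖b x‖ + 1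
  have hU : IsOpen {p : ℂ × ℂ × ℂ | ‖p.1‖ < A ∧ ‖p.2.1‖ < B ∧ ‖p.2.2‖ < r} := by
    exact (isOpen_lt (f := fun p : ℂ × ℂ × ℂ => ‖p.1‖) (by fun_prop) continuous_const).inter
      ((isOpen_lt (f := fun p : ℂ × ℂ × ℂ => ‖p.2.1‖) (by fun_prop) continuous_const).inter
        (isOpen_lt (f := fun p : ℂ × ℂ × ℂ => ‖p.2.2‖) (by fun_prop) continuous_const))
  have hmem : (a x, b x, z x) ∈ {p : ℂ × ℂ × ℂ | ‖p.1‖ < A ∧ ‖p.2.1‖ < B ∧ ‖p.2.2‖ < r} :=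
    ⟨by simp [A], by simp [B], h1⟩
  refine ContinuousOn.continuousAt (s := {p : ℂ × ℂ × ℂ | ‖p.1‖ < A ∧ ‖p.2.1‖ < B ∧ ‖p.2.2‖ < r})
    ?_ (hU.mem_nhds hmem)
  simp_rw [ordinaryHypergeometric_eq_powSum]
  unfold powSum
  refine continuousOn_tsum (u := fun n => ordinaryHypergeometricCoefficient A B c n * r ^ n)
    (fun n => ?_) (summable_ordinaryHypergeometricCoefficient (by positivity) (by positivity) hc
      h0 h2) ?_
  · unfold ordinaryHypergeometricCoefficient
    refine Continuous.continuousOn ?_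
    have h3 : Continuous fun p : ℂ × ℂ × ℂ => (ascPochhammer ℂ n).eval p.1 :=
      (ascPochhammer ℂ n).continuous.comp continuous_fst
    have h4 : Continuous fun p : ℂ × ℂ × ℂ => (ascPochhammer ℂ n).eval p.2.1 :=
      (ascPochhammer ℂ n).continuous.comp (continuous_fst.comp continuous_snd)
    fun_prop
  · intro n p hp
    rw [norm_mul, norm_pow]
    have h5 := norm_ordinaryHypergeometricCoefficient_le (a := p.1) (b := p.2.1) hp.1.le hp.2.1.le hc n
    have h6 := (norm_nonneg _).trans h5
    have h7 := hp.2.2.le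
    gcongr

/-! ### Wronskians and the Jost basis -/

theorem eqOn_Ioi_of_hasDerivAt_zero {f : ℝ → ℂ} (h : ∀ t, 0 < t → HasDerivAt f 0 t) {s t : ℝ}
    (hs : 0 < s) (ht : 0 < t) : f s = f t :=
  isOpen_Ioi.is_const_of_deriv_eq_zero isPreconnected_Ioi
    (fun x hx => (h x hx).differentiableAt.differentiableWithinAt) (fun x hx => (h x hx).deriv)
    hs ht

theorem wronskian_const {Q u v u' v' : ℝ → ℂ} (hu : ∀ t, 0 < t → HasDerivAt u (u' t) t)
    (hu' : ∀ t, 0 < t → HasDerivAt u' (Q t * u t) t) (hv : ∀ t, 0 < t → HasDerivAt v (v' t) t)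
    (hv' : ∀ t, 0 < t → HasDerivAt v' (Q t * v t) t) {s t : ℝ} (hs : 0 < s) (ht : 0 < t) :
    u s * v' s - u' s * v s = u t * v' t - u' t * v t := by
  refine eqOn_Ioi_of_hasDerivAt_zero (f := fun t => u t * v' t - u' t * v t) (fun t ht => ?_) hs ht
  convert! ((hu t ht).mul (hv' t ht)).sub ((hu' t ht).mul (hv t ht)) using 1
  ring

theorem SummableOnDisc.tendsto_expSum_mul {f g : ℕ → ℂ} (hf : SummableOnDisc f)
    (hg : SummableOnDisc g) (ξ : ℂ) :
    Tendsto (fun t : ℝ => expSum f ξ t * expSum g (-ξ) t) atTop (𝓝 (f 0 * g 0)) := by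
  refine ((hf.tendsto_expSum ξ).mul (hg.tendsto_expSum (-ξ))).congr fun t => ?_
  rw [mul_mul_mul_comm, ← Complex.exp_add]
  simp

/-- The Wronskian is constant, so it can be read off at infinity. There only the leading
coefficients survive, and they give -iξ - iξ. -/
theorem jost_wronskian (α β : ℝ) {ξ : ℂ} (h1 : -(1 / 2) ≤ ξ.im) (h2 : ξ.im ≤ 1 / 2) {t : ℝ}
    (ht : 0 < t) :
    jost α β ξ t * jostDeriv α β (-ξ) t - jostDeriv α β ξ t * jost α β (-ξ) t =
      -2 * Complex.I * ξ := by
  have h3 : -(1 / 2) ≤ (-ξ).im := by rw [Complex.neg_im]; linarith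
  have hconst : ∀ s : ℝ, 0 < s →
      jost α β ξ s * jostDeriv α β (-ξ) s - jostDeriv α β ξ s * jost α β (-ξ) s =
      jost α β ξ t * jostDeriv α β (-ξ) t - jostDeriv α β ξ t * jost α β (-ξ) t := by
    intro s hs
    refine wronskian_const (Q := fun t => jacobiPot α β t - ξ ^ 2)
      (fun t ht => hasDerivAt_jost α β h1 ht) (fun t ht => hasDerivAt_jostDeriv α β h1 ht)
      (fun t ht => hasDerivAt_jost α β h3 ht) (fun t ht => ?_) hs ht
    simpa using hasDerivAt_jostDeriv α β h3 ht
  have l1 := (summableOnDisc_jostCoeff α β h1).tendsto_expSum_mul (summableOnDisc_jostDeriv α β h3) ξ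
  have l2 := (summableOnDisc_jostDeriv α β h1).tendsto_expSum_mul (summableOnDisc_jostCoeff α β h3) ξ
  have l3 := l1.sub l2
  refine tendsto_nhds_unique (tendsto_const_nhds.congr' ?_) (l3.trans (le_of_eq ?_))
  · filter_upwards [eventually_gt_atTop 0] with s hs
    exact (hconst s hs).symm
  · simp only [jostCoeff_zero]
    congr 1
    push_cast
    ring

theorem jost_linear_independent (α β : ℝ) {ξ : ℂ} (h1 : -(1 / 2) ≤ ξ.im) (h2 : ξ.im ≤ 1 / 2)
    (hξ : ξ ≠ 0) {X Y : ℂ} (h : ∀ t : ℝ, 0 < t → X * jost α β ξ t = Y * jost α β (-ξ) t) :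
    X = 0 := by
  have h3 : -(1 / 2) ≤ (-ξ).im := by rw [Complex.neg_im]; linarith
  have hd : X * jostDeriv α β ξ 1 = Y * jostDeriv α β (-ξ) 1 := by
    refine ((hasDerivAt_jost α β h1 one_pos).const_mul X).unique ?_
    refine ((hasDerivAt_jost α β h3 one_pos).const_mul Y).congr_of_eventuallyEq ?_
    filter_upwards [lt_mem_nhds one_pos] with t ht using h t ht
  have hw := jost_wronskian α β h1 h2 one_pos
  have : X * (-2 * Complex.I * ξ) = 0 := by
    rw [← hw]
    linear_combination jostDeriv α β (-ξ) 1 * h 1 one_pos - jost α β (-ξ) 1 * hd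
  simpa [hξ] using this

/-- The coefficients are the constant Wronskians of y with the two Jost solutions, divided by the
Wronskian -2iξ of the basis. -/
theorem exists_eq_jost_add_jost (α β : ℝ) {ξ : ℂ} (h1 : -(1 / 2) ≤ ξ.im) (h2 : ξ.im ≤ 1 / 2)
    (hξ : ξ ≠ 0) {y y' : ℝ → ℂ} (hy : ∀ t, 0 < t → HasDerivAt y (y' t) t)
    (hy' : ∀ t, 0 < t → HasDerivAt y' ((jacobiPot α β t - ξ ^ 2) * y t) t) :
    ∃ A B : ℂ, ∀ t, 0 < t → y t = A * jost α β ξ t + B * jost α β (-ξ) t := by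
  have h3 : -(1 / 2) ≤ (-ξ).im := by rw [Complex.neg_im]; linarith
  have hj : ∀ t, 0 < t →
      HasDerivAt (jostDeriv α β (-ξ)) ((jacobiPot α β t - ξ ^ 2) * jost α β (-ξ) t) t := by
    intro t ht
    simpa using hasDerivAt_jostDeriv α β h3 ht
  have hw : -2 * Complex.I * ξ ≠ 0 := by simp [hξ]
  refine ⟨(y 1 * jostDeriv α β (-ξ) 1 - y' 1 * jost α β (-ξ) 1) / (-2 * Complex.I * ξ),
    -(y 1 * jostDeriv α β ξ 1 - y' 1 * jost α β ξ 1) / (-2 * Complex.I * ξ), fun t ht => ?_⟩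
  have c1 := wronskian_const (Q := fun t => jacobiPot α β t - ξ ^ 2) hy hy'
    (fun t ht => hasDerivAt_jost α β h3 ht) hj one_pos ht
  have c2 := wronskian_const (Q := fun t => jacobiPot α β t - ξ ^ 2) hy hy'
    (fun t ht => hasDerivAt_jost α β h1 ht) (fun t ht => hasDerivAt_jostDeriv α β h1 ht) one_pos ht
  rw [c1, c2, div_mul_eq_mul_div, div_mul_eq_mul_div, ← add_div, eq_div_iff hw,
    ← jost_wronskian α β h1 h2 ht]
  ring

theorem continuousAt_jost (α β : ℝ) {ξ : ℂ} (hξ : -(1 / 2) < ξ.im) {t : ℝ} (ht : 0 < t) :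
    ContinuousAt (fun ξ => jost α β ξ t) ξ := by
  obtain ⟨Q, hQ⟩ := exists_nat_ge ((|α ^ 2 - 1 / 4| + |β ^ 2 - 1 / 4|) / (1 / 2))
  have hz := norm_cexp_neg_two_mul_lt ht
  unfold jost expSum
  refine ContinuousAt.mul (by fun_prop) ?_
  have hev : ∀ᶠ ζ : ℂ in 𝓝 ξ, -(1 / 2) ≤ ζ.im :=
    (Complex.continuous_im.continuousAt.eventually_const_lt hξ).mono fun ζ h => le_of_lt h
  refine tendsto_tsum_of_dominated_convergence
    (bound := fun n => ((n + Q).choose Q : ℝ) * ‖Complex.exp (-2 * t)‖ ^ n)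
    (summable_choose_mul_pow Q (norm_nonneg _) hz) (fun n => ?_) ?_
  · refine Tendsto.mul_const _ ?_
    refine (differentiableAt_jostCoeff α β (fun k h => ?_) n).continuousAt
    have := half_mul_le_norm_sub_I_mul hξ.le k
    rw [h, norm_zero] at this
    have hk : (0 : ℝ) ≤ k := Nat.cast_nonneg k
    linarith
  · filter_upwards [hev] with ζ hζ n
    rw [norm_mul, norm_pow]
    exact mul_le_mul_of_nonneg_right
      (norm_jostCoeff_le (by norm_num) hQ (half_mul_le_norm_sub_I_mul hζ) n) (by positivity)

/-! ### The Jacobi function as a solution of the Schrödinger equation -/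

/-- The exponential prefactor of `jacobiY`. -/
noncomputable def jacobiYFactor (α β : ℝ) (ξ : ℂ) (t : ℝ) : ℂ :=
  Complex.exp ((α + 1 / 2) * Real.log (2 * Real.sinh t) + (β + 1 / 2) * Real.log (2 * Real.cosh t) -
    (jacobiRho α β - Complex.I * ξ) * Real.log (Real.cosh t))

/-- The hypergeometric coefficients of the Jacobi function in the variable `tanh² t`. -/
noncomputable def jacobiYCoeff (α β : ℝ) (ξ : ℂ) : ℕ → ℂ :=
  ordinaryHypergeometricCoefficient (((jacobiRho α β : ℂ) - Complex.I * ξ) / 2)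
    (((α - β + 1 : ℝ) - Complex.I * ξ) / 2) ((α + 1 : ℝ) : ℂ)

/-- The Jacobi function multiplied by the square root of the weight. -/
noncomputable def jacobiY (α β : ℝ) (ξ : ℂ) (t : ℝ) : ℂ :=
  jacobiYFactor α β ξ t * powSum (jacobiYCoeff α β ξ) (((Real.tanh t) ^ 2 : ℝ) : ℂ)

theorem norm_tanh_sq_lt (t : ℝ) : ‖(((Real.tanh t) ^ 2 : ℝ) : ℂ)‖ < 1 := by
  rw [Complex.norm_real, Real.norm_of_nonneg (sq_nonneg _), Real.tanh_eq_sinh_div_cosh, div_pow,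
    div_lt_one (by positivity [Real.cosh_pos t])]
  linarith [Real.cosh_sq t]

theorem hasDerivAt_powSum_tanh_sq {f : ℕ → ℂ} (hf : SummableOnDisc f) {t : ℝ} (ht : 0 < t) :
    HasDerivAt (fun t : ℝ => powSum f (((Real.tanh t) ^ 2 : ℝ) : ℂ))
      (2 / (Real.sinh t * Real.cosh t) * powSum (fun n => n * f n) (((Real.tanh t) ^ 2 : ℝ) : ℂ))
      t := by
  have hS : Real.sinh t ≠ 0 := (Real.sinh_pos_iff.2 ht).ne'
  have hC : Real.cosh t ≠ 0 := (Real.cosh_pos t).ne'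
  have h1 : HasDerivAt (fun t => Real.tanh t ^ 2)
      (Real.tanh t ^ 2 * (2 / (Real.sinh t * Real.cosh t))) t := by
    have e : (fun t => Real.tanh t ^ 2) = fun t => (Real.sinh t / Real.cosh t) ^ 2 := by
      funext t; rw [Real.tanh_eq_sinh_div_cosh]
    rw [e, Real.tanh_eq_sinh_div_cosh]
    convert! ((Real.hasDerivAt_sinh t).div (Real.hasDerivAt_cosh t) hC).pow 2 using 1
    have := Real.cosh_sq t
    simp only [Pi.div_apply, Nat.add_one_sub_one, pow_one, Nat.cast_ofNat]
    field_simp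
    linear_combination -this
  have h2 := (hf.hasDerivAt_powSum (norm_tanh_sq_lt t)).comp t h1.ofReal_comp
  convert! h2 using 1
  rw [← hf.mul_powSum_deriv (norm_tanh_sq_lt t)]
  push_cast
  ring

theorem hasDerivAt_jacobiYFactor (α β : ℝ) (ξ : ℂ) {t : ℝ} (ht : 0 < t) :
    HasDerivAt (jacobiYFactor α β ξ) (jacobiYFactor α β ξ t *
      ((α + 1 / 2) * (Real.cosh t / Real.sinh t) +
        (β + 1 / 2 - (jacobiRho α β - Complex.I * ξ)) * (Real.sinh t / Real.cosh t))) t := by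
  have hS : 0 < Real.sinh t := Real.sinh_pos_iff.2 ht
  have hC : 0 < Real.cosh t := Real.cosh_pos t
  have l1 := (((Real.hasDerivAt_sinh t).const_mul 2).log (by positivity)).ofReal_comp
  have l2 := (((Real.hasDerivAt_cosh t).const_mul 2).log (by positivity)).ofReal_comp
  have l3 := ((Real.hasDerivAt_cosh t).log (by positivity)).ofReal_comp
  have h := (((l1.const_mul ((α : ℂ) + 1 / 2)).add (l2.const_mul ((β : ℂ) + 1 / 2))).sub
    (l3.const_mul ((jacobiRho α β : ℂ) - Complex.I * ξ))).cexp
  unfold jacobiYFactor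
  convert! h using 1
  have hS' : (Real.sinh t : ℂ) ≠ 0 := by exact_mod_cast hS.ne'
  have hC' : (Real.cosh t : ℂ) ≠ 0 := by exact_mod_cast hC.ne'
  congr 1
  push_cast at hS' hC' ⊢
  field_simp
  ring

/-- The derivative of `jacobiY`. -/
noncomputable def jacobiYDeriv (α β : ℝ) (ξ : ℂ) (t : ℝ) : ℂ :=
  jacobiYFactor α β ξ t *
    (((α + 1 / 2) * (Real.cosh t / Real.sinh t) +
        (β + 1 / 2 - (jacobiRho α β - Complex.I * ξ)) * (Real.sinh t / Real.cosh t)) *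
      powSum (jacobiYCoeff α β ξ) (((Real.tanh t) ^ 2 : ℝ) : ℂ) +
    2 / (Real.sinh t * Real.cosh t) *
      powSum (fun n => n * jacobiYCoeff α β ξ n) (((Real.tanh t) ^ 2 : ℝ) : ℂ))

theorem hasDerivAt_jacobiY {α β : ℝ} (hα : -1 < α) (ξ : ℂ) {t : ℝ} (ht : 0 < t) :
    HasDerivAt (jacobiY α β ξ) (jacobiYDeriv α β ξ t) t := by
  have hf : SummableOnDisc (jacobiYCoeff α β ξ) :=
    summableOnDisc_ordinaryHypergeometricCoefficient _ _ (by linarith)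
  convert! (hasDerivAt_jacobiYFactor α β ξ ht).mul (hasDerivAt_powSum_tanh_sq hf ht) using 1
  unfold jacobiYDeriv
  ring

/-- The hypergeometric equation in z = tanh² t, in its Euler-operator form, eliminates the series
with n². What remains is a comparison of the coefficients of the series G0 and G1. -/
theorem hasDerivAt_jacobiYDeriv {α β : ℝ} (hα : -1 < α) (ξ : ℂ) {t : ℝ} (ht : 0 < t) :
    HasDerivAt (jacobiYDeriv α β ξ) ((jacobiPot α β t - ξ ^ 2) * jacobiY α β ξ t) t := by
  have hf : SummableOnDisc (jacobiYCoeff α β ξ) :=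
    summableOnDisc_ordinaryHypergeometricCoefficient _ _ (by linarith)
  have hS : Real.sinh t ≠ 0 := (Real.sinh_pos_iff.2 ht).ne'
  have hC : Real.cosh t ≠ 0 := (Real.cosh_pos t).ne'
  have hS' : (Real.sinh t : ℂ) ≠ 0 := by exact_mod_cast hS
  have hC' : (Real.cosh t : ℂ) ≠ 0 := by exact_mod_cast hC
  have hCS : (Real.cosh t : ℂ) ^ 2 = (Real.sinh t : ℂ) ^ 2 + 1 := by exact_mod_cast Real.cosh_sq t
  have d1 : HasDerivAt (fun t : ℝ => ((Real.cosh t / Real.sinh t : ℝ) : ℂ))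
      (-(1 / (Real.sinh t : ℂ) ^ 2)) t := by
    convert! ((Real.hasDerivAt_cosh t).div (Real.hasDerivAt_sinh t) hS).ofReal_comp using 1
    push_cast at hS' hC' hCS ⊢
    field_simp
    linear_combination hCS
  have d2 : HasDerivAt (fun t : ℝ => ((Real.sinh t / Real.cosh t : ℝ) : ℂ))
      (1 / (Real.cosh t : ℂ) ^ 2) t := by
    convert! ((Real.hasDerivAt_sinh t).div (Real.hasDerivAt_cosh t) hC).ofReal_comp using 1
    push_cast at hS' hC' hCS ⊢
    field_simp
    linear_combination -hCS
  have d3 : HasDerivAt (fun t : ℝ => ((2 / (Real.sinh t * Real.cosh t) : ℝ) : ℂ))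
      (-2 * (1 / (Real.sinh t : ℂ) ^ 2 + 1 / (Real.cosh t : ℂ) ^ 2)) t := by
    convert! ((hasDerivAt_const t (2 : ℝ)).div ((Real.hasDerivAt_sinh t).mul
      (Real.hasDerivAt_cosh t)) (mul_ne_zero hS hC)).ofReal_comp using 1
    push_cast at hS' hC' hCS ⊢
    simp only [Pi.mul_apply]
    push_cast
    field_simp
    ring
  have D := (hasDerivAt_jacobiYFactor α β ξ ht).mul
    ((((d1.const_mul ((α : ℂ) + 1 / 2)).add
      (d2.const_mul ((β : ℂ) + 1 / 2 - (jacobiRho α β - Complex.I * ξ)))).mul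
      (hasDerivAt_powSum_tanh_sq hf ht)).add (d3.mul (hasDerivAt_powSum_tanh_sq hf.nat_mul ht)))
  have E := hypergeometric_euler_equation (((jacobiRho α β : ℂ) - Complex.I * ξ) / 2)
    (((α - β + 1 : ℝ) - Complex.I * ξ) / 2) (c := α + 1) (by linarith) (norm_tanh_sq_lt t)
  have hz : (((Real.tanh t) ^ 2 : ℝ) : ℂ) = (Real.sinh t : ℂ) ^ 2 / (Real.cosh t : ℂ) ^ 2 := by
    rw [Real.tanh_eq_sinh_div_cosh]; push_cast; rw [div_pow]
  change (1 - _) * powSum (fun n => n * (n * jacobiYCoeff α β ξ n)) _ =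
    _ * powSum (fun n => n * jacobiYCoeff α β ξ n) _ + _ * powSum (jacobiYCoeff α β ξ) _ at E
  have D' := D
  convert! D' using 1
  · unfold jacobiYDeriv
    funext s
    simp only [Pi.mul_apply, Pi.add_apply]
    push_cast
    rfl
  · simp only [Pi.mul_apply, Pi.add_apply]
    unfold jacobiY
    set G0 := powSum (jacobiYCoeff α β ξ) (((Real.tanh t) ^ 2 : ℝ) : ℂ)
    set G1 := powSum (fun n => n * jacobiYCoeff α β ξ n) (((Real.tanh t) ^ 2 : ℝ) : ℂ)
    set G2 := powSum (fun n => n * (n * jacobiYCoeff α β ξ n)) (((Real.tanh t) ^ 2 : ℝ) : ℂ)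
    set F := jacobiYFactor α β ξ t
    unfold jacobiPot
    unfold jacobiRho at E ⊢
    rw [hz] at E
    push_cast at hS' hC' hCS E ⊢
    set S := Complex.sinh (t : ℂ)
    set C := Complex.cosh (t : ℂ)
    have hz1 : 1 - S ^ 2 / C ^ 2 = 1 / C ^ 2 := by field_simp; linear_combination hCS
    rw [hz1] at E
    have E2 : G2 = C ^ 2 * ((S ^ 2 / C ^ 2 * ((α + β + 1 - Complex.I * ξ) / 2 +
        (α - β + 1 - Complex.I * ξ) / 2) - (α + 1 - 1)) * G1 + S ^ 2 / C ^ 2 *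
        ((α + β + 1 - Complex.I * ξ) / 2 * ((α - β + 1 - Complex.I * ξ) / 2)) * G0) := by
      rw [← E]; field_simp
    have e1 : C / S * (C / S) = 1 + 1 / S ^ 2 := by field_simp; linear_combination hCS
    have e2 : S / C * (S / C) = 1 - 1 / C ^ 2 := by field_simp; linear_combination -hCS
    have e3 : C / S * (S / C) = 1 := by field_simp
    have e4 : C / S * (2 / (S * C)) = 2 / S ^ 2 := by field_simp
    have e5 : S / C * (2 / (S * C)) = 2 / C ^ 2 := by field_simp
    have e6 : 2 / (S * C) * (2 / (S * C)) * C ^ 2 = 4 / S ^ 2 := by field_simp; norm_num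
    have e7 : 2 / (S * C) * (2 / (S * C)) * C ^ 2 * (S ^ 2 / C ^ 2) = 4 / C ^ 2 := by
      field_simp; norm_num
    set P : ℂ := (α : ℂ) + 1 / 2 with hP
    set κ : ℂ := (β : ℂ) + 1 / 2 - (α + β + 1 - Complex.I * ξ) with hκ
    set A : ℂ := (α + β + 1 - Complex.I * ξ) / 2 + (α - β + 1 - Complex.I * ξ) / 2 with hA
    set B : ℂ := (α + β + 1 - Complex.I * ξ) / 2 * ((α - β + 1 - Complex.I * ξ) / 2) with hB
    -- The five coefficient identities: `i1`, `i2`, `i3` produce -ξ² and the two terms of the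
    -- potential in front of G0, while `i4` and `i5` make the terms in G1 vanish.
    have i1 : (P + κ) ^ 2 = -ξ ^ 2 := by
      rw [hP, hκ]; linear_combination ξ ^ 2 * Complex.I_sq
    have i2 : P ^ 2 - P = (α : ℂ) ^ 2 - 1 / 4 := by rw [hP]; ring
    have i3 : κ ^ 2 - κ - 4 * B = (β : ℂ) ^ 2 - 1 / 4 := by rw [hκ, hB]; ring
    have i4 : 4 * P - 2 - 4 * α = 0 := by rw [hP]; ring
    have i5 : 4 * κ - 2 + 4 * A = 0 := by rw [hκ, hA]; ring
    linear_combination (-F * G0 * P ^ 2) * e1 + (-F * G0 * κ ^ 2) * e2 +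
      (-2 * P * κ * F * G0) * e3 + (-2 * P * F * G1) * e4 + (-2 * κ * F * G1) * e5 +
      (α * F * G1) * e6 + (-F * (A * G1 + B * G0)) * e7 -
      F * (2 / (S * C)) * (2 / (S * C)) * E2 - F * G0 * i1 - F * G0 / S ^ 2 * i2 +
      F * G0 / C ^ 2 * i3 - F * G1 / S ^ 2 * i4 - F * G1 / C ^ 2 * i5

/-- In this form the behaviour at infinity is visible: log tanh t tends to 0 and log cosh t is t -
log 2 + o(1). -/
theorem jacobiYFactor_eq (α β : ℝ) (ξ : ℂ) {t : ℝ} (ht : 0 < t) :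
    jacobiYFactor α β ξ t = Complex.exp ((α + 1 / 2) * Real.log (Real.tanh t) +
      jacobiRho α β * Real.log 2 + Complex.I * ξ * Real.log (Real.cosh t)) := by
  have hS : 0 < Real.sinh t := Real.sinh_pos_iff.2 ht
  have hC : 0 < Real.cosh t := Real.cosh_pos t
  unfold jacobiYFactor
  rw [Real.log_mul (by norm_num) hS.ne', Real.log_mul (by norm_num) hC.ne',
    Real.tanh_eq_sinh_div_cosh, Real.log_div hS.ne' hC.ne']
  unfold jacobiRho
  push_cast
  congr 1
  ring

/-! ### Asymptotics at infinity and the connection formula -/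

/-- The leading coefficient of `jacobiY` at infinity. -/
noncomputable def jacobiLeading (α β : ℝ) (ξ : ℂ) : ℂ :=
  Complex.exp ((jacobiRho α β - Complex.I * ξ) * Real.log 2) *
    (Complex.Gamma (α + 1 : ℝ) * Complex.Gamma (Complex.I * ξ) /
      (Complex.Gamma (((jacobiRho α β : ℂ) + Complex.I * ξ) / 2 - β) *
        Complex.Gamma (((jacobiRho α β : ℂ) + Complex.I * ξ) / 2)))

theorem tendsto_tanh_atTop : Tendsto Real.tanh atTop (𝓝 1) := by
  have h : ∀ t : ℝ, Real.tanh t = (1 - Real.exp (-2 * t)) / (1 + Real.exp (-2 * t)) := by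
    intro t
    rw [Real.tanh_eq_sinh_div_cosh, Real.sinh_eq, Real.cosh_eq, show -2 * t = -t + -t by ring,
      Real.exp_add]
    have h1 : Real.exp t * Real.exp (-t) = 1 := by rw [← Real.exp_add]; simp
    have := Real.exp_pos t
    have := Real.exp_pos (-t)
    rw [div_div_div_cancel_right₀ (by norm_num), div_eq_div_iff (by positivity) (by positivity)]
    linear_combination (2 * Real.exp (-t)) * h1
  have h0 : Tendsto (fun t : ℝ => Real.exp (-2 * t)) atTop (𝓝 0) :=
    Real.tendsto_exp_atBot.comp (tendsto_id.const_mul_atTop_of_neg (by norm_num))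
  have : Tendsto (fun t : ℝ => (1 - Real.exp (-2 * t)) / (1 + Real.exp (-2 * t))) atTop
      (𝓝 ((1 - 0) / (1 + 0))) :=
    (tendsto_const_nhds.sub h0).div (tendsto_const_nhds.add h0) (by norm_num)
  simp only [sub_zero, add_zero, div_one] at this
  exact this.congr fun t => (h t).symm

theorem tendsto_log_cosh_sub : Tendsto (fun t => Real.log (Real.cosh t) - t) atTop
    (𝓝 (-Real.log 2)) := by
  have h : ∀ t : ℝ, Real.log (Real.cosh t) - t = Real.log ((1 + Real.exp (-2 * t)) / 2) := by
    intro t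
    have e : (1 + Real.exp (-2 * t)) / 2 = Real.cosh t * Real.exp (-t) := by
      rw [Real.cosh_eq, show -2 * t = -t + -t by ring, Real.exp_add]
      have h1 : Real.exp t * Real.exp (-t) = 1 := by rw [← Real.exp_add]; simp
      linear_combination (-1 / 2 : ℝ) * h1
    rw [e, Real.log_mul (Real.cosh_pos t).ne' (Real.exp_pos _).ne', Real.log_exp]
    ring
  have h0 : Tendsto (fun t : ℝ => Real.exp (-2 * t)) atTop (𝓝 0) :=
    Real.tendsto_exp_atBot.comp (tendsto_id.const_mul_atTop_of_neg (by norm_num))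
  have : Tendsto (fun t : ℝ => Real.log ((1 + Real.exp (-2 * t)) / 2)) atTop
      (𝓝 (Real.log ((1 + 0) / 2))) :=
    ((tendsto_const_nhds.add h0).div_const 2).log (by norm_num)
  rw [show Real.log ((1 + 0) / 2) = -Real.log 2 by rw [add_zero, one_div, Real.log_inv]] at this
  exact this.congr fun t => (h t).symm

theorem tanh_sq_mem_Ioo {t : ℝ} (ht : 0 < t) : Real.tanh t ^ 2 ∈ Ioo (0 : ℝ) 1 := by
  have hS : 0 < Real.sinh t := Real.sinh_pos_iff.2 ht
  have hC : 0 < Real.cosh t := Real.cosh_pos t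
  rw [Real.tanh_eq_sinh_div_cosh, div_pow]
  refine ⟨by positivity, ?_⟩
  rw [div_lt_one (by positivity)]
  linarith [Real.cosh_sq t]

/-- For the parameters of the series in tanh² t one has c - a - b = iξ, so Im ξ < 0 is what Gauss'
limit requires. -/
theorem tendsto_jacobiY {α β : ℝ} (hβα : β < α) (hβ : -(1 / 2) < β) (hα : 1 / 2 < α) {ξ : ℂ}
    (h1 : -(1 / 2) ≤ ξ.im) (h2 : ξ.im < 0) :
    Tendsto (fun t : ℝ => Complex.exp (-(Complex.I * ξ * t)) * jacobiY α β ξ t) atTop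
      (𝓝 (jacobiLeading α β ξ)) := by
  have hρ : 1 < jacobiRho α β := by unfold jacobiRho; linarith
  set a : ℂ := ((jacobiRho α β : ℂ) - Complex.I * ξ) / 2 with ha
  set b : ℂ := ((α - β + 1 : ℝ) - Complex.I * ξ) / 2 with hb
  have ea : a.re = (jacobiRho α β + ξ.im) / 2 := by simp [ha]
  have eb : b.re = (α - β + 1 + ξ.im) / 2 := by simp [hb]
  have hF := tendsto_ordinaryHypergeometric_one (a := a) (b := b) (c := α + 1)
    (by rw [ea]; linarith) (by rw [eb]; linarith)
    (by rw [Complex.sub_re, eb, Complex.ofReal_re]; linarith)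
    (by rw [Complex.sub_re, Complex.sub_re, ea, eb, Complex.ofReal_re]
        unfold jacobiRho; linarith)
  have hT : Tendsto (fun t : ℝ => Real.tanh t ^ 2) atTop (𝓝[<] 1) := by
    refine tendsto_nhdsWithin_of_tendsto_nhds_of_eventually_within _ ?_ ?_
    · simpa using tendsto_tanh_atTop.pow 2
    · filter_upwards [eventually_gt_atTop 0] with t ht using (tanh_sq_mem_Ioo ht).2
  have hF2 := hF.comp hT
  have hE : Tendsto (fun t : ℝ => Complex.exp ((α + 1 / 2) * Real.log (Real.tanh t) +
      jacobiRho α β * Real.log 2 + Complex.I * ξ * ((Real.log (Real.cosh t) - t : ℝ) : ℂ))) atTop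
      (𝓝 (Complex.exp ((α + 1 / 2) * (Real.log 1 : ℝ) +
        jacobiRho α β * Real.log 2 + Complex.I * ξ * ((-Real.log 2 : ℝ) : ℂ)))) := by
    refine (Complex.continuous_exp.tendsto _).comp ?_
    have l1 := (Complex.continuous_ofReal.tendsto _).comp (tendsto_tanh_atTop.log one_ne_zero)
    have l2 := (Complex.continuous_ofReal.tendsto _).comp tendsto_log_cosh_sub
    exact ((l1.const_mul _).add tendsto_const_nhds).add (l2.const_mul _)
  have hlim := hE.mul hF2
  have e1 : jacobiLeading α β ξ = Complex.exp ((α + 1 / 2) * (Real.log 1 : ℝ) +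
        jacobiRho α β * Real.log 2 + Complex.I * ξ * ((-Real.log 2 : ℝ) : ℂ)) *
      (Complex.Gamma ((α + 1 : ℝ) : ℂ) * Complex.Gamma (((α + 1 : ℝ) : ℂ) - b - a) /
        (Complex.Gamma (((α + 1 : ℝ) : ℂ) - a) * Complex.Gamma (((α + 1 : ℝ) : ℂ) - b))) := by
    have g1 : ((α + 1 : ℝ) : ℂ) - b - a = Complex.I * ξ := by
      rw [ha, hb]; unfold jacobiRho; push_cast; ring
    have g2 : ((α + 1 : ℝ) : ℂ) - a = ((jacobiRho α β : ℂ) + Complex.I * ξ) / 2 - β := by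
      rw [ha]; unfold jacobiRho; push_cast; ring
    have g3 : ((α + 1 : ℝ) : ℂ) - b = ((jacobiRho α β : ℂ) + Complex.I * ξ) / 2 := by
      rw [hb]; unfold jacobiRho; push_cast; ring
    rw [g1, g2, g3, jacobiLeading, Real.log_one]
    congr 2
    push_cast
    ring
  rw [e1]
  refine hlim.congr' ?_
  filter_upwards [eventually_gt_atTop 0] with t ht
  rw [jacobiY, jacobiYFactor_eq α β ξ ht, ← mul_assoc, ← Complex.exp_add]
  simp only [Function.comp_apply]
  rw [ordinaryHypergeometric_eq_powSum]
  congr 2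
  push_cast
  ring

/-- For Im ξ < 0 the solution Φ_ξ dominates Φ_{-ξ} at infinity, so the asymptotics fix its
coefficient. The coefficient of the recessive solution stays undetermined here. -/
theorem jacobiY_eq_of_im_neg {α β : ℝ} (hβα : β < α) (hβ : -(1 / 2) < β) (hα : 1 / 2 < α) {ξ : ℂ}
    (h1 : -(1 / 2) ≤ ξ.im) (h2 : ξ.im < 0) :
    ∃ B : ℂ, ∀ t, 0 < t →
      jacobiY α β ξ t = jacobiLeading α β ξ * jost α β ξ t + B * jost α β (-ξ) t := by
  have hξ : ξ ≠ 0 := fun h => by rw [h] at h2; simp at h2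
  have h3 : -(1 / 2) ≤ (-ξ).im := by rw [Complex.neg_im]; linarith
  obtain ⟨A, B, hAB⟩ := exists_eq_jost_add_jost α β h1 (by linarith) hξ
    (fun t ht => hasDerivAt_jacobiY (by linarith) ξ ht)
    (fun t ht => hasDerivAt_jacobiYDeriv (α := α) (β := β) (by linarith) ξ ht)
  refine ⟨B, ?_⟩
  have l1 := (summableOnDisc_jostCoeff α β h1).tendsto_expSum ξ
  have l2 := (summableOnDisc_jostCoeff α β h3).tendsto_expSum (-ξ)
  have l3 : Tendsto (fun t : ℝ => Complex.exp (-(2 * Complex.I * ξ * t))) atTop (𝓝 0) := by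
    rw [tendsto_zero_iff_norm_tendsto_zero]
    simp_rw [Complex.norm_exp]
    have : ∀ t : ℝ, (-(2 * Complex.I * ξ * t)).re = 2 * ξ.im * t := by intro t; simp
    simp_rw [this]
    exact Real.tendsto_exp_atBot.comp (tendsto_id.const_mul_atTop_of_neg (by linarith))
  have l4 := (l1.const_mul A).add ((l3.mul l2).const_mul B)
  simp only [jostCoeff_zero, mul_zero, mul_one, add_zero] at l4
  have hA : A = jacobiLeading α β ξ := by
    refine tendsto_nhds_unique l4 ((tendsto_jacobiY hβα hβ hα h1 h2).congr' ?_)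
    filter_upwards [eventually_gt_atTop 0] with t ht
    rw [hAB t ht]
    have : Complex.exp (-(2 * Complex.I * ξ * t)) * Complex.exp (-(Complex.I * -ξ * t)) =
        Complex.exp (-(Complex.I * ξ * t)) := by
      rw [← Complex.exp_add]; congr 1; ring
    unfold jost
    linear_combination (-B * expSum (jostCoeff α β (-ξ)) (-ξ) t) * this
  rw [← hA]
  exact hAB

theorem continuousAt_jacobiY {α β : ℝ} (hα : -1 < α) (p : ℂ × ℝ) (ht : 0 < p.2) :
    ContinuousAt (fun p : ℂ × ℝ => jacobiY α β p.1 p.2) p := by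
  have hS : 0 < Real.sinh p.2 := Real.sinh_pos_iff.2 ht
  have hC : 0 < Real.cosh p.2 := Real.cosh_pos p.2
  unfold jacobiY
  refine ContinuousAt.mul ?_ ?_
  · unfold jacobiYFactor
    have l1 : ContinuousAt (fun p : ℂ × ℝ => Real.log (2 * Real.sinh p.2)) p :=
      ContinuousAt.log (by fun_prop) (by positivity)
    have l2 : ContinuousAt (fun p : ℂ × ℝ => Real.log (2 * Real.cosh p.2)) p :=
      ContinuousAt.log (by fun_prop) (by positivity)
    have l3 : ContinuousAt (fun p : ℂ × ℝ => Real.log (Real.cosh p.2)) p :=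
      ContinuousAt.log (by fun_prop) (by positivity)
    fun_prop
  · simp_rw [jacobiYCoeff, ← ordinaryHypergeometric_eq_powSum]
    refine continuousAt_ordinaryHypergeometric (by linarith) (by fun_prop) (by fun_prop) ?_
      (norm_tanh_sq_lt p.2)
    have : Continuous fun p : ℂ × ℝ => Real.tanh p.2 := by
      have e : (fun p : ℂ × ℝ => Real.tanh p.2) = fun p => Real.sinh p.2 / Real.cosh p.2 := by
        funext p; rw [Real.tanh_eq_sinh_div_cosh]
      rw [e]
      exact (by fun_prop : Continuous fun p : ℂ × ℝ => Real.sinh p.2).div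
        (by fun_prop) fun p => (Real.cosh_pos p.2).ne'
    exact (Complex.continuous_ofReal.comp (this.pow 2)).continuousAt

theorem continuousAt_jacobiLeading (α β : ℝ) {x : ℝ}
    (hx : x ≠ 0) : ContinuousAt (jacobiLeading α β) x := by
  have hG : ∀ z : ℂ, z.im ≠ 0 → ContinuousAt Complex.Gamma z := fun z hz =>
    (Complex.differentiableAt_Gamma z fun m hm => hz (by rw [hm]; simp)).continuousAt
  have hne : ∀ z : ℂ, z.im ≠ 0 → Complex.Gamma z ≠ 0 := fun z hz =>
    Complex.Gamma_ne_zero fun m hm => hz (by rw [hm]; simp)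
  unfold jacobiLeading
  refine ContinuousAt.mul (by fun_prop) (ContinuousAt.div (continuousAt_const.mul ?_)
    (ContinuousAt.mul ?_ ?_) (mul_ne_zero (hne _ (by simpa using hx)) (hne _ (by simpa using hx))))
  · exact ContinuousAt.comp (f := fun ξ : ℂ => Complex.I * ξ) (g := Complex.Gamma)
      (hG _ (by simpa using hx)) (by fun_prop)
  · exact ContinuousAt.comp (f := fun ξ : ℂ => ((jacobiRho α β : ℂ) + Complex.I * ξ) / 2 - β)
      (g := Complex.Gamma) (hG _ (by simpa using hx)) (by fun_prop)
  · exact ContinuousAt.comp (f := fun ξ : ℂ => ((jacobiRho α β : ℂ) + Complex.I * ξ) / 2)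
      (g := Complex.Gamma) (hG _ (by simpa using hx)) (by fun_prop)

/-- The real point is approached from below along x - iε. The unknown coefficient is recovered from
the values at a single point t₀, which shows that it converges as well. -/
theorem jacobiY_eq_of_real {α β : ℝ} (hβα : β < α) (hβ : -(1 / 2) < β) (hα : 1 / 2 < α) {x : ℝ}
    (hx : x ≠ 0) :
    ∃ B : ℂ, ∀ t, 0 < t →
      jacobiY α β x t = jacobiLeading α β x * jost α β x t + B * jost α β (-x) t := by
  set ξ : ℝ → ℂ := fun ε => x - Complex.I * ε with hξ
  have hξ0 : Tendsto ξ (𝓝[>] 0) (𝓝 (x : ℂ)) := by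
    refine Tendsto.mono_left ?_ nhdsWithin_le_nhds
    exact (by fun_prop : Continuous ξ).tendsto' 0 _ (by simp [hξ])
  have hev : ∀ᶠ ε in 𝓝[>] (0 : ℝ), ∃ B : ℂ, ∀ t, 0 < t → jacobiY α β (ξ ε) t =
      jacobiLeading α β (ξ ε) * jost α β (ξ ε) t + B * jost α β (-ξ ε) t := by
    filter_upwards [Ioo_mem_nhdsGT (by norm_num : (0 : ℝ) < 1 / 2)] with ε hε
    have : (ξ ε).im = -ε := by simp [hξ]
    exact jacobiY_eq_of_im_neg hβα hβ hα (by rw [this]; linarith [hε.2])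
      (by rw [this]; linarith [hε.1])
  have hx0 : (x : ℂ).im = 0 := Complex.ofReal_im x
  have hx0' : (-(x : ℂ)).im = 0 := by simp
  -- If Φ_{-x} vanished identically, its Wronskian with Φ_x would be 0 instead of -2ix.
  obtain ⟨t₀, ht₀, hne⟩ : ∃ t₀ : ℝ, 0 < t₀ ∧ jost α β (-x) t₀ ≠ 0 := by
    by_contra! h
    have := jost_wronskian α β (ξ := (x : ℂ)) (by rw [hx0]; norm_num) (by rw [hx0]; norm_num) one_pos
    have hd : jostDeriv α β (-x) 1 = 0 := by
      refine (hasDerivAt_jost α β (ξ := -(x : ℂ)) (by rw [hx0']; norm_num) one_pos).unique ?_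
      refine (hasDerivAt_const (1 : ℝ) (0 : ℂ)).congr_of_eventuallyEq ?_
      filter_upwards [lt_mem_nhds one_pos] with t ht using h t ht
    rw [hd, h 1 one_pos] at this
    simp [hx] at this
  have cJ : ∀ t, 0 < t → Tendsto (fun ε => jost α β (ξ ε) t) (𝓝[>] 0) (𝓝 (jost α β x t)) :=
    fun t ht => (continuousAt_jost α β (ξ := (x : ℂ)) (by rw [hx0]; norm_num) ht).tendsto.comp hξ0
  have cJ' : ∀ t, 0 < t → Tendsto (fun ε => jost α β (-ξ ε) t) (𝓝[>] 0) (𝓝 (jost α β (-x) t)) :=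
    fun t ht => (continuousAt_jost α β (ξ := -(x : ℂ)) (by rw [hx0']; norm_num) ht).tendsto.comp
      hξ0.neg
  have cY : ∀ t, 0 < t → Tendsto (fun ε => jacobiY α β (ξ ε) t) (𝓝[>] 0) (𝓝 (jacobiY α β x t)) := by
    intro t ht
    have h := (continuousAt_jacobiY (α := α) (β := β) (by linarith) ((x : ℂ), t) ht).tendsto
    exact h.comp (f := fun ε => (ξ ε, t)) (hξ0.prodMk_nhds tendsto_const_nhds)
  have cA : Tendsto (fun ε => jacobiLeading α β (ξ ε)) (𝓝[>] 0) (𝓝 (jacobiLeading α β x)) :=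
    (continuousAt_jacobiLeading α β hx).tendsto.comp hξ0
  refine ⟨(jacobiY α β x t₀ - jacobiLeading α β x * jost α β x t₀) / jost α β (-x) t₀,
    fun t ht => ?_⟩
  have lim := (cA.mul (cJ t ht)).add ((((cY t₀ ht₀).sub (cA.mul (cJ t₀ ht₀))).div (cJ' t₀ ht₀)
    hne).mul (cJ' t ht))
  refine tendsto_nhds_unique (cY t ht) (lim.congr' ?_)
  filter_upwards [hev, (cJ' t₀ ht₀).eventually_ne hne] with ε ⟨B, hB⟩ hε
  simp only [Pi.div_apply]
  rw [hB t ht, hB t₀ ht₀]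
  field_simp
  ring

/-- This is Euler's transformation with a, b = (ρ ∓ ix)/2; the powers of 1 - tanh² t = cosh⁻² t are
absorbed by the exponential prefactor. -/
theorem jacobiY_neg {α β : ℝ} (hβα : β < α) (hρ : 0 < jacobiRho α β) (x t : ℝ) :
    jacobiY α β (-x) t = jacobiY α β x t := by
  have hC : 0 < Real.cosh t := Real.cosh_pos t
  set z : ℂ := (((Real.tanh t) ^ 2 : ℝ) : ℂ) with hz
  have h := ordinaryHypergeometric_euler (a := ((jacobiRho α β : ℂ) - Complex.I * x) / 2)
    (b := ((jacobiRho α β : ℂ) + Complex.I * x) / 2) (c := α + 1) (by simp; linarith)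
    (by simp; linarith) (by simp; unfold jacobiRho; linarith)
    (by simp; unfold jacobiRho; linarith) (norm_tanh_sq_lt t)
  rw [← hz, ordinaryHypergeometric_eq_powSum, ordinaryHypergeometric_eq_powSum] at h
  have e1 : ((α + 1 : ℝ) : ℂ) - ((jacobiRho α β : ℂ) + Complex.I * x) / 2 =
      ((α - β + 1 : ℝ) - Complex.I * x) / 2 := by unfold jacobiRho; push_cast; ring
  have e2 : ((α + 1 : ℝ) : ℂ) - ((jacobiRho α β : ℂ) - Complex.I * x) / 2 =
      ((α - β + 1 : ℝ) - Complex.I * (-x)) / 2 := by unfold jacobiRho; push_cast; ring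
  rw [e1, e2] at h
  have hpow : ∀ s : ℂ, (1 - z) ^ s = Complex.exp (-(2 * s) * Real.log (Real.cosh t)) := by
    intro s
    have : 1 - z = ((Real.cosh t ^ 2)⁻¹ : ℝ) := by
      rw [hz, Real.tanh_eq_sinh_div_cosh]
      rw [← Complex.ofReal_one, ← Complex.ofReal_sub]
      congr 1
      have := Real.cosh_sq t
      field_simp
      linarith
    rw [this, Complex.cpow_def_of_ne_zero (by exact_mod_cast (by positivity)),
      ← Complex.ofReal_log (by positivity), Real.log_inv, Real.log_pow]
    push_cast
    congr 1
    ring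
  rw [hpow, hpow] at h
  have hf : ∀ ξ : ℂ, jacobiYFactor α β ξ t = Complex.exp ((α + 1 / 2) * Real.log (2 * Real.sinh t) +
      (β + 1 / 2) * Real.log (2 * Real.cosh t)) *
      Complex.exp (-(2 * (((jacobiRho α β : ℂ) - Complex.I * ξ) / 2)) * Real.log (Real.cosh t)) := by
    intro ξ
    rw [← Complex.exp_add]
    unfold jacobiYFactor
    congr 1
    ring
  unfold jacobiY jacobiYCoeff
  rw [hf, hf, mul_assoc, mul_assoc, ← hz, h]
  simp

/-- Connection formula between the Jacobi function and the Jost solutions. -/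
theorem jacobiY_eq {α β : ℝ} (hβα : β < α) (hβ : -(1 / 2) < β) (hα : 1 / 2 < α) {x : ℝ}
    (hx : x ≠ 0) {t : ℝ} (ht : 0 < t) :
    jacobiY α β x t = jacobiLeading α β x * jost α β x t + jacobiLeading α β (-x) * jost α β (-x) t := by
  have hρ : 0 < jacobiRho α β := by unfold jacobiRho; linarith
  obtain ⟨B, hB⟩ := jacobiY_eq_of_real hβα hβ hα hx
  obtain ⟨B', hB'⟩ := jacobiY_eq_of_real hβα hβ hα (neg_ne_zero.2 hx)
  push_cast at hB'
  simp only [neg_neg] at hB'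
  have hx0' : (-(x : ℂ)).im = 0 := by simp
  -- Evenness equates the expansions at x and at -x, and independence of the Jost solutions then
  -- identifies the unknown coefficient.
  have h0 : jacobiLeading α β (-x) - B = 0 := by
    refine jost_linear_independent α β (ξ := -(x : ℂ)) (Y := jacobiLeading α β x - B')
      (by rw [hx0']; norm_num) (by rw [hx0']; norm_num) (by simpa using hx) fun t ht => ?_
    rw [neg_neg]
    have := jacobiY_neg hβα hρ x t
    rw [hB t ht, hB' t ht] at this
    linear_combination this
  rw [hB t ht, sub_eq_zero.1 h0]

/-- Legendre's duplication formula splits Γ(iξ) into the two Gamma factors in the numerator of the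
c-function. -/
theorem jacobiLeading_eq (α β : ℝ) (ξ : ℂ) :
    jacobiLeading α β ξ = (Real.Gamma (α + 1) / (2 * √Real.pi) : ℝ) * jacobiC α β ξ := by
  have h := Complex.Gamma_mul_Gamma_add_half (Complex.I * ξ / 2)
  rw [show Complex.I * ξ / 2 + 1 / 2 = (1 + Complex.I * ξ) / 2 by ring,
    show 2 * (Complex.I * ξ / 2) = Complex.I * ξ by ring] at h
  have hlog : Complex.log 2 = (Real.log 2 : ℝ) := by
    rw [← Complex.ofReal_ofNat, Complex.ofReal_log (by norm_num)]
  have h2 : ∀ s : ℂ, (2 : ℂ) ^ s = Complex.exp (s * Real.log 2) := by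
    intro s
    rw [Complex.cpow_def_of_ne_zero two_ne_zero, hlog, mul_comm]
  have hpi : (√Real.pi : ℂ) ≠ 0 := by
    exact_mod_cast (Real.sqrt_pos.2 Real.pi_pos).ne'
  unfold jacobiLeading jacobiC
  rw [mul_assoc ((2 : ℂ) ^ (jacobiRho α β : ℂ)), h, h2, h2, Complex.Gamma_ofReal]
  rw [sub_mul (jacobiRho α β : ℂ), sub_mul (1 : ℂ), Complex.exp_sub, Complex.exp_sub, one_mul]
  have e2 : Complex.exp (Real.log 2 : ℝ) = 2 := by
    rw [← Complex.ofReal_exp, Real.exp_log two_pos]; norm_num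
  rw [e2]
  push_cast
  have := Complex.exp_ne_zero (Complex.I * ξ * Complex.log 2)
  field_simp

/-- For t ≥ 1 one has sinh t ≥ 1, so the definition of φ is already in its Pfaff branch, a series in
tanh² t. The cutoff makes smaller t irrelevant. -/
theorem jacobiPhi_eq {α β : ℝ} (ξ : ℂ) {t : ℝ} (ht : 1 ≤ t) :
    (Real.sqrt (jacobiWeight α β t) : ℂ) * jacobiPhi α β ξ t = jacobiY α β ξ t := by
  have ht0 : 0 < t := by linarith
  have hS : 0 < Real.sinh t := Real.sinh_pos_iff.2 ht0
  have hS1 : 1 ≤ Real.sinh t := ht.trans (Real.self_le_sinh_iff.2 ht0.le)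
  have hC : 0 < Real.cosh t := Real.cosh_pos t
  have hz : ¬ ‖-((Real.sinh t : ℂ) ^ 2)‖ < 1 := by
    rw [norm_neg, norm_pow, Complex.norm_real, Real.norm_of_nonneg hS.le, not_lt]
    exact one_le_pow₀ hS1
  unfold jacobiPhi gaussHypergeometric
  rw [if_neg hz]
  have hcs := Real.cosh_sq t
  have e1 : (1 - -((Real.sinh t : ℂ) ^ 2)) = ((Real.cosh t ^ 2 : ℝ) : ℂ) := by
    rw [hcs]; push_cast; ring
  have e2 : -((Real.sinh t : ℂ) ^ 2) / (-((Real.sinh t : ℂ) ^ 2) - 1) =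
      ((Real.tanh t ^ 2 : ℝ) : ℂ) := by
    have : -((Real.sinh t : ℂ) ^ 2) - 1 = -((Real.cosh t ^ 2 : ℝ) : ℂ) := by rw [hcs]; push_cast; ring
    rw [this, neg_div_neg_eq, Real.tanh_eq_sinh_div_cosh, div_pow]
    push_cast; rfl
  have e3 : ((α : ℂ) + 1) - ((jacobiRho α β : ℂ) + Complex.I * ξ) / 2 =
      ((α - β + 1 : ℝ) - Complex.I * ξ) / 2 := by unfold jacobiRho; push_cast; ring
  have e4 : (α : ℂ) + 1 = ((α + 1 : ℝ) : ℂ) := by push_cast; rfl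
  rw [e1, e2, e3, e4, ordinaryHypergeometric_eq_powSum, ← mul_assoc]
  unfold jacobiY jacobiYCoeff
  congr 1
  rw [Complex.cpow_def_of_ne_zero (by exact_mod_cast (by positivity)),
    ← Complex.ofReal_log (by positivity), Real.log_pow]
  have e5 : Real.sqrt (jacobiWeight α β t) = Real.exp ((α + 1 / 2) * Real.log (2 * Real.sinh t) +
      (β + 1 / 2) * Real.log (2 * Real.cosh t)) := by
    unfold jacobiWeight
    rw [Real.sqrt_eq_iff_mul_self_eq (by positivity) (Real.exp_pos _).le, ← Real.exp_add,
      Real.rpow_def_of_pos (by positivity), Real.rpow_def_of_pos (by positivity), ← Real.exp_add]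
    congr 1; ring
  rw [e5, Complex.ofReal_exp, ← Complex.exp_add]
  unfold jacobiYFactor
  push_cast
  congr 1
  ring

/-! ### Test functions on [1, ∞) and their Fourier transforms -/

/-- Smooth compactly supported functions that vanish on `(-∞, 1)`. -/
structure IsTestIci (G : ℝ → ℂ) : Prop where
  contDiff : ContDiff ℝ ∞ G
  hasCompactSupport : HasCompactSupport G
  eq_zero : ∀ t, t < 1 → G t = 0

/-- The Fourier transform `∫ G(t) e^{iζt} dt` at a complex point `ζ`. -/
noncomputable def expTransform (G : ℝ → ℂ) (ζ : ℂ) : ℂ :=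
  ∫ t : ℝ, G t * Complex.exp (Complex.I * ζ * t)

namespace IsTestIci

variable {G : ℝ → ℂ}

theorem continuous (hG : IsTestIci G) : Continuous G := hG.contDiff.continuous

/-- Multipliers such as t⁻¹ and √Δ may be singular at 0, where the test function vanishes. -/
theorem mul_left (hG : IsTestIci G) {φ : ℝ → ℂ} (hφ : ContDiffOn ℝ ∞ φ (Ioi 0)) :
    IsTestIci fun t => φ t * G t where
  contDiff := by
    rw [contDiff_iff_contDiffAt]
    intro t
    rcases lt_or_ge 0 t with ht | ht
    · exact (hφ.contDiffAt (Ioi_mem_nhds ht)).mul hG.contDiff.contDiffAt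
    · refine (contDiffAt_const (c := (0 : ℂ))).congr_of_eventuallyEq ?_
      filter_upwards [gt_mem_nhds (ht.trans_lt one_pos)] with s hs
      rw [hG.eq_zero s hs, mul_zero]
  hasCompactSupport := hG.hasCompactSupport.mul_left
  eq_zero t ht := by rw [hG.eq_zero t ht, mul_zero]

theorem deriv (hG : IsTestIci G) : IsTestIci (deriv G) where
  contDiff := (contDiff_infty_iff_deriv.1 hG.contDiff).2
  hasCompactSupport := hG.hasCompactSupport.deriv
  eq_zero t ht := by
    have : G =ᶠ[𝓝 t] fun _ => 0 := by
      filter_upwards [gt_mem_nhds ht] with s hs using hG.eq_zero s hs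
    rw [this.deriv_eq, deriv_const]

theorem integrable_mul (hG : IsTestIci G) {φ : ℝ → ℂ} (hφ : Continuous φ) :
    Integrable fun t => G t * φ t :=
  (hG.continuous.mul hφ).integrable_of_hasCompactSupport hG.hasCompactSupport.mul_right

/-- Support in t ≥ 1 yields the factor e^{-Im ζ}. At the points x + 2ki it becomes e^{-2k}, which
controls the sums over k. -/
theorem norm_expTransform_le (hG : IsTestIci G) {ζ : ℂ} (hζ : 0 ≤ ζ.im) :
    ‖expTransform G ζ‖ ≤ (∫ t, ‖G t‖) * Real.exp (-ζ.im) := by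
  have hi := (hG.continuous.integrable_of_hasCompactSupport hG.hasCompactSupport
    (μ := volume)).norm
  rw [← integral_mul_const]
  refine norm_integral_le_of_norm_le (hi.mul_const _) (Eventually.of_forall fun t => ?_)
  rw [norm_mul]
  rcases lt_or_ge t 1 with ht | ht
  · rw [hG.eq_zero t ht]; simp
  · refine mul_le_mul_of_nonneg_left ?_ (norm_nonneg _)
    rw [Complex.norm_exp, Real.exp_le_exp]
    have : (Complex.I * ζ * t).re = -(ζ.im * t) := by simp
    rw [this]
    nlinarith

theorem expTransform_deriv (hG : IsTestIci G) (ζ : ℂ) :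
    expTransform (_root_.deriv G) ζ = -(Complex.I * ζ) * expTransform G ζ := by
  have hE : ∀ t : ℝ, HasDerivAt (fun t : ℝ => Complex.exp (Complex.I * ζ * t))
      (Complex.exp (Complex.I * ζ * t) * (Complex.I * ζ)) t := by
    intro t
    simpa using ((hasDerivAt_id (t : ℂ)).const_mul (Complex.I * ζ)).cexp.comp_ofReal
  have hd : ∀ t : ℝ, HasDerivAt G (_root_.deriv G t) t := fun t =>
    (hG.contDiff.differentiable (by simp) t).hasDerivAt
  have := integral_mul_deriv_eq_deriv_mul_of_integrable (u := G)
    (v := fun t : ℝ => Complex.exp (Complex.I * ζ * t)) (u' := _root_.deriv G)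
    (v' := fun t : ℝ => Complex.exp (Complex.I * ζ * t) * (Complex.I * ζ))
    (fun t _ => hd t) (fun t _ => hE t) (hG.integrable_mul (by fun_prop))
    (hG.deriv.integrable_mul (by fun_prop)) (hG.integrable_mul (by fun_prop))
  unfold expTransform
  rw [← neg_eq_iff_eq_neg.2 this, ← integral_const_mul, ← integral_neg]
  congr 1
  funext t
  ring

theorem exists_norm_expTransform_le (n : ℕ) :
    ∀ {G : ℝ → ℂ}, IsTestIci G → ∃ C : ℝ, 0 ≤ C ∧ ∀ ζ : ℂ, 0 ≤ ζ.im →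
      ‖ζ‖ ^ n * ‖expTransform G ζ‖ ≤ C * Real.exp (-ζ.im) := by
  induction n with
  | zero =>
    intro G hG
    exact ⟨∫ t, ‖G t‖, integral_nonneg fun _ => norm_nonneg _, fun ζ hζ => by
      simpa using hG.norm_expTransform_le hζ⟩
  | succ n ih =>
    intro G hG
    obtain ⟨C, hC, h⟩ := ih hG.deriv
    refine ⟨C, hC, fun ζ hζ => ?_⟩
    have := h ζ hζ
    rw [hG.expTransform_deriv, norm_mul, norm_neg, norm_mul, Complex.norm_I, one_mul,
      ← mul_assoc, ← pow_succ] at this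
    exact this

theorem exists_norm_expTransform_le_one_add (hG : IsTestIci G) (n : ℕ) :
    ∃ C : ℝ, 0 ≤ C ∧ ∀ ζ : ℂ, 0 ≤ ζ.im →
      (1 + ‖ζ‖) ^ n * ‖expTransform G ζ‖ ≤ C * Real.exp (-ζ.im) := by
  obtain ⟨C₀, h0, h0'⟩ := exists_norm_expTransform_le 0 hG
  obtain ⟨C₁, h1, h1'⟩ := exists_norm_expTransform_le n hG
  refine ⟨2 ^ (n - 1) * (C₀ + C₁), by positivity, fun ζ hζ => ?_⟩
  have := add_pow_le zero_le_one (norm_nonneg ζ) n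
  have h2 := h0' ζ hζ
  rw [pow_zero] at h2
  rw [one_pow] at this
  calc _ ≤ 2 ^ (n - 1) * (1 + ‖ζ‖ ^ n) * ‖expTransform G ζ‖ := by gcongr
    _ = 2 ^ (n - 1) * (1 * ‖expTransform G ζ‖ + ‖ζ‖ ^ n * ‖expTransform G ζ‖) := by ring
    _ ≤ 2 ^ (n - 1) * (C₀ * Real.exp (-ζ.im) + C₁ * Real.exp (-ζ.im)) := by
        refine mul_le_mul_of_nonneg_left (add_le_add ?_ (h1' ζ hζ)) (by positivity)
        rwa [one_mul] at h2 ⊢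
    _ = _ := by ring

theorem hasDerivAt_expTransform (hG : IsTestIci G) (ζ : ℂ) :
    HasDerivAt (expTransform G) (expTransform (fun t => Complex.I * t * G t) ζ) ζ := by
  have key := hasDerivAt_integral_of_dominated_loc_of_deriv_le (μ := volume) (𝕜 := ℂ)
    (F := fun ζ (t : ℝ) => G t * Complex.exp (Complex.I * ζ * t))
    (F' := fun ζ (t : ℝ) => G t * (Complex.exp (Complex.I * ζ * t) * (Complex.I * t)))
    (x₀ := ζ) (s := Metric.ball ζ 1)
    (bound := fun t => ‖G t * ((|t| * Real.exp ((‖ζ‖ + 1) * |t|) : ℝ) : ℂ)‖)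
    (Metric.ball_mem_nhds ζ one_pos)
    (Eventually.of_forall fun z => (hG.integrable_mul (by fun_prop)).aestronglyMeasurable)
    (hG.integrable_mul (by fun_prop)) (hG.integrable_mul (by fun_prop)).aestronglyMeasurable
    (Eventually.of_forall fun t z hz => ?_) (hG.integrable_mul ?_).norm
    (Eventually.of_forall fun t z hz => ?_)
  · refine (key.2).congr_deriv ?_
    unfold expTransform
    congr 1
    funext t
    ring
  · rw [norm_mul, norm_mul, norm_mul, norm_mul, Complex.norm_I, one_mul, Complex.norm_real,
      Complex.norm_real, Real.norm_of_nonneg (by positivity : 0 ≤ |t| * Real.exp ((‖ζ‖ + 1) * |t|)),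
      mul_comm ‖Complex.exp _‖, Real.norm_eq_abs, Complex.norm_exp]
    refine mul_le_mul_of_nonneg_left (mul_le_mul_of_nonneg_left (Real.exp_le_exp.2 ?_)
      (abs_nonneg t)) (norm_nonneg _)
    refine (Complex.re_le_norm _).trans ?_
    rw [norm_mul, norm_mul, Complex.norm_I, one_mul, Complex.norm_real, Real.norm_eq_abs]
    gcongr
    rw [mem_ball_iff_norm] at hz
    have := norm_add_le (z - ζ) ζ
    rw [sub_add_cancel] at this
    linarith
  · exact Complex.continuous_ofReal.comp (by fun_prop)
  · refine HasDerivAt.const_mul _ ?_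
    simpa using (((hasDerivAt_id z).const_mul Complex.I).mul_const (t : ℂ)).cexp

/-- Division by it produces a primitive of the Fourier transform in ζ, as needed to integrate by
parts on the spectral side. -/
theorem div_I_mul (hG : IsTestIci G) : IsTestIci fun t => (Complex.I * t)⁻¹ * G t :=
  hG.mul_left (by
    refine ContDiffOn.inv (contDiff_const.mul Complex.ofRealCLM.contDiff).contDiffOn ?_
    intro t ht
    have : (t : ℂ) ≠ 0 := by exact_mod_cast (mem_Ioi.1 ht).ne'
    simpa using this)

theorem I_mul_div_I_mul (hG : IsTestIci G) :
    (fun t : ℝ => Complex.I * t * ((Complex.I * t)⁻¹ * G t)) = G := by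
  funext t
  by_cases ht : t = 0
  · rw [ht, hG.eq_zero 0 one_pos]; simp
  · have : (t : ℂ) ≠ 0 := by exact_mod_cast ht
    rw [← mul_assoc, mul_inv_cancel₀ (mul_ne_zero Complex.I_ne_zero this), one_mul]

end IsTestIci

/-! ### Plancherel duality, shift of contour and integration by parts -/

theorem memLp_two_inv_one_add_abs : MemLp (fun x : ℝ => (1 + |x|)⁻¹) 2 := by
  have hc : Continuous fun x : ℝ => (1 + |x|)⁻¹ :=
    Continuous.inv₀ (by fun_prop) fun x => by positivity
  rw [memLp_two_iff_integrable_sq hc.aestronglyMeasurable]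
  have := integrable_one_add_norm (E := ℝ) (μ := volume) (r := 2) (by simp)
  refine this.congr (Eventually.of_forall fun x => ?_)
  simp only [Real.norm_eq_abs]
  rw [Real.rpow_neg (by positivity), Real.rpow_two, inv_pow]

/-- Fourier duality for functions of size `O((1 + |x|)⁻¹)`. -/
theorem exists_fourier_dual : ∃ C₀ : ℝ, 0 ≤ C₀ ∧ ∀ (A : ℝ → ℂ) (K : ℝ), 0 ≤ K → Continuous A →
    (∀ x, ‖A x‖ ≤ K * (1 + |x|)⁻¹) → ∃ J : Lp ℂ 2 (volume : Measure ℝ), ‖J‖ ≤ C₀ * K ∧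
      ∀ H : ℝ → ℂ, ContDiff ℝ ∞ H → HasCompactSupport H →
        ∫ x, A x * expTransform H x = ∫ t, J t * H t := by
  have h2 := memLp_two_inv_one_add_abs
  refine ⟨2 * Real.pi * (eLpNorm (fun x : ℝ => (1 + |x|)⁻¹) 2).toReal, by positivity, ?_⟩
  intro A K hK hA hAK
  -- Mathlib's Fourier transform has the kernel e^{-2πitw}, so that of H at w is `expTransform H` at
  -- -2πw. The function B is A in this variable, with the Jacobian 2π.
  set B : ℝ → ℂ := fun w => (2 * Real.pi : ℝ) * A (-(2 * Real.pi) * w) with hB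
  have hBc : Continuous B := by fun_prop
  have hpi : 1 ≤ 2 * Real.pi := by linarith [Real.pi_gt_three]
  have hBle : ∀ w, ‖B w‖ ≤ (2 * Real.pi * K) * ‖(1 + |w|)⁻¹‖ := by
    intro w
    rw [hB, norm_mul, Complex.norm_real, Real.norm_of_nonneg (by positivity),
      mul_assoc (2 * Real.pi) K, Real.norm_of_nonneg (by positivity)]
    refine mul_le_mul_of_nonneg_left ((hAK _).trans ?_) (by positivity)
    refine mul_le_mul_of_nonneg_left (inv_anti₀ (by positivity) ?_) hK
    rw [abs_mul, abs_neg, abs_of_pos Real.two_pi_pos]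
    have := abs_nonneg w
    nlinarith
  have hBm : MemLp B 2 := h2.of_le_mul hBc.aestronglyMeasurable (Eventually.of_forall hBle)
  set b : Lp ℂ 2 (volume : Measure ℝ) := hBm.toLp B with hb
  refine ⟨FourierTransform.fourier b, ?_, ?_⟩
  · rw [Lp.norm_fourier_eq, hb, Lp.norm_toLp]
    have := eLpNorm_le_mul_eLpNorm_of_ae_le_mul (p := 2) (μ := (volume : Measure ℝ))
      (Eventually.of_forall hBle)
    have h3 := ENNReal.toReal_mono (ENNReal.mul_ne_top ENNReal.ofReal_ne_top h2.eLpNorm_ne_top) this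
    rw [ENNReal.toReal_mul, ENNReal.toReal_ofReal (by positivity)] at h3
    linarith
  · intro H hH hHc
    have e := congrArg (fun T => T (hHc.toSchwartzMap hH)) (Lp.fourier_toTemperedDistribution_eq b)
    simp only [TemperedDistribution.fourier_apply, Lp.toTemperedDistribution_apply] at e
    have e1 : ∫ t, (FourierTransform.fourier b : Lp ℂ 2 (volume : Measure ℝ)) t * H t =
        ∫ x, (hHc.toSchwartzMap hH) x • (FourierTransform.fourier b : Lp ℂ 2 (volume : Measure ℝ)) x := by
      refine integral_congr_ae (Eventually.of_forall fun t => ?_)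
      simp [mul_comm]
    rw [e1, ← e]
    have e2 : ∀ w : ℝ, (FourierTransform.fourier (hHc.toSchwartzMap hH)) w =
        expTransform H ((-(2 * Real.pi) * w : ℝ) : ℂ) := by
      intro w
      rw [SchwartzMap.fourier_coe, Real.fourier_eq']
      unfold expTransform
      refine integral_congr_ae (Eventually.of_forall fun t => ?_)
      simp only [smul_eq_mul]
      rw [mul_comm]
      congr 1
      congr 1
      simp
      ring
    have e3 : ∫ x, (FourierTransform.fourier (hHc.toSchwartzMap hH)) x • b x =
        ∫ w, (2 * Real.pi : ℝ) * (A (-(2 * Real.pi) * w) *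
          expTransform H ((-(2 * Real.pi) * w : ℝ) : ℂ)) := by
      refine integral_congr_ae ?_
      filter_upwards [hBm.coeFn_toLp] with w hw
      rw [hb, hw, e2, smul_eq_mul, hB]
      ring
    rw [e3, integral_const_mul]
    have := Measure.integral_comp_mul_left (fun x : ℝ => A x * expTransform H x) (-(2 * Real.pi))
    rw [this, abs_inv, abs_neg, abs_of_nonneg (by positivity), Complex.real_smul, ← mul_assoc,
      ← Complex.ofReal_mul, mul_inv_cancel₀ (by positivity), Complex.ofReal_one, one_mul]

theorem integrable_of_norm_le_inv_sq {F : ℝ → ℂ} (hF : Continuous F) {C : ℝ}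
    (h : ∀ x, ‖F x‖ ≤ C * ((1 + |x|) ^ 2)⁻¹) : Integrable F := by
  have := (integrable_one_add_norm (E := ℝ) (μ := volume) (r := 2) (by simp)).const_mul C
  refine this.mono' hF.aestronglyMeasurable (Eventually.of_forall fun x => (h x).trans (le_of_eq ?_))
  rw [Real.norm_eq_abs, Real.rpow_neg (by positivity), Real.rpow_two]

/-- Cauchy's theorem on the rectangles [-R, R] × [0, η]; the bound makes the vertical sides vanish
as R → ∞. -/
theorem integral_eq_integral_add_mul_I {F : ℂ → ℂ} {η C : ℝ} (hη : 0 ≤ η)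
    (hF : ∀ ζ : ℂ, 0 ≤ ζ.im → ζ.im ≤ η → DifferentiableAt ℂ F ζ)
    (hC : ∀ ζ : ℂ, 0 ≤ ζ.im → ζ.im ≤ η → ‖F ζ‖ ≤ C * ((1 + |ζ.re|) ^ 2)⁻¹) :
    ∫ x : ℝ, F x = ∫ x : ℝ, F (x + η * Complex.I) := by
  have hline : ∀ y : ℝ, 0 ≤ y → y ≤ η → Integrable fun x : ℝ => F (x + y * Complex.I) := by
    intro y h0 h1
    refine integrable_of_norm_le_inv_sq (C := C) ?_ fun x => by
      simpa using hC (x + y * Complex.I) (by simpa using h0) (by simpa using h1)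
    refine continuous_iff_continuousAt.2 fun x => ?_
    exact ContinuousAt.comp (f := fun x : ℝ => (x : ℂ) + y * Complex.I)
      (hF (x + y * Complex.I) (by simpa using h0) (by simpa using h1)).continuousAt (by fun_prop)
  have h0 := hline 0 le_rfl hη
  have h1 := hline η hη le_rfl
  simp only [Complex.ofReal_zero, zero_mul, add_zero] at h0
  have t0 := intervalIntegral_tendsto_integral h0 tendsto_neg_atTop_atBot tendsto_id
  have t1 := intervalIntegral_tendsto_integral h1 tendsto_neg_atTop_atBot tendsto_id
  have hrect : ∀ R : ℝ, ((∫ x in -R..R, F x) - ∫ x in -R..R, F (x + η * Complex.I)) =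
      -(Complex.I * ∫ y in (0 : ℝ)..η, F (R + y * Complex.I)) +
        Complex.I * ∫ y in (0 : ℝ)..η, F ((-R : ℝ) + y * Complex.I) := by
    intro R
    have := Complex.integral_boundary_rect_eq_zero_of_differentiableOn F (-R : ℝ)
      (R + η * Complex.I) (fun ζ hζ => by
        rw [Complex.mem_reProdIm] at hζ
        simp [uIcc_of_le hη] at hζ
        exact (hF ζ hζ.2.1 hζ.2.2).differentiableWithinAt)
    simp at this
    push_cast at this ⊢
    linear_combination this
  have hside : ∀ σ : ℝ, |σ| = 1 → Tendsto (fun R : ℝ => ∫ y in (0 : ℝ)..η, F ((σ * R : ℝ) + y * Complex.I))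
      atTop (𝓝 0) := by
    intro σ hσ
    have hd : Tendsto (fun R : ℝ => C * ((1 + |R|) ^ 2)⁻¹ * |η - 0|) atTop (𝓝 0) := by
      have : Tendsto (fun R : ℝ => ((1 + |R|) ^ 2)) atTop atTop :=
        (tendsto_pow_atTop two_ne_zero).comp (tendsto_atTop_add_const_left _ _ tendsto_abs_atTop_atTop)
      simpa using (this.inv_tendsto_atTop.const_mul C).mul_const |η - 0|
    refine squeeze_zero_norm (fun R => ?_) hd
    refine intervalIntegral.norm_integral_le_of_norm_le_const fun y hy => ?_
    rw [uIoc_of_le hη] at hy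
    simpa [abs_mul, hσ] using hC ((σ * R : ℝ) + y * Complex.I) (by simpa using hy.1.le) (by simpa using hy.2)
  have s1 := hside 1 (by simp)
  have s2 := hside (-1) (by simp)
  have t2 := (((s1.const_mul Complex.I).neg).add (s2.const_mul Complex.I)).congr
    fun R => by simpa using (hrect R).symm
  have := tendsto_nhds_unique t2 (t0.sub t1)
  simp only [mul_zero, neg_zero, add_zero] at this
  exact sub_eq_zero.1 this.symm

theorem expTransform_add_mul_I (G : ℝ → ℂ) (ζ : ℂ) (y : ℝ) :
    expTransform G (ζ + y * Complex.I) = expTransform (fun t => Complex.exp (-y * t) * G t) ζ := by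
  unfold expTransform
  refine integral_congr_ae (Eventually.of_forall fun t => ?_)
  simp only
  have e : Complex.I * (ζ + y * Complex.I) * t = -y * t + Complex.I * ζ * t := by
    linear_combination (y : ℂ) * t * Complex.I_sq
  rw [e, Complex.exp_add]
  ring

theorem IsTestIci.cexp_mul {G : ℝ → ℂ} (hG : IsTestIci G) (y : ℝ) :
    IsTestIci fun t => Complex.exp (-y * t) * G t :=
  hG.mul_left (by
    refine ContDiff.contDiffOn ?_
    exact (contDiff_const.mul Complex.ofRealCLM.contDiff).cexp)

/-- All derivatives of `u` up to the order `n` grow at most polynomially. -/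
def HasPolyGrowth (n : ℕ) (u : ℝ → ℂ) : Prop :=
  ∃ (C : ℝ) (p : ℕ), ∀ j ≤ n, ∀ x, ‖iteratedDeriv j u x‖ ≤ C * (1 + |x|) ^ p

theorem IsTestIci.integrable_mul_expTransform {G u : ℝ → ℂ} (hG : IsTestIci G) (hu : Continuous u)
    {C : ℝ} {p : ℕ} (h : ∀ x, ‖u x‖ ≤ C * (1 + |x|) ^ p) :
    Integrable fun x : ℝ => u x * expTransform G x := by
  obtain ⟨K, hK, hK'⟩ := hG.exists_norm_expTransform_le_one_add (p + 2)
  have hc : Continuous (expTransform G) :=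
    continuous_iff_continuousAt.2 fun ζ => (hG.hasDerivAt_expTransform ζ).continuousAt
  have hC : 0 ≤ C := by simpa using (norm_nonneg _).trans (h 0)
  refine integrable_of_norm_le_inv_sq (C := C * K)
    (hu.mul (hc.comp Complex.continuous_ofReal)) fun x => ?_
  have h1 := hK' x (by simp)
  simp at h1
  rw [norm_mul, ← div_eq_mul_inv, le_div_iff₀ (by positivity)]
  calc ‖u x‖ * ‖expTransform G x‖ * (1 + |x|) ^ 2
      ≤ C * (1 + |x|) ^ p * ‖expTransform G x‖ * (1 + |x|) ^ 2 := by gcongr; exact h x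
    _ = C * ((1 + |x|) ^ (p + 2) * ‖expTransform G x‖) := by ring
    _ ≤ C * K := by gcongr

/-- Each integration by parts moves one derivative onto u and one factor -(it)⁻¹ onto the test
function. Rapid decay of the transform beats the polynomial growth, so there are no boundary terms.
-/
theorem integral_mul_expTransform_eq (n : ℕ) : ∀ {u : ℝ → ℂ} {G : ℝ → ℂ}, ContDiff ℝ ∞ u →
    HasPolyGrowth n u → IsTestIci G → ∫ x : ℝ, u x * expTransform G x =
      ∫ x : ℝ, iteratedDeriv n u x *
        expTransform (fun t => (-1) ^ n * ((Complex.I * t)⁻¹ ^ n * G t)) x := by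
  induction n with
  | zero => intro u G _ _ _; simp
  | succ n ih =>
    intro u G hu hg hG
    obtain ⟨C, p, h⟩ := hg
    have hG1 := hG.div_I_mul
    have hu' : ContDiff ℝ ∞ (deriv u) := (contDiff_infty_iff_deriv.1 hu).2
    have hE : ∀ x : ℝ, HasDerivAt (fun x : ℝ => expTransform (fun t => (Complex.I * t)⁻¹ * G t) x)
        (expTransform G x) x := fun x => by
      have := (hG1.hasDerivAt_expTransform x).comp_ofReal
      rwa [hG.I_mul_div_I_mul] at this
    have h0 : ∀ x, ‖u x‖ ≤ C * (1 + |x|) ^ p := fun x => by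
      simpa using h 0 (Nat.zero_le _) x
    have h1 : ∀ x, ‖deriv u x‖ ≤ C * (1 + |x|) ^ p := fun x => by
      simpa using h 1 (by omega) x
    have key := integral_mul_deriv_eq_deriv_mul_of_integrable (u := u)
      (v := fun x : ℝ => expTransform (fun t => (Complex.I * t)⁻¹ * G t) x)
      (u' := deriv u) (v' := fun x : ℝ => expTransform G x)
      (fun x _ => (hu.differentiable (by simp) x).hasDerivAt) (fun x _ => hE x)
      (hG.integrable_mul_expTransform hu.continuous h0)
      (hG1.integrable_mul_expTransform hu'.continuous h1)
      (hG1.integrable_mul_expTransform hu.continuous h0)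
    rw [key, ih hu' ⟨C, p, fun j hj x => ?_⟩ hG1, iteratedDeriv_succ', ← integral_neg]
    · refine integral_congr_ae (Eventually.of_forall fun x => ?_)
      simp only
      rw [← mul_neg]
      congr 1
      unfold expTransform
      rw [← integral_neg]
      refine integral_congr_ae (Eventually.of_forall fun t => ?_)
      simp only
      ring
    · rw [← iteratedDeriv_succ']
      exact h (j + 1) (by omega) x

/-! ### Symbol estimates -/

theorem DifferentiableOn.iteratedDeriv_of_isOpen {f : ℂ → ℂ} {U : Set ℂ}
    (hf : DifferentiableOn ℂ f U) (hU : IsOpen U) (j : ℕ) :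
    DifferentiableOn ℂ (iteratedDeriv j f) U := by
  induction j with
  | zero => simpa using hf
  | succ j ih => rw [iteratedDeriv_succ]; exact ih.deriv hU

theorem iteratedDeriv_comp_ofReal_add {f : ℂ → ℂ} {U : Set ℂ} (hU : IsOpen U)
    (hf : DifferentiableOn ℂ f U) {c : ℂ} (hc : ∀ x : ℝ, (x : ℂ) + c ∈ U) (j : ℕ) :
    iteratedDeriv j (fun x : ℝ => f (x + c)) = fun x : ℝ => iteratedDeriv j f (x + c) := by
  induction j with
  | zero => simp
  | succ j ih =>
    funext x
    rw [iteratedDeriv_succ, ih, iteratedDeriv_succ]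
    have h1 := (hf.iteratedDeriv_of_isOpen hU j).differentiableAt (hU.mem_nhds (hc x))
    exact (h1.hasDerivAt.comp_add_const (x : ℂ) c).comp_ofReal.deriv

theorem contDiff_comp_ofReal_add {f : ℂ → ℂ} {U : Set ℂ} (hU : IsOpen U)
    (hf : DifferentiableOn ℂ f U) {c : ℂ} (hc : ∀ x : ℝ, (x : ℂ) + c ∈ U) :
    ContDiff ℝ ∞ fun x : ℝ => f (x + c) := by
  refine contDiff_iff_contDiffAt.2 fun x => ?_
  have : ContDiffAt ℂ ∞ f (x + c) := (hf.analyticAt (hU.mem_nhds (hc x))).contDiffAt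
  exact ContDiffAt.comp x (f := fun x : ℝ => (x : ℂ) + c) (this.restrict_scalars ℝ)
    (Complex.ofRealCLM.contDiff.contDiffAt.add contDiffAt_const)

theorem norm_iteratedDeriv_mul_le {u v : ℝ → ℂ} (hu : ContDiff ℝ ∞ u) (hv : ContDiff ℝ ∞ v)
    {x w a b : ℝ} (hw : 0 < w) (n : ℕ)
    (h1 : ∀ i ≤ n, ‖iteratedDeriv i u x‖ ≤ a * (w ^ i)⁻¹)
    (h2 : ∀ i ≤ n, ‖iteratedDeriv i v x‖ ≤ b * (w ^ i)⁻¹) :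
    ‖iteratedDeriv n (fun x => u x * v x) x‖ ≤ 2 ^ n * (a * b) * (w ^ n)⁻¹ := by
  have hb : 0 ≤ b := by simpa using (norm_nonneg _).trans (h2 0 (Nat.zero_le _))
  have ha : 0 ≤ a := by simpa using (norm_nonneg _).trans (h1 0 (Nat.zero_le _))
  rw [iteratedDeriv_fun_mul (hu.contDiffAt.of_le (by exact_mod_cast le_top))
    (hv.contDiffAt.of_le (by exact_mod_cast le_top))]
  have e : (2 : ℝ) ^ n * (a * b) * (w ^ n)⁻¹ =
      ∑ i ∈ Finset.range (n + 1), (n.choose i : ℝ) * (a * b * (w ^ n)⁻¹) := by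
    rw [← Finset.sum_mul, ← Nat.cast_sum, Nat.sum_range_choose]
    push_cast; ring
  rw [e]
  refine norm_sum_le_of_le _ fun i hi => ?_
  have hi' := Finset.mem_range_succ_iff.1 hi
  rw [norm_mul, norm_mul, Complex.norm_natCast, mul_assoc]
  refine mul_le_mul_of_nonneg_left ?_ (by positivity)
  calc _ ≤ a * (w ^ i)⁻¹ * (b * (w ^ (n - i))⁻¹) :=
        mul_le_mul (h1 i hi') (h2 _ (Nat.sub_le _ _)) (norm_nonneg _) (by positivity)
    _ = a * b * (w ^ i * w ^ (n - i))⁻¹ := by rw [mul_inv]; ring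
    _ = _ := by rw [← pow_add, Nat.add_sub_of_le hi']

/-- The coefficient of `e^{(iζ - 2k)t}` in the expansion of `√Δ φ_ζ / (c(ζ) c(-ζ))`. -/
noncomputable def jacobiSymbol (α β : ℝ) (k : ℕ) (ζ : ℂ) : ℂ :=
  (jacobiC α β (-ζ))⁻¹ * jostCoeff α β ζ k

theorem eighth_mul_le_norm_sub_I_mul {ξ ζ : ℂ} (hξ : 0 ≤ ξ.im) (hζ : ‖ζ - ξ‖ ≤ (1 + ‖ξ‖) / 4)
    (k : ℕ) : 1 / 8 * ((k : ℝ) + 1) ≤ ‖((k : ℂ) + 1) - Complex.I * ζ‖ := by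
  have hk : (0 : ℝ) ≤ k := Nat.cast_nonneg k
  have h := le_norm_neg_I_mul_div_two_add hξ hζ (a := (k + 1) / 2) (by linarith)
  have e : ((k : ℂ) + 1) - Complex.I * ζ =
      2 * (-Complex.I * ζ / 2 + (((k + 1) / 2 : ℝ) : ℂ)) := by push_cast; ring
  rw [e, norm_mul, Complex.norm_ofNat]
  linarith [norm_nonneg ξ]

theorem differentiableAt_jacobiSymbol {α β : ℝ} (hβα : β < α) (hβ : -(1 / 2) < β)
    (hα : 1 / 2 < α) {ξ ζ : ℂ} (hξ : 0 ≤ ξ.im) (hζ : ‖ζ - ξ‖ ≤ (1 + ‖ξ‖) / 4) (k : ℕ) :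
    DifferentiableAt ℂ (jacobiSymbol α β k) ζ := by
  refine (differentiableAt_inv_jacobiC_neg hβα hβ hα hξ hζ).mul
    (differentiableAt_jostCoeff α β (fun k => ?_) k)
  rw [← norm_pos_iff]
  exact lt_of_lt_of_le (by positivity) (eighth_mul_le_norm_sub_I_mul hξ hζ k)

theorem differentiableAt_jacobiSymbol_self {α β : ℝ} (hβα : β < α) (hβ : -(1 / 2) < β)
    (hα : 1 / 2 < α) {ξ : ℂ} (hξ : 0 ≤ ξ.im) (k : ℕ) :
    DifferentiableAt ℂ (jacobiSymbol α β k) ξ :=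
  differentiableAt_jacobiSymbol hβα hβ hα hξ (by rw [sub_self, norm_zero]; positivity) k

/-- Cauchy's estimate on the disc of radius (1 + ‖ξ‖)/4, where the bounds for 1/c(-ζ) and for the
Jost coefficients hold uniformly; the radius accounts for n! 4^n (1 + ‖ξ‖)^{-n}. -/
theorem norm_iteratedDeriv_jacobiSymbol_le {α β : ℝ} (hβα : β < α) (hβ : -(1 / 2) < β)
    (hα : 1 / 2 < α) : ∃ (C : ℝ) (Q : ℕ), 0 ≤ C ∧ ∀ (n k : ℕ) (ξ : ℂ), 0 ≤ ξ.im →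
      ‖iteratedDeriv n (jacobiSymbol α β k) ξ‖ ≤
        n.factorial * 4 ^ n * (C * (k + Q).choose Q * (1 + ‖ξ‖) ^ (α + 1 / 2)) *
          ((1 + ‖ξ‖) ^ n)⁻¹ := by
  obtain ⟨C, hC, h⟩ := norm_inv_jacobiC_neg_le hβα hβ hα
  obtain ⟨Q, hQ⟩ := exists_nat_ge ((|α ^ 2 - 1 / 4| + |β ^ 2 - 1 / 4|) / (1 / 8))
  refine ⟨C, Q, hC, fun n k ξ hξ => ?_⟩
  have hR : 0 < (1 + ‖ξ‖) / 4 := by positivity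
  have hd : DiffContOnCl ℂ (jacobiSymbol α β k) (Metric.ball ξ ((1 + ‖ξ‖) / 4)) := by
    refine DifferentiableOn.diffContOnCl_ball (U := Metric.closedBall ξ ((1 + ‖ξ‖) / 4))
      (fun ζ hζ => ?_) subset_rfl
    exact (differentiableAt_jacobiSymbol hβα hβ hα hξ (mem_closedBall_iff_norm.1 hζ)
      k).differentiableWithinAt
  refine (Complex.norm_iteratedDeriv_le_of_forall_mem_sphere_norm_le n hR hd
    (C := C * (k + Q).choose Q * (1 + ‖ξ‖) ^ (α + 1 / 2)) fun ζ hζ => ?_).trans (le_of_eq ?_)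
  · have hζ' : ‖ζ - ξ‖ ≤ (1 + ‖ξ‖) / 4 := (mem_sphere_iff_norm.1 hζ).le
    unfold jacobiSymbol
    rw [norm_mul, mul_right_comm]
    exact mul_le_mul (h ξ ζ hξ hζ') (norm_jostCoeff_le (by norm_num) hQ
      (eighth_mul_le_norm_sub_I_mul hξ hζ') k) (norm_nonneg _) (by positivity)
  · rw [div_pow]
    field_simp

/-- Bounds for the products of a multiplier with the symbols on a line and on a strip. -/
theorem norm_iteratedDeriv_mul_jacobiSymbol_le {α β : ℝ} (hβα : β < α) (hβ : -(1 / 2) < β)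
    (hα : 1 / 2 < α) : ∃ Q : ℕ, ∀ (m : ℂ → ℂ), DifferentiableOn ℂ m (stripOmegaOne α β) →
    ∀ (η : ℝ), 0 < η → η < jacobiRho α β → ∀ N : ℕ, (∀ a ≤ N,
      ∃ C : ℝ, ∀ x : ℝ,
        ‖iteratedDeriv a (fun u : ℝ => m ((u : ℂ) + (η : ℂ) * Complex.I)) x‖
          ≤ C * ((1 + |x|) ^ a)⁻¹) → ∃ K : ℝ, 0 ≤ K ∧ ∀ (n k : ℕ) (x : ℝ), n ≤ N →
    ‖iteratedDeriv n (fun u : ℝ => m (u + η * Complex.I) *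
      jacobiSymbol α β k (u + η * Complex.I)) x‖ ≤
        K * (k + Q).choose Q * (1 + |x|) ^ (α + 1 / 2) * ((1 + |x|) ^ n)⁻¹ := by
  obtain ⟨C, Q, hC, h⟩ := norm_iteratedDeriv_jacobiSymbol_le hβα hβ hα
  refine ⟨Q, fun m hm η h0 h1 N hN => ?_⟩
  choose! c hc using hN
  have hc0 : ∀ a ≤ N, 0 ≤ c a := fun a ha => by
    simpa using (norm_nonneg _).trans (hc a ha 0)
  set c' : ℝ := ∑ a ∈ Finset.range (N + 1), c a with hc'
  have hcc : ∀ a ≤ N, c a ≤ c' := fun a ha =>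
    Finset.single_le_sum (f := c) (fun i hi => hc0 i (Finset.mem_range_succ_iff.1 hi))
      (Finset.mem_range_succ_iff.2 ha)
  have hc'0 : 0 ≤ c' := (hc0 0 (Nat.zero_le _)).trans (hcc 0 (Nat.zero_le _))
  have hop : IsOpen (stripOmegaOne α β) :=
    isOpen_lt (by fun_prop) continuous_const
  have hS : ∀ k, DifferentiableOn ℂ (jacobiSymbol α β k) {ζ | 0 < ζ.im} := fun k ζ hζ =>
    (differentiableAt_jacobiSymbol_self hβα hβ hα (le_of_lt hζ) k).differentiableWithinAt
  have hop2 : IsOpen {ζ : ℂ | 0 < ζ.im} := isOpen_lt continuous_const Complex.continuous_im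
  refine ⟨2 ^ N * (c' * (N.factorial * 4 ^ N * (C * (1 + η) ^ (α + 1 / 2)))), by positivity,
    fun n k x hn => ?_⟩
  have hx : 0 < 1 + |x| := by positivity
  have key := norm_iteratedDeriv_mul_le (n := n) (x := x) (w := 1 + |x|) (a := c')
    (b := N.factorial * 4 ^ N * (C * (k + Q).choose Q * ((1 + η) * (1 + |x|)) ^ (α + 1 / 2)))
    (contDiff_comp_ofReal_add hop hm (c := η * Complex.I)
      (fun x => by simpa [stripOmegaOne, abs_of_pos h0] using h1))
    (contDiff_comp_ofReal_add hop2 (hS k) (c := η * Complex.I) (fun x => by simpa using h0))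
    (by positivity) (fun i hi => ?_) (fun i hi => ?_)
  · refine key.trans ?_
    rw [Real.mul_rpow (by positivity) (by positivity)]
    have e : 2 ^ N * (c' * (↑N.factorial * 4 ^ N * (C * (1 + η) ^ (α + 1 / 2)))) *
        ((k + Q).choose Q) * (1 + |x|) ^ (α + 1 / 2) * ((1 + |x|) ^ n)⁻¹ =
        2 ^ N * (c' * (↑N.factorial * 4 ^ N * (C * ((k + Q).choose Q) *
          ((1 + η) ^ (α + 1 / 2) * (1 + |x|) ^ (α + 1 / 2))))) * ((1 + |x|) ^ n)⁻¹ := by ring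
    rw [e]
    gcongr
    norm_num
  · exact (hc i (hi.trans hn) x).trans (mul_le_mul_of_nonneg_right (hcc i (hi.trans hn))
      (by positivity))
  · rw [iteratedDeriv_comp_ofReal_add hop2 (hS k) (fun x => by simpa using h0)]
    refine (h i k _ (by simpa using h0.le)).trans ?_
    have hw1 : 1 + |x| ≤ 1 + ‖(x : ℂ) + η * Complex.I‖ := by
      have := Complex.abs_re_le_norm ((x : ℂ) + η * Complex.I)
      simpa using this
    have hw2 : 1 + ‖(x : ℂ) + η * Complex.I‖ ≤ (1 + η) * (1 + |x|) := by
      have := norm_add_le (x : ℂ) (η * Complex.I)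
      rw [norm_mul, Complex.norm_I, Complex.norm_real, Complex.norm_real, Real.norm_eq_abs,
        Real.norm_eq_abs, abs_of_pos h0] at this
      nlinarith [abs_nonneg x]
    have hf : (i.factorial : ℝ) ≤ N.factorial := by
      exact_mod_cast Nat.factorial_le (hi.trans hn)
    have h4 : (4 : ℝ) ^ i ≤ 4 ^ N := pow_le_pow_right₀ (by norm_num) (hi.trans hn)
    gcongr

/-! ### Summation in L² and the shifted expansion -/

/-- Pairing with T is the inner product with its conjugate, a continuous functional, so it passes
through the sum in L². -/
theorem hasSum_integral_mul_of_Lp {B : ℕ → Lp ℂ 2 (volume : Measure ℝ)} (hB : Summable fun k => ‖B k‖)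
    {T : ℝ → ℂ} (hT : MemLp T 2) :
    HasSum (fun k => ∫ t, B k t * T t) (∫ t, (∑' k, B k : Lp ℂ 2 (volume : Measure ℝ)) t * T t) := by
  have hTc : MemLp (fun t => starRingEnd ℂ (T t)) 2 := hT.star
  have key : ∀ f : Lp ℂ 2 (volume : Measure ℝ), inner ℂ (hTc.toLp _) f = ∫ t, f t * T t := by
    intro f
    rw [L2.inner_def]
    refine integral_congr_ae ?_
    filter_upwards [hTc.coeFn_toLp] with t ht
    rw [ht]
    simp
  have := (Summable.of_norm hB).hasSum.mapL (innerSL ℂ (hTc.toLp _))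
  simp only [innerSL_apply_apply, key] at this
  exact this

/-- On t ≥ 1 the factor e^{-2kt} is at most e^{-2k}, which beats the polynomial growth of the norms.
Restriction to [1, ∞) does not change the pairing with the test functions. -/
theorem exists_Lp_hasSum_pairing {J : ℕ → Lp ℂ 2 (volume : Measure ℝ)} {K : ℝ} {Q : ℕ}
    (hJ : ∀ k, ‖J k‖ ≤ K * (k + Q).choose Q) :
    ∃ j : Lp ℂ 2 (volume : Measure ℝ), ∀ T : ℝ → ℂ, IsTestIci T →
      HasSum (fun k : ℕ => ∫ t, J k t * (Complex.exp (-(2 * k : ℝ) * t) * T t)) (∫ t, j t * T t) := by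
  set b : ℕ → ℝ → ℂ := fun k => (Ici (1 : ℝ)).indicator fun t =>
    Complex.exp (-(2 * k : ℝ) * t) * J k t with hb
  have hble : ∀ k t, ‖b k t‖ ≤ Real.exp (-2) ^ k * ‖J k t‖ := by
    intro k t
    by_cases ht : t ∈ Ici (1 : ℝ)
    · simp only [hb, indicator_of_mem ht, norm_mul]
      refine mul_le_mul_of_nonneg_right ?_ (norm_nonneg _)
      rw [Complex.norm_exp, ← Real.exp_nat_mul, Real.exp_le_exp]
      have : (-((2 * k : ℝ) : ℂ) * t).re = -(2 * k * t) := by simp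
      rw [this]
      have h1 : (1 : ℝ) ≤ t := ht
      have hk : (0 : ℝ) ≤ k := Nat.cast_nonneg k
      nlinarith
    · simp only [hb, indicator_of_notMem ht, norm_zero]; positivity
  have hbm : ∀ k, MemLp (b k) 2 := fun k => by
    refine (Lp.memLp (J k)).of_le_mul ?_ (Eventually.of_forall (hble k))
    refine AEStronglyMeasurable.indicator ?_ measurableSet_Ici
    exact (Continuous.aestronglyMeasurable (by fun_prop)).mul (Lp.aestronglyMeasurable _)
  have hnorm : ∀ k, ‖(hbm k).toLp (b k)‖ ≤ K * ((k + Q).choose Q * Real.exp (-2) ^ k) := by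
    intro k
    have : ‖(hbm k).toLp (b k)‖ ≤ Real.exp (-2) ^ k * ‖J k‖ := by
      refine Lp.norm_le_mul_norm_of_ae_le_mul ?_
      filter_upwards [(hbm k).coeFn_toLp] with t ht
      rw [ht]; exact hble k t
    refine this.trans ?_
    calc _ ≤ Real.exp (-2) ^ k * (K * (k + Q).choose Q) := by gcongr; exact hJ k
      _ = _ := by ring
  have hs : Summable fun k => ‖(hbm k).toLp (b k)‖ :=
    Summable.of_nonneg_of_le (fun _ => norm_nonneg _) hnorm
      ((summable_choose_mul_pow Q (Real.exp_pos _).le (by rw [Real.exp_lt_one_iff]; norm_num)).mul_left K)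
  refine ⟨∑' k, (hbm k).toLp (b k), fun T hT => ?_⟩
  convert! hasSum_integral_mul_of_Lp hs (hT.continuous.memLp_of_hasCompactSupport hT.hasCompactSupport) using 2 with k
  refine integral_congr_ae ?_
  filter_upwards [(hbm k).coeFn_toLp] with t ht
  rw [ht, hb]
  by_cases h1 : t ∈ Ici (1 : ℝ)
  · simp only [indicator_of_mem h1]; ring
  · rw [hT.eq_zero t (not_le.1 h1)]; simp

theorem IsTestIci.inv_I_mul_pow {G : ℝ → ℂ} (hG : IsTestIci G) (n : ℕ) :
    IsTestIci fun t => (Complex.I * t)⁻¹ ^ n * G t := by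
  induction n with
  | zero => simpa using hG
  | succ n ih =>
    have := ih.div_I_mul
    refine (funext fun t => ?_ : (fun t : ℝ => (Complex.I * t)⁻¹ ^ (n + 1) * G t) = _) ▸ this
    rw [pow_succ]; ring

theorem IsTestIci.const_mul {G : ℝ → ℂ} (hG : IsTestIci G) (c : ℂ) :
    IsTestIci fun t => c * G t :=
  hG.mul_left contDiffOn_const

/-- The expansion of the pairing of an inverse Jacobi transform, after a shift of contour. -/
theorem exists_Lp_hasSum_integral_jacobiSymbol {α β : ℝ} (hβα : β < α) (hβ : -(1 / 2) < β)
    (hα : 1 / 2 < α) {m : ℂ → ℂ} (hm_hol : DifferentiableOn ℂ m (stripOmegaOne α β))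
    (hm_bdd : ∀ η < jacobiRho α β, ∃ C : ℝ, ∀ ξ : ℂ, |ξ.im| ≤ η → ‖m ξ‖ ≤ C) {N : ℕ}
    (hN : α + 3 / 2 ≤ N) {η : ℝ} (h0 : 0 < η) (h1 : η < jacobiRho α β)
    (hm_deriv : ∀ a ≤ N, ∃ C : ℝ, ∀ x : ℝ,
        ‖iteratedDeriv a (fun u : ℝ => m ((u : ℂ) + (η : ℂ) * Complex.I)) x‖
          ≤ C * ((1 + |x|) ^ a)⁻¹) :
    ∃ j : Lp ℂ 2 (volume : Measure ℝ), ∀ G : ℝ → ℂ, IsTestIci G →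
      HasSum (fun k : ℕ => ∫ x : ℝ, m x * jacobiSymbol α β k x *
          expTransform G (x + (2 * k : ℝ) * Complex.I))
        (∫ t, j t * ((-1) ^ N * ((Complex.I * t)⁻¹ ^ N * (Complex.exp (-η * t) * G t)))) := by
  obtain ⟨Q, hQ⟩ := norm_iteratedDeriv_mul_jacobiSymbol_le hβα hβ hα
  obtain ⟨K, hK, hbound⟩ := hQ m hm_hol η h0 h1 N hm_deriv
  obtain ⟨C₀, hC₀, hdual⟩ := exists_fourier_dual
  obtain ⟨Cm, hCm⟩ := hm_bdd η h1
  obtain ⟨Cs, Qs, hCs, hs⟩ := norm_iteratedDeriv_jacobiSymbol_le hβα hβ hα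
  have hop : IsOpen (stripOmegaOne α β) := isOpen_lt (by fun_prop) continuous_const
  have hop2 : IsOpen {ζ : ℂ | 0 < ζ.im} := isOpen_lt continuous_const Complex.continuous_im
  set u : ℕ → ℝ → ℂ := fun k x => m (x + η * Complex.I) * jacobiSymbol α β k (x + η * Complex.I)
    with hu
  have husm : ∀ k, ContDiff ℝ ∞ (u k) := fun k =>
    (contDiff_comp_ofReal_add hop hm_hol
      (fun x => by simpa [stripOmegaOne, abs_of_pos h0] using h1)).mul
    (contDiff_comp_ofReal_add hop2 (fun ζ hζ => (differentiableAt_jacobiSymbol_self hβα hβ hα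
      (le_of_lt hζ) k).differentiableWithinAt) (fun x => by simpa using h0))
  obtain ⟨P, hP⟩ := exists_nat_ge (α + 1 / 2)
  have hgrow : ∀ k, HasPolyGrowth N (u k) := by
    refine fun k => ⟨K * (k + Q).choose Q, P, fun n hn x => (hbound n k x hn).trans ?_⟩
    have hx : 1 ≤ 1 + |x| := by linarith [abs_nonneg x]
    have e1 : (1 + |x|) ^ (α + 1 / 2) ≤ (1 + |x|) ^ P := by
      rw [← Real.rpow_natCast]; exact Real.rpow_le_rpow_of_exponent_le hx hP
    have e2 : ((1 + |x|) ^ n)⁻¹ ≤ 1 := inv_le_one_of_one_le₀ (one_le_pow₀ hx)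
    calc _ ≤ K * (k + Q).choose Q * (1 + |x|) ^ P * 1 := by gcongr
      _ = _ := mul_one _
  -- This is where N ≥ α + 3/2 enters: the exponent α + 1/2 - N is at most -1, so the derivative is
  -- square integrable.
  have htop : ∀ k x, ‖iteratedDeriv N (u k) x‖ ≤ K * (k + Q).choose Q * (1 + |x|)⁻¹ := by
    intro k x
    refine (hbound N k x le_rfl).trans ?_
    have hx : 1 ≤ 1 + |x| := by linarith [abs_nonneg x]
    rw [mul_assoc]
    refine mul_le_mul_of_nonneg_left ?_ (by positivity)
    rw [← Real.rpow_natCast, ← Real.rpow_neg (by positivity), ← Real.rpow_add (by positivity),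
      ← Real.rpow_neg_one]
    exact Real.rpow_le_rpow_of_exponent_le hx (by linarith)
  choose J hJ hJ' using fun k => hdual (iteratedDeriv N (u k)) (K * (k + Q).choose Q)
    (by positivity) ((husm k).continuous_iteratedDeriv N (by exact_mod_cast le_top)) (htop k)
  obtain ⟨j, hj⟩ := exists_Lp_hasSum_pairing (K := C₀ * K) (fun k => (hJ k).trans (by rw [mul_assoc]))
  refine ⟨j, fun G hG => ?_⟩
  convert! hj _ (((hG.cexp_mul η).inv_I_mul_pow N).const_mul ((-1) ^ N)) using 2 with k
  -- The shift by 2ki is first absorbed into the test function as e^{-2kt}. Only the shift by η is a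
  -- true move of contour, and it is the same for all k.
  have hG2 : IsTestIci fun t => Complex.exp (-(2 * k : ℝ) * t) * G t := hG.cexp_mul _
  have hshift := integral_eq_integral_add_mul_I (η := η) (F := fun ζ => m ζ * jacobiSymbol α β k ζ *
    expTransform (fun t => Complex.exp (-(2 * k : ℝ) * t) * G t) ζ) h0.le (fun ζ hζ0 hζ1 => ?_)
    (C := Cm * (Cs * (k + Qs).choose Qs) *
      (hG2.exists_norm_expTransform_le_one_add (P + 2)).choose) (fun ζ hζ0 hζ1 => ?_)
  · simp_rw [expTransform_add_mul_I G]
    rw [hshift]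
    simp_rw [expTransform_add_mul_I _ _ η]
    have := integral_mul_expTransform_eq N (husm k) (hgrow k) (hG2.cexp_mul η)
    rw [this, hJ' k _ (((hG2.cexp_mul η).inv_I_mul_pow N).const_mul _).contDiff
      (((hG2.cexp_mul η).inv_I_mul_pow N).const_mul _).hasCompactSupport]
    refine integral_congr_ae (Eventually.of_forall fun t => ?_)
    simp only
    ring
  · refine ((hm_hol.differentiableAt (hop.mem_nhds ?_)).mul
      (differentiableAt_jacobiSymbol_self hβα hβ hα hζ0 k)).mul
      (hG2.hasDerivAt_expTransform ζ).differentiableAt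
    simp only [stripOmegaOne, mem_ofPred_eq, abs_of_nonneg hζ0]
    exact hζ1.trans_lt h1
  · obtain ⟨hE0, hE⟩ := (hG2.exists_norm_expTransform_le_one_add (P + 2)).choose_spec
    set E := (hG2.exists_norm_expTransform_le_one_add (P + 2)).choose
    have b1 : ‖m ζ‖ ≤ Cm := hCm ζ (by rwa [abs_of_nonneg hζ0])
    have b2 := hs 0 k ζ hζ0
    simp only [iteratedDeriv_zero, Nat.factorial_zero, Nat.cast_one, pow_zero, one_mul, inv_one,
      mul_one] at b2
    have hw : 1 ≤ 1 + ‖ζ‖ := by linarith [norm_nonneg ζ]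
    have b3 : (1 + ‖ζ‖) ^ (α + 1 / 2) ≤ (1 + ‖ζ‖) ^ P := by
      rw [← Real.rpow_natCast]; exact Real.rpow_le_rpow_of_exponent_le hw hP
    have b4 := (hE ζ hζ0).trans (mul_le_of_le_one_right hE0
      (Real.exp_le_one_iff.2 (by linarith)))
    have hCm0 : 0 ≤ Cm := (norm_nonneg _).trans b1
    have hre : 1 + |ζ.re| ≤ 1 + ‖ζ‖ := by linarith [Complex.abs_re_le_norm ζ]
    rw [norm_mul, norm_mul, ← div_eq_mul_inv, le_div_iff₀ (by positivity)]
    set e := ‖expTransform (fun t => Complex.exp (-(2 * k : ℝ) * t) * G t) ζ‖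
    have he : 0 ≤ e := norm_nonneg _
    calc ‖m ζ‖ * ‖jacobiSymbol α β k ζ‖ * e * (1 + |ζ.re|) ^ 2
        ≤ Cm * (Cs * (k + Qs).choose Qs * (1 + ‖ζ‖) ^ P) * e * (1 + ‖ζ‖) ^ 2 := by
          gcongr
          exact b2.trans (by gcongr)
      _ = Cm * (Cs * (k + Qs).choose Qs) * ((1 + ‖ζ‖) ^ (P + 2) * e) := by ring
      _ ≤ _ := by gcongr

/-! ### The Jacobi measure and the transform of cut-off functions -/

theorem jacobiWeight_pos (α β : ℝ) {t : ℝ} (ht : 0 < t) : 0 < jacobiWeight α β t := by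
  unfold jacobiWeight
  have h1 := Real.sinh_pos_iff.2 ht
  have h2 := Real.cosh_pos t
  positivity

theorem contDiffOn_jacobiWeight (α β : ℝ) : ContDiffOn ℝ ∞ (jacobiWeight α β) (Ioi 0) := by
  unfold jacobiWeight
  refine ContDiffOn.mul ?_ ?_
  · refine ContDiffOn.rpow_const_of_ne (contDiff_const.mul Real.contDiff_sinh).contDiffOn
      fun t ht => ?_
    have := Real.sinh_pos_iff.2 ht
    positivity
  · refine ContDiffOn.rpow_const_of_ne (contDiff_const.mul Real.contDiff_cosh).contDiffOn
      fun t ht => ?_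
    have := Real.cosh_pos t
    positivity

theorem measurable_jacobiWeight (α β : ℝ) : Measurable (jacobiWeight α β) := by
  unfold jacobiWeight
  exact ((Real.measurable_sinh.const_mul 2).pow_const _).mul
    ((Real.measurable_cosh.const_mul 2).pow_const _)

theorem integral_jacobiMeasure (α β : ℝ) (h : ℝ → ℂ) :
    ∫ t, h t ∂(jacobiMeasure α β) = ∫ t in Ioi (0 : ℝ), (jacobiWeight α β t : ℂ) * h t := by
  unfold jacobiMeasure
  rw [integral_withDensity_eq_integral_toReal_smul (measurable_jacobiWeight α β).ennreal_ofReal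
    (Eventually.of_forall fun _ => ENNReal.ofReal_lt_top)]
  refine setIntegral_congr_fun measurableSet_Ioi fun t ht => ?_
  simp only [ENNReal.toReal_ofReal (jacobiWeight_pos α β ht).le, Complex.real_smul]

theorem integrable_jacobiMeasure_iff (α β : ℝ) (h : ℝ → ℂ) :
    Integrable h (jacobiMeasure α β) ↔
      IntegrableOn (fun t => (jacobiWeight α β t : ℂ) * h t) (Ioi (0 : ℝ)) := by
  unfold jacobiMeasure
  rw [integrable_withDensity_iff_integrable_smul' (measurable_jacobiWeight α β).ennreal_ofReal
    (Eventually.of_forall fun _ => ENNReal.ofReal_lt_top)]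
  refine integrableOn_congr_fun (fun t ht => ?_) measurableSet_Ioi
  simp only [ENNReal.toReal_ofReal (jacobiWeight_pos α β ht).le, Complex.real_smul]

/-- The function `√Δ g`, cut off to `(1, ∞)`. -/
noncomputable def sqrtWeightCut (α β : ℝ) (g : ℝ → ℂ) (t : ℝ) : ℂ :=
  if 1 < t then (Real.sqrt (jacobiWeight α β t) : ℂ) * g t else 0

/-- As g vanishes on (0, r] with r > 1, the cut at 1 falls where g is 0 and preserves smoothness; it
also discards the values at t ≤ 0, which μ does not see. -/
theorem isTestIci_sqrtWeightCut (α β : ℝ) {g : ℝ → ℂ} (hg : ContDiff ℝ ∞ g)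
    (hc : HasCompactSupport g) {r : ℝ} (hr : 1 < r) (h0 : ∀ t, 0 < t → t ≤ r → g t = 0) :
    IsTestIci (sqrtWeightCut α β g) := by
  have h1 : IsTestIci fun t => if 1 < t then g t else 0 := by
    refine ⟨contDiff_iff_contDiffAt.2 fun t => ?_, ?_, fun t ht => if_neg ht.not_gt⟩
    · rcases lt_or_ge t r with ht | ht
      · refine (contDiffAt_const (c := (0 : ℂ))).congr_of_eventuallyEq ?_
        filter_upwards [gt_mem_nhds ht] with s hs
        split_ifs with h
        · exact h0 s (by linarith) hs.le
        · rfl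
      · refine hg.contDiffAt.congr_of_eventuallyEq ?_
        filter_upwards [lt_mem_nhds (hr.trans_le ht)] with s hs
        rw [if_pos hs]
    · refine hc.mono fun t ht => ?_
      simp only [Function.mem_support] at ht ⊢
      intro h
      simp [h] at ht
  have h2 := h1.mul_left (φ := fun t => (Real.sqrt (jacobiWeight α β t) : ℂ))
    (Complex.ofRealCLM.contDiff.comp_contDiffOn ((contDiffOn_jacobiWeight α β).sqrt
      fun t ht => (jacobiWeight_pos α β ht).ne'))
  refine (funext fun t => ?_ : sqrtWeightCut α β g = _) ▸ h2
  unfold sqrtWeightCut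
  split_ifs <;> simp

/-- Half of the weight goes to g and half to φ. -/
theorem jacobiTransform_eq (α β : ℝ) {g : ℝ → ℂ} (h0 : ∀ t, 0 < t → t ≤ 1 → g t = 0) (ξ : ℂ) :
    jacobiTransform α β g ξ = ∫ t, sqrtWeightCut α β g t * jacobiY α β ξ t := by
  unfold jacobiTransform
  rw [integral_jacobiMeasure, ← integral_indicator measurableSet_Ioi]
  refine integral_congr_ae (Eventually.of_forall fun t => ?_)
  simp only [indicator, mem_Ioi, sqrtWeightCut]
  by_cases h1 : 1 < t
  · have hw := (jacobiWeight_pos α β (one_pos.trans h1)).le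
    rw [if_pos h1, if_pos (one_pos.trans h1), ← jacobiPhi_eq ξ h1.le]
    nth_rw 1 [← Real.mul_self_sqrt hw]
    push_cast
    ring
  · rw [if_neg h1, zero_mul]
    split_ifs with h2
    · rw [h0 t h2 (not_lt.1 h1)]; simp
    · rfl

theorem integral_jacobiMeasure_cut (α β : ℝ) {g : ℝ → ℂ} (κ : ℝ → ℂ) :
    ∫ t, (if 1 < t then κ t * (Real.sqrt (jacobiWeight α β t) : ℂ)⁻¹ else 0) * g t
      ∂(jacobiMeasure α β) = ∫ t, κ t * sqrtWeightCut α β g t := by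
  rw [integral_jacobiMeasure, ← integral_indicator measurableSet_Ioi]
  refine integral_congr_ae (Eventually.of_forall fun t => ?_)
  simp only [indicator, mem_Ioi, sqrtWeightCut]
  by_cases h1 : 1 < t
  · have hw := jacobiWeight_pos α β (one_pos.trans h1)
    have hw' : (Real.sqrt (jacobiWeight α β t) : ℂ) ≠ 0 := by
      exact_mod_cast (Real.sqrt_pos.2 hw).ne'
    rw [if_pos h1, if_pos (one_pos.trans h1), if_pos h1]
    nth_rw 1 [← Real.mul_self_sqrt hw.le]
    push_cast
    field_simp
  · simp [h1]

theorem integrable_jacobiMeasure_cut (α β : ℝ) {g : ℝ → ℂ} {κ : ℝ → ℂ}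
    (h : Integrable fun t => κ t * sqrtWeightCut α β g t) :
    Integrable (fun t => (if 1 < t then κ t * (Real.sqrt (jacobiWeight α β t) : ℂ)⁻¹ else 0) * g t)
      (jacobiMeasure α β) := by
  rw [integrable_jacobiMeasure_iff, ← integrable_indicator_iff measurableSet_Ioi]
  refine h.congr (Eventually.of_forall fun t => ?_)
  simp only [indicator, mem_Ioi, sqrtWeightCut]
  by_cases h1 : 1 < t
  · have hw := jacobiWeight_pos α β (one_pos.trans h1)
    have hw' : (Real.sqrt (jacobiWeight α β t) : ℂ) ≠ 0 := by
      exact_mod_cast (Real.sqrt_pos.2 hw).ne'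
    rw [if_pos h1, if_pos (one_pos.trans h1), if_pos h1]
    nth_rw 2 [← Real.mul_self_sqrt hw.le]
    push_cast
    field_simp
  · simp [h1]

/-! ### Series expansion of the pairing -/

theorem hasSum_integral_mul_jost (α β : ℝ) {G : ℝ → ℂ} (hG : IsTestIci G) (x : ℝ) :
    HasSum (fun k : ℕ => jostCoeff α β x k * expTransform G (x + (2 * k : ℝ) * Complex.I))
      (∫ t, G t * jost α β x t) := by
  have hsd := summableOnDisc_jostCoeff α β (ξ := x) (by simp)
  have hterm : ∀ (k : ℕ) (t : ℝ), G t * Complex.exp (Complex.I * x * t) *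
      (jostCoeff α β x k * Complex.exp (-2 * t) ^ k) =
      jostCoeff α β x k * (G t * Complex.exp (Complex.I * (x + (2 * k : ℝ) * Complex.I) * t)) := by
    intro k t
    rw [← Complex.exp_nat_mul]
    have : Complex.I * (x + (2 * k : ℝ) * Complex.I) * t =
        Complex.I * x * t + k * (-2 * t) := by
      push_cast; linear_combination (2 * (k : ℂ) * t) * Complex.I_sq
    rw [this, Complex.exp_add]
    ring
  have hi : ∀ k : ℕ, Integrable fun t => G t * Complex.exp (Complex.I * x * t) *
      (jostCoeff α β x k * Complex.exp (-2 * t) ^ k) := fun k => by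
    simp_rw [mul_assoc]
    exact hG.integrable_mul (by fun_prop)
  have hn := (hG.continuous.integrable_of_hasCompactSupport hG.hasCompactSupport
    (μ := volume)).norm
  have hle : ∀ (k : ℕ) (t : ℝ), ‖G t * Complex.exp (Complex.I * x * t) *
      (jostCoeff α β x k * Complex.exp (-2 * t) ^ k)‖ ≤
      (‖jostCoeff α β x k‖ * Real.exp (-2) ^ k) * ‖G t‖ := by
    intro k t
    rcases lt_or_ge t 1 with ht | ht
    · rw [hG.eq_zero t ht]; simp
    · rw [norm_mul, norm_mul, norm_mul, norm_pow, norm_cexp_neg_two_mul, Complex.norm_exp]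
      have e : (Complex.I * x * t).re = 0 := by simp
      rw [e, Real.exp_zero, mul_one, mul_comm ‖G t‖]
      gcongr
      linarith
  have key := hasSum_integral_of_summable_integral_norm hi (Summable.of_nonneg_of_le
    (fun k => integral_nonneg fun _ => norm_nonneg _)
    (fun k => integral_mono (hi k).norm (hn.const_mul _) (hle k)) ?_)
  · convert! key using 1
    · funext k
      unfold expTransform
      rw [← integral_const_mul]
      exact integral_congr_ae (Eventually.of_forall fun t => (hterm k t).symm)
    · refine integral_congr_ae (Eventually.of_forall fun t => ?_)
      simp only
      rw [tsum_mul_left]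
      unfold jost expSum powSum
      ring
  · simp_rw [integral_const_mul]
    exact (hsd (Real.exp (-2)) (Real.exp_pos _).le
      (by rw [Real.exp_lt_one_iff]; norm_num)).mul_right _

theorem integrableOn_Ioi_and_integral_add_comp_neg {T : ℝ → ℂ} (hT : Integrable T) :
    IntegrableOn (fun x => T x + T (-x)) (Ioi 0) ∧
      ∫ x in Ioi (0 : ℝ), (T x + T (-x)) = ∫ x, T x := by
  have h1 : IntegrableOn (fun x => T (-x)) (Ioi 0) := hT.comp_neg.integrableOn
  refine ⟨hT.integrableOn.add h1, ?_⟩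
  rw [integral_add hT.integrableOn h1, integral_comp_neg_Ioi, neg_zero, add_comm,
    intervalIntegral.integral_Iic_add_Ioi hT.integrableOn hT.integrableOn]

/-- The kth term is bounded by a constant times (polynomial in k) · e^{-2k} (1 + |x|)^{-2}: the
rapid decay of the transform of G absorbs the order α + 1/2 of the symbol, and its support in t ≥ 1
yields e^{-2k}. Sum and integral may thus be exchanged. -/
theorem exists_hasSum_integral_jacobiSymbol {α β : ℝ} (hβα : β < α) (hβ : -(1 / 2) < β)
    (hα : 1 / 2 < α) {m : ℝ → ℂ} (hm : Continuous m) {Cm : ℝ} (hm_bdd : ∀ x, ‖m x‖ ≤ Cm)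
    {G : ℝ → ℂ} (hG : IsTestIci G) :
    Integrable (fun x : ℝ => m x * ((jacobiC α β (-(x : ℂ)))⁻¹ * ∫ t, G t * jost α β x t)) ∧
    HasSum (fun k : ℕ => ∫ x : ℝ, m x * jacobiSymbol α β k x *
          expTransform G (x + (2 * k : ℝ) * Complex.I))
      (∫ x : ℝ, m x * ((jacobiC α β (-(x : ℂ)))⁻¹ * ∫ t, G t * jost α β x t)) := by
  obtain ⟨C, Q, hC, hS⟩ := norm_iteratedDeriv_jacobiSymbol_le hβα hβ hα
  obtain ⟨P, hP⟩ := exists_nat_ge (α + 1 / 2)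
  obtain ⟨E, hE0, hE⟩ := hG.exists_norm_expTransform_le_one_add (P + 2)
  have hCm : 0 ≤ Cm := (norm_nonneg _).trans (hm_bdd 0)
  set F : ℕ → ℝ → ℂ := fun k x => m x * jacobiSymbol α β k x *
    expTransform G (x + (2 * k : ℝ) * Complex.I) with hF
  set b : ℕ → ℝ := fun k => Cm * C * E * ((k + Q).choose Q * Real.exp (-2) ^ k) with hb
  have hb0 : ∀ k, 0 ≤ b k := fun k => by positivity
  have hbs : Summable b := (summable_choose_mul_pow Q (Real.exp_pos _).le
    (by rw [Real.exp_lt_one_iff]; norm_num)).mul_left _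
  have hFb : ∀ k x, ‖F k x‖ ≤ b k * ((1 + |x|) ^ 2)⁻¹ := by
    intro k x
    have h1 := hS 0 k x (by simp)
    simp only [iteratedDeriv_zero, Nat.factorial_zero, Nat.cast_one, pow_zero, one_mul, inv_one,
      mul_one, Complex.norm_real, Real.norm_eq_abs] at h1
    have hw : 1 ≤ 1 + |x| := by linarith [abs_nonneg x]
    have h2 : (1 + |x|) ^ (α + 1 / 2) ≤ (1 + |x|) ^ P := by
      rw [← Real.rpow_natCast]; exact Real.rpow_le_rpow_of_exponent_le hw hP
    have h3 := hE (x + (2 * k : ℝ) * Complex.I) (by simp)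
    have h4 : 1 + |x| ≤ 1 + ‖(x : ℂ) + (2 * k : ℝ) * Complex.I‖ := by
      have := Complex.abs_re_le_norm ((x : ℂ) + (2 * k : ℝ) * Complex.I)
      simpa using this
    have h5 : Real.exp (-((x : ℂ) + (2 * k : ℝ) * Complex.I).im) = Real.exp (-2) ^ k := by
      rw [← Real.exp_nat_mul]; congr 1; simp; ring
    rw [h5] at h3
    simp only [hF, hb]
    rw [norm_mul, norm_mul, ← div_eq_mul_inv, le_div_iff₀ (by positivity)]
    set e := ‖expTransform G (x + (2 * k : ℝ) * Complex.I)‖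
    have he : 0 ≤ e := norm_nonneg _
    calc ‖m x‖ * ‖jacobiSymbol α β k x‖ * e * (1 + |x|) ^ 2
        ≤ Cm * (C * (k + Q).choose Q * (1 + |x|) ^ P) * e * (1 + |x|) ^ 2 := by
          gcongr
          · exact hm_bdd x
          · exact h1.trans (by gcongr)
      _ = Cm * (C * (k + Q).choose Q) * ((1 + |x|) ^ (P + 2) * e) := by ring
      _ ≤ Cm * (C * (k + Q).choose Q) * (E * Real.exp (-2) ^ k) := by
          refine mul_le_mul_of_nonneg_left (le_trans ?_ h3) (by positivity)
          gcongr
      _ = _ := by ring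
  have hFc : ∀ k, Continuous (F k) := by
    intro k
    refine (hm.mul (continuous_iff_continuousAt.2 fun x => ?_)).mul
      (continuous_iff_continuousAt.2 fun x => ?_)
    · exact ContinuousAt.comp (f := fun x : ℝ => (x : ℂ))
        (differentiableAt_jacobiSymbol_self hβα hβ hα (by simp) k).continuousAt (by fun_prop)
    · exact ContinuousAt.comp (f := fun x : ℝ => (x : ℂ) + (2 * k : ℝ) * Complex.I)
        (hG.hasDerivAt_expTransform _).continuousAt (by fun_prop)
  have hsum : ∀ x : ℝ, HasSum (fun k => F k x)
      (m x * ((jacobiC α β (-(x : ℂ)))⁻¹ * ∫ t, G t * jost α β x t)) := by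
    intro x
    have := ((hasSum_integral_mul_jost α β hG x).mul_left (jacobiC α β (-(x : ℂ)))⁻¹).mul_left (m x)
    convert! this using 2 with k
    simp only [hF, jacobiSymbol]
    ring
  have hFi : ∀ k, Integrable (F k) := fun k => integrable_of_norm_le_inv_sq (hFc k) (hFb k)
  have hle1 : ∀ x : ℝ, ((1 + |x|) ^ 2)⁻¹ ≤ 1 := fun x =>
    inv_le_one_of_one_le₀ (one_le_pow₀ (by linarith [abs_nonneg x]))
  have hcont : Continuous fun x => ∑' k, F k x :=
    continuous_tsum hFc hbs fun k x => (hFb k x).trans (mul_le_of_le_one_right (hb0 k) (hle1 x))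
  have e : (fun x => ∑' k, F k x) =
      fun x : ℝ => m x * ((jacobiC α β (-(x : ℂ)))⁻¹ * ∫ t, G t * jost α β x t) :=
    funext fun x => (hsum x).tsum_eq
  rw [← e]
  refine ⟨integrable_of_norm_le_inv_sq hcont (C := ∑' k, b k) fun x => ?_, ?_⟩
  · rw [← tsum_mul_right]
    exact tsum_of_norm_bounded (hbs.mul_right _).hasSum (hFb · x)
  · have hw := integrable_one_add_norm (E := ℝ) (μ := volume) (r := 2) (by simp)
    have hw' : Integrable fun x : ℝ => ((1 + |x|) ^ 2)⁻¹ := hw.congr (Eventually.of_forall fun x => by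
      simp only [Real.norm_eq_abs]
      rw [Real.rpow_neg (by positivity), Real.rpow_two])
    refine hasSum_integral_of_summable_integral_norm hFi (Summable.of_nonneg_of_le
      (fun k => integral_nonneg fun _ => norm_nonneg _)
      (fun k => integral_mono (hFi k).norm (hw'.const_mul _) (hFb k)) ?_)
    simp_rw [integral_const_mul]
    exact hbs.mul_right _

theorem IsTestIci.integrable_mul_jost {α β : ℝ} {G : ℝ → ℂ} (hG : IsTestIci G) (x : ℝ) :
    Integrable fun t => G t * jost α β x t := by
  have hc : Continuous fun t => G t * jost α β x t := by
    refine continuous_iff_continuousAt.2 fun t => ?_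
    rcases lt_or_ge 0 t with ht | ht
    · exact hG.continuous.continuousAt.mul (hasDerivAt_jost α β (by simp) ht).continuousAt
    · refine (continuousAt_const (y := (0 : ℂ))).congr ?_
      filter_upwards [gt_mem_nhds (ht.trans_lt one_pos)] with s hs
      rw [hG.eq_zero s hs, zero_mul]
  exact hc.integrable_of_hasCompactSupport hG.hasCompactSupport.mul_right

/-- The constant `Γ(α + 1) / (2 √π)` of the connection formula. -/
noncomputable def jacobiConst (α : ℝ) : ℝ := Real.Gamma (α + 1) / (2 * Real.sqrt Real.pi)

theorem jacobiConst_pos {α : ℝ} (hα : -1 < α) : 0 < jacobiConst α :=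
  div_pos (Real.Gamma_pos_of_pos (by linarith)) (by positivity)

/-- The connection formula divided by c(x) c(-x): in each Jost term one of the two c-factors
cancels. The two terms are exchanged by x ↦ -x. -/
theorem jacobiTransform_mul_plancherelDensity {α β : ℝ} (hβα : β < α) (hβ : -(1 / 2) < β)
    (hα : 1 / 2 < α) {g : ℝ → ℂ} (h0 : ∀ t, 0 < t → t ≤ 1 → g t = 0)
    (hG : IsTestIci (sqrtWeightCut α β g)) {x : ℝ} (hx : x ≠ 0) :
    jacobiTransform α β g x * plancherelDensity α β x =
      (jacobiConst α : ℂ) *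
      ((jacobiC α β (-(x : ℂ)))⁻¹ * ∫ t, sqrtWeightCut α β g t * jost α β x t) +
      (jacobiConst α : ℂ) *
      ((jacobiC α β (-((-x : ℝ) : ℂ)))⁻¹ * ∫ t, sqrtWeightCut α β g t * jost α β (-x : ℝ) t) := by
  have hc := jacobiC_ne_zero (α := α) (β := β) hx
  have hc' := jacobiC_ne_zero (α := α) (β := β) (neg_ne_zero.2 hx)
  rw [jacobiTransform_eq α β h0]
  have e : ∫ t, sqrtWeightCut α β g t * jacobiY α β x t =
      jacobiLeading α β x * (∫ t, sqrtWeightCut α β g t * jost α β x t) +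
      jacobiLeading α β (-x) * (∫ t, sqrtWeightCut α β g t * jost α β (-x : ℝ) t) := by
    rw [← integral_const_mul, ← integral_const_mul, ← integral_add
      ((hG.integrable_mul_jost x).const_mul _) ((hG.integrable_mul_jost (-x)).const_mul _)]
    refine integral_congr_ae (Eventually.of_forall fun t => ?_)
    simp only
    rcases lt_or_ge 0 t with ht | ht
    · rw [jacobiY_eq hβα hβ hα hx ht]
      push_cast
      ring
    · rw [hG.eq_zero t (ht.trans_lt one_pos)]; simp
  rw [e, jacobiLeading_eq, jacobiLeading_eq]
  unfold plancherelDensity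
  push_cast at hc' ⊢
  rw [neg_neg]
  rw [show ((Real.Gamma (α + 1) : ℂ) / (2 * (Real.sqrt Real.pi : ℂ))) = (jacobiConst α : ℂ) by
    unfold jacobiConst; push_cast; rfl]
  field_simp

theorem integral_mul_jacobiTransform_mul_plancherelDensity {α β : ℝ} (hβα : β < α)
    (hβ : -(1 / 2) < β) (hα : 1 / 2 < α) {m : ℂ → ℂ} (hm : Continuous fun x : ℝ => m x) {Cm : ℝ}
    (hm_bdd : ∀ x : ℝ, ‖m x‖ ≤ Cm) (hm_even : ∀ x : ℝ, m (-(x : ℂ)) = m x)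
    {g : ℝ → ℂ} (h0 : ∀ t, 0 < t → t ≤ 1 → g t = 0) (hG : IsTestIci (sqrtWeightCut α β g)) :
    IntegrableOn (fun x : ℝ => m x * jacobiTransform α β g x * plancherelDensity α β x) (Ioi 0) ∧
    HasSum (fun k : ℕ => ∫ x : ℝ, m x * jacobiSymbol α β k x *
          expTransform (sqrtWeightCut α β g) (x + (2 * k : ℝ) * Complex.I))
      ((jacobiConst α : ℂ)⁻¹ *
        ∫ x in Ioi (0 : ℝ), m x * jacobiTransform α β g x * plancherelDensity α β x) := by
  obtain ⟨hi, hs⟩ := exists_hasSum_integral_jacobiSymbol hβα hβ hα hm hm_bdd hG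
  have hC₀ : (jacobiConst α : ℂ) ≠ 0 := by
    exact_mod_cast (jacobiConst_pos (by linarith)).ne'
  set T : ℝ → ℂ := fun x => m x *
    ((jacobiC α β (-(x : ℂ)))⁻¹ * ∫ t, sqrtWeightCut α β g t * jost α β x t)
  have e : EqOn (fun x : ℝ => m x * jacobiTransform α β g x * plancherelDensity α β x)
      (fun x => (jacobiConst α : ℂ) * (T x + T (-x))) (Ioi 0) := by
    intro x hx
    simp only [T]
    rw [mul_assoc, jacobiTransform_mul_plancherelDensity hβα hβ hα h0 hG (ne_of_gt hx)]
    push_cast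
    rw [hm_even]
    ring
  obtain ⟨h1, h2⟩ := integrableOn_Ioi_and_integral_add_comp_neg hi
  refine ⟨(integrableOn_congr_fun e measurableSet_Ioi).2 (h1.const_mul _), ?_⟩
  rw [setIntegral_congr_fun measurableSet_Ioi e, integral_const_mul, h2, ← mul_assoc]
  rw [inv_mul_cancel₀ hC₀, one_mul]
  exact hs

/-! ### Uniqueness of the representing function and membership in L^s -/

theorem jacobiMeasure_absolutelyContinuous (α β : ℝ) : jacobiMeasure α β ≪ volume :=
  (withDensity_absolutelyContinuous _ _).trans Measure.restrict_le_self.absolutelyContinuous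

theorem ae_jacobiMeasure {α β : ℝ} {p : ℝ → Prop} (h : ∀ᵐ t, t ∈ Ioi (0 : ℝ) → p t) :
    ∀ᵐ t ∂(jacobiMeasure α β), p t := by
  have h1 : ∀ᵐ t ∂(volume.restrict (Ioi (0 : ℝ))), p t := (ae_restrict_iff' measurableSet_Ioi).2 h
  exact (withDensity_absolutelyContinuous _ _).ae_le h1

/-- Two representing functions agree almost everywhere. -/
theorem IsInverseJacobiMul.ae_eq {α β : ℝ} {m : ℂ → ℂ} {χ : ℝ → ℝ} {k k' : ℝ → ℂ}
    (h : IsInverseJacobiMul α β m χ k) (h' : IsInverseJacobiMul α β m χ k') :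
    k =ᵐ[jacobiMeasure α β] k' := by
  have hd : ∀ f : ℝ → ℂ, ContDiff ℝ ∞ f → HasCompactSupport f →
      IntegrableOn (fun t => (jacobiWeight α β t : ℂ) * ((k t - k' t) * f t)) (Ioi 0) ∧
      ∫ t in Ioi (0 : ℝ), (jacobiWeight α β t : ℂ) * ((k t - k' t) * f t) = 0 := by
    intro f hf hc
    obtain ⟨-, h1, h2⟩ := h f hf hc
    obtain ⟨-, h1', h2'⟩ := h' f hf hc
    simp_rw [sub_mul]
    refine ⟨(integrable_jacobiMeasure_iff α β _).1 (h1.sub h1'), ?_⟩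
    rw [← integral_jacobiMeasure α β (fun t => k t * f t - k' t * f t), integral_sub h1 h1',
      h2, h2', sub_self]
  have key := isOpen_Ioi.ae_eq_zero_of_integral_contDiff_smul_eq_zero (μ := volume)
    (f := fun t : ℝ => (jacobiWeight α β t : ℂ) * (k t - k' t)) (U := Ioi 0) ?_ ?_
  · refine ae_jacobiMeasure ?_
    filter_upwards [key] with t ht ht0
    have hw : (jacobiWeight α β t : ℂ) ≠ 0 := by exact_mod_cast (jacobiWeight_pos α β ht0).ne'
    exact sub_eq_zero.1 ((mul_eq_zero.1 (ht ht0)).resolve_left hw)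
  -- Local integrability follows from the definition itself, tested on a bump function equal to 1
  -- near x.
  · intro x hx
    let b : ContDiffBump x := ⟨1, 2, one_pos, one_lt_two⟩
    obtain ⟨h1, -⟩ := hd (fun t => (b t : ℂ))
      (Complex.ofRealCLM.contDiff.comp b.contDiff) (b.hasCompactSupport.comp_left (g := fun r : ℝ => (r : ℂ)) (by simp))
    refine ⟨Ioi 0 ∩ Metric.ball x 1, inter_mem_nhdsWithin _ (Metric.ball_mem_nhds x one_pos), ?_⟩
    refine (h1.mono_set inter_subset_left).congr_fun (fun t ht => ?_)
      (measurableSet_Ioi.inter Metric.isOpen_ball.measurableSet)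
    have : b t = 1 := b.one_of_mem_closedBall (Metric.ball_subset_closedBall ht.2)
    simp only [this]
    push_cast
    ring
  · intro g hg hc hsupp
    obtain ⟨-, h2⟩ := hd (fun t => (g t : ℂ))
      (Complex.ofRealCLM.contDiff.comp hg) (hc.comp_left (g := fun r : ℝ => (r : ℂ)) (by simp))
    rw [← h2, ← integral_indicator measurableSet_Ioi]
    refine integral_congr_ae (Eventually.of_forall fun t => ?_)
    simp only [indicator]
    split_ifs with ht
    · rw [Complex.real_smul]; ring
    · have : g t = 0 := image_eq_zero_of_notMem_tsupport fun h => ht (hsupp h)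
      rw [this, zero_smul]

theorem jacobiWeight_le {α β : ℝ} (hα : -(1 / 2) < α) (hβ : -(1 / 2) < β) {t : ℝ} (ht : 0 < t) :
    jacobiWeight α β t ≤ 2 ^ (2 * β + 1) * Real.exp (2 * jacobiRho α β * t) := by
  have h1 : 2 * Real.sinh t ≤ Real.exp t := by
    rw [Real.sinh_eq]; linarith [Real.exp_pos (-t)]
  have h2 : 2 * Real.cosh t ≤ 2 * Real.exp t := by
    rw [Real.cosh_eq]
    have : Real.exp (-t) ≤ Real.exp t := Real.exp_le_exp.2 (by linarith)
    linarith
  have h0 := Real.sinh_pos_iff.2 ht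
  have h0' := Real.cosh_pos t
  unfold jacobiWeight
  calc _ ≤ Real.exp t ^ (2 * α + 1) * (2 * Real.exp t) ^ (2 * β + 1) := by
        gcongr <;> linarith
    _ = 2 ^ (2 * β + 1) * Real.exp (2 * jacobiRho α β * t) := by
        rw [Real.mul_rpow (by norm_num) (Real.exp_pos _).le, ← Real.exp_mul, ← Real.exp_mul,
          mul_left_comm, ← Real.exp_add]
        congr 2
        unfold jacobiRho; ring

theorem memLp_jacobiMeasure_of_memLp {α β s : ℝ} (hs : 0 < s) {k : ℝ → ℂ}
    (hk : AEStronglyMeasurable k)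
    (h : MemLp (fun t => ((jacobiWeight α β t ^ (1 / s) : ℝ) : ℂ) * k t) (ENNReal.ofReal s)
      (volume.restrict (Ioi 0))) :
    MemLp k (ENNReal.ofReal s) (jacobiMeasure α β) := by
  have hs0 : ENNReal.ofReal s ≠ 0 := (ENNReal.ofReal_pos.2 hs).ne'
  have hi := (integrable_norm_rpow_iff h.1 hs0 ENNReal.ofReal_ne_top).2 h
  refine (integrable_norm_rpow_iff (hk.mono_ac (jacobiMeasure_absolutelyContinuous α β)) hs0
    ENNReal.ofReal_ne_top).1 ?_
  unfold jacobiMeasure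
  rw [integrable_withDensity_iff_integrable_smul' (measurable_jacobiWeight α β).ennreal_ofReal
    (Eventually.of_forall fun _ => ENNReal.ofReal_lt_top)]
  refine (integrableOn_congr_fun (fun t ht => ?_) measurableSet_Ioi).1 hi
  have hw := jacobiWeight_pos α β ht
  simp only [ENNReal.toReal_ofReal hw.le, ENNReal.toReal_ofReal hs.le, smul_eq_mul, norm_mul,
    Complex.norm_real]
  rw [Real.norm_of_nonneg (by positivity), Real.mul_rpow (by positivity) (norm_nonneg _),
    ← Real.rpow_mul hw.le, one_div, inv_mul_cancel₀ hs.ne', Real.rpow_one]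

theorem memLp_indicator_exp_neg {δ r : ℝ} (hδ : 0 < δ) (hr : 0 < r) :
    MemLp (fun t => Real.exp (-δ * t)) (ENNReal.ofReal r) (volume.restrict (Ioi 0)) := by
  refine (integrable_norm_rpow_iff (Continuous.aestronglyMeasurable (by fun_prop))
    (ENNReal.ofReal_pos.2 hr).ne' ENNReal.ofReal_ne_top).1 ?_
  refine (exp_neg_integrableOn_Ioi 0 (mul_pos hδ hr)).congr (Eventually.of_forall fun t => ?_)
  simp only
  rw [Real.norm_of_nonneg (Real.exp_pos _).le, ← Real.exp_mul, ENNReal.toReal_ofReal hr.le]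
  ring_nf

/-- One factor Δ^{1/s} comes from the measure and Δ^{-1/2} from k. Their product is O(e^{(2/s -
1)ρt}), so an exponential e^{-δt} with δ > 0 is left in front of j. Hölder's inequality with 1/s =
(1/s - 1/2) + 1/2 finishes, and s < 2 makes the first exponent positive. -/
theorem memLp_jacobiMeasure_of_norm_le {α β : ℝ} (hα : -(1 / 2) < α) (hβ : -(1 / 2) < β)
    {s η : ℝ} (hs : 0 < s) (hs2 : s < 2) (hη : (2 / s - 1) * jacobiRho α β < η) {k j : ℝ → ℂ}
    (hk : AEStronglyMeasurable k) (hj : MemLp j 2) {C : ℝ}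
    (hkj : ∀ t, 0 < t → ‖k t‖ ≤ C * ‖j t‖ * Real.exp (-η * t) / Real.sqrt (jacobiWeight α β t)) :
    MemLp k (ENNReal.ofReal s) (jacobiMeasure α β) := by
  refine memLp_jacobiMeasure_of_memLp hs hk ?_
  set δ := η - (2 / s - 1) * jacobiRho α β with hδ
  have hδ0 : 0 < δ := sub_pos.2 hη
  have hs' : 0 < 1 / s - 1 / 2 := by
    have := one_div_lt_one_div_of_lt hs hs2
    linarith
  have hH : ENNReal.HolderTriple (ENNReal.ofReal (1 / s - 1 / 2)⁻¹) 2 (ENNReal.ofReal s) := ⟨by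
    rw [← ENNReal.ofReal_inv_of_pos (inv_pos.2 hs'), inv_inv, ← ENNReal.ofReal_inv_of_pos hs,
      show (2 : ENNReal) = ENNReal.ofReal 2 by simp, ← ENNReal.ofReal_inv_of_pos two_pos,
      ← ENNReal.ofReal_add hs'.le (by norm_num)]
    congr 1
    ring⟩
  have hm : MemLp (fun t => Real.exp (-δ * t) * ‖j t‖) (ENNReal.ofReal s)
      (volume.restrict (Ioi 0)) :=
    (hj.norm.restrict (Ioi 0)).mul (memLp_indicator_exp_neg hδ0 (inv_pos.2 hs'))
  refine hm.of_le_mul (c := C * (2 ^ (2 * β + 1)) ^ (1 / s - 1 / 2)) ?_ ?_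
  · exact (Complex.measurable_ofReal.comp
      ((measurable_jacobiWeight α β).pow_const _)).aestronglyMeasurable.mul hk.restrict
  · refine (ae_restrict_iff' measurableSet_Ioi).2 (Eventually.of_forall fun t ht => ?_)
    have hw := jacobiWeight_pos α β ht
    rw [norm_mul, Complex.norm_real, Real.norm_of_nonneg (by positivity),
      Real.norm_of_nonneg (by positivity)]
    have e1 : jacobiWeight α β t ^ (1 / s) =
        jacobiWeight α β t ^ (1 / s - 1 / 2) * Real.sqrt (jacobiWeight α β t) := by
      rw [Real.sqrt_eq_rpow, ← Real.rpow_add hw]; congr 1; ring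
    have e2 : jacobiWeight α β t ^ (1 / s - 1 / 2) ≤ (2 ^ (2 * β + 1)) ^ (1 / s - 1 / 2) *
        Real.exp ((2 / s - 1) * jacobiRho α β * t) := by
      refine (Real.rpow_le_rpow hw.le (jacobiWeight_le hα hβ ht) hs'.le).trans (le_of_eq ?_)
      rw [Real.mul_rpow (by positivity) (Real.exp_pos _).le, ← Real.exp_mul]
      congr 2
      field_simp
    have hq := Real.sqrt_pos.2 hw
    have hC : 0 ≤ C * ‖j t‖ * Real.exp (-η * t) := by
      have := (norm_nonneg _).trans (hkj t ht)
      rwa [le_div_iff₀ hq, zero_mul] at this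
    calc _ ≤ jacobiWeight α β t ^ (1 / s) *
          (C * ‖j t‖ * Real.exp (-η * t) / Real.sqrt (jacobiWeight α β t)) := by
          gcongr; exact hkj t ht
      _ = jacobiWeight α β t ^ (1 / s - 1 / 2) * (C * ‖j t‖ * Real.exp (-η * t)) := by
          rw [e1]; field_simp
      _ ≤ (2 ^ (2 * β + 1)) ^ (1 / s - 1 / 2) *
        Real.exp ((2 / s - 1) * jacobiRho α β * t) * (C * ‖j t‖ * Real.exp (-η * t)) :=
          mul_le_mul_of_nonneg_right e2 hC
      _ = C * (2 ^ (2 * β + 1)) ^ (1 / s - 1 / 2) * ‖j t‖ *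
        (Real.exp ((2 / s - 1) * jacobiRho α β * t) * Real.exp (-η * t)) := by ring
      _ = _ := by
          rw [← Real.exp_add, show (2 / s - 1) * jacobiRho α β * t + -η * t = -δ * t by
            rw [hδ]; ring]
          ring

/-- For every height `η` of the contour, the cut off inverse transform is represented by a function
that is `O(e^{-ηt})`, in the `L²` sense, relative to `Δ^{-1/2}`. -/
theorem exists_isInverseJacobiMul_memLp {α β : ℝ} (hβα : β < α) (hβ : -(1 / 2) < β)
    (hα : 1 / 2 < α) {m : ℂ → ℂ} (hm_even : ∀ ξ ∈ stripOmegaOne α β, m (-ξ) = m ξ)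
    (hm_hol : DifferentiableOn ℂ m (stripOmegaOne α β))
    (hm_bdd : ∀ η < jacobiRho α β, ∃ C : ℝ, ∀ ξ : ℂ, |ξ.im| ≤ η → ‖m ξ‖ ≤ C) {N : ℕ}
    (hN : α + 3 / 2 ≤ N) {η : ℝ} (h0 : 0 < η) (h1 : η < jacobiRho α β)
    (hm_deriv : ∀ a ≤ N, ∃ C : ℝ, ∀ x : ℝ,
        ‖iteratedDeriv a (fun u : ℝ => m ((u : ℂ) + (η : ℂ) * Complex.I)) x‖
          ≤ C * ((1 + |x|) ^ a)⁻¹)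
    {χ : ℝ → ℝ} (hχ : ContDiff ℝ ∞ χ) (hχ1 : ∀ t, |χ t| ≤ 1) {r : ℝ} (hr : 1 < r)
    (hχ0 : ∀ t, 0 < t → t ≤ r → χ t = 0) :
    ∃ k : ℝ → ℂ, IsInverseJacobiMul α β m χ k ∧ ∀ s : ℝ, 0 < s → s < 2 →
      (2 / s - 1) * jacobiRho α β < η → MemLp k (ENNReal.ofReal s) (jacobiMeasure α β) := by
  have hreal : ∀ x : ℝ, (x : ℂ) ∈ stripOmegaOne α β := fun x => by
    simpa [stripOmegaOne] using h0.trans h1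
  have hop : IsOpen (stripOmegaOne α β) := isOpen_lt (by fun_prop) continuous_const
  obtain ⟨j, hj⟩ := exists_Lp_hasSum_integral_jacobiSymbol hβα hβ hα hm_hol hm_bdd hN h0 h1 hm_deriv
  obtain ⟨Cm, hCm⟩ := hm_bdd η h1
  have hmc : Continuous fun x : ℝ => m x := continuous_iff_continuousAt.2 fun x =>
    ContinuousAt.comp (f := fun x : ℝ => (x : ℂ))
      (hm_hol.differentiableAt (hop.mem_nhds (hreal x))).continuousAt (by fun_prop)
  -- The L² function of the shifted expansion with the factors gained by the shift and by the N
  -- integrations by parts. The constant of the connection formula is restored here.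
  set κ : ℝ → ℂ := fun t => (jacobiConst α : ℂ) *
    (j t * ((-1) ^ N * ((Complex.I * t)⁻¹ ^ N * Complex.exp (-η * t)))) with hκ
  have hmeasκ : AEStronglyMeasurable κ :=
    ((Lp.aestronglyMeasurable j).mul (Measurable.aestronglyMeasurable (by fun_prop))).const_mul _
  refine ⟨fun t => (if 1 < t then κ t * (Real.sqrt (jacobiWeight α β t) : ℂ)⁻¹ else 0) * χ t,
    fun f hf hc => ?_, fun s hs hs2 hsη => ?_⟩
  · have hg : ContDiff ℝ ∞ fun t => (χ t : ℂ) * f t := (Complex.ofRealCLM.contDiff.comp hχ).mul hf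
    have hG : IsTestIci (sqrtWeightCut α β fun t => (χ t : ℂ) * f t) :=
      isTestIci_sqrtWeightCut α β hg hc.mul_left hr fun t ht htr => by rw [hχ0 t ht htr]; simp
    obtain ⟨hi, hs⟩ := integral_mul_jacobiTransform_mul_plancherelDensity hβα hβ hα hmc
      (fun x => hCm x (by simpa using h0.le)) (fun x => hm_even x (hreal x))
      (fun t ht ht1 => by rw [hχ0 t ht (ht1.trans hr.le)]; simp) hG
    have hC₀ : (jacobiConst α : ℂ) ≠ 0 := by
      exact_mod_cast (jacobiConst_pos (by linarith)).ne'
    have e := hs.unique (hj _ hG)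
    rw [inv_mul_eq_iff_eq_mul₀ hC₀, ← integral_const_mul] at e
    simp_rw [mul_assoc _ ((χ _ : ℝ) : ℂ)]
    have e2 : ∀ t, (jacobiConst α : ℂ) * (j t * ((-1) ^ N * ((Complex.I * t)⁻¹ ^ N *
        (Complex.exp (-η * t) * sqrtWeightCut α β (fun t => (χ t : ℂ) * f t) t)))) =
        κ t * sqrtWeightCut α β (fun t => (χ t : ℂ) * f t) t := fun t => by
      simp only [hκ]; ring
    refine ⟨hi, integrable_jacobiMeasure_cut α β ?_, ?_⟩
    · have hT := ((hG.cexp_mul η).inv_I_mul_pow N).const_mul ((-1) ^ N)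
      have := ((Lp.memLp j).integrable_mul
        (hT.continuous.memLp_of_hasCompactSupport hT.hasCompactSupport (p := 2))).const_mul
          (jacobiConst α : ℂ)
      exact this.congr (Eventually.of_forall e2)
    · rw [integral_jacobiMeasure_cut, e]
      exact integral_congr_ae (Eventually.of_forall fun t => (e2 t).symm)
  · refine memLp_jacobiMeasure_of_norm_le (by linarith) hβ hs hs2 hsη (j := j)
      (C := jacobiConst α) ?_ (Lp.memLp j) fun t ht => ?_
    · refine AEStronglyMeasurable.mul ?_
        (Complex.continuous_ofReal.comp hχ.continuous).aestronglyMeasurable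
      have : AEStronglyMeasurable fun t => κ t * (Real.sqrt (jacobiWeight α β t) : ℂ)⁻¹ :=
        hmeasκ.mul (Complex.measurable_ofReal.comp
          (measurable_jacobiWeight α β).sqrt).inv.aestronglyMeasurable
      exact (this.indicator (measurableSet_Ioi (a := 1))).congr
        (Eventually.of_forall fun t => by simp [indicator])
    · have hC := jacobiConst_pos (α := α) (by linarith)
      have hw := Real.sqrt_pos.2 (jacobiWeight_pos α β ht)
      have hχt : ‖(χ t : ℂ)‖ ≤ 1 := by rw [Complex.norm_real]; exact hχ1 t
      rw [norm_mul]
      refine (mul_le_of_le_one_right (norm_nonneg _) hχt).trans ?_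
      split_ifs with ht1
      · rw [norm_mul, norm_inv, Complex.norm_real, Real.norm_of_nonneg hw.le, ← div_eq_mul_inv]
        refine div_le_div_of_nonneg_right ?_ hw.le
        have h2 : ‖(Complex.I * t)⁻¹ ^ N‖ ≤ 1 := by
          rw [norm_pow, norm_inv, norm_mul, Complex.norm_I, one_mul, Complex.norm_real,
            Real.norm_of_nonneg ht.le]
          exact pow_le_one₀ (by positivity) (inv_le_one_of_one_le₀ ht1.le)
        have h3 : ‖Complex.exp (-η * t)‖ = Real.exp (-η * t) := by
          rw [Complex.norm_exp]; simp
        simp only [hκ]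
        rw [norm_mul, norm_mul, norm_mul, norm_mul, norm_pow, norm_neg, norm_one, one_pow, one_mul,
          h3, Complex.norm_real, Real.norm_of_nonneg hC.le, mul_assoc]
        have h4 : ‖(Complex.I * (t : ℂ))⁻¹ ^ N‖ * Real.exp (-η * t) ≤ Real.exp (-η * t) :=
          mul_le_of_le_one_left (Real.exp_pos _).le h2
        gcongr
      · rw [norm_zero]; positivity

/-! ### The absolutely convergent case -/

theorem exists_norm_jost_le (α β : ℝ) : ∃ C : ℝ, ∀ (x t : ℝ), 1 ≤ t → ‖jost α β x t‖ ≤ C := by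
  obtain ⟨Q, hQ⟩ := exists_nat_ge ((|α ^ 2 - 1 / 4| + |β ^ 2 - 1 / 4|) / (1 / 2))
  have hs := summable_choose_mul_pow Q (Real.exp_pos (-2)).le
    (by rw [Real.exp_lt_one_iff]; norm_num)
  refine ⟨∑' n : ℕ, ((n + Q).choose Q : ℝ) * Real.exp (-2) ^ n, fun x t ht => ?_⟩
  unfold jost expSum
  have e : ‖Complex.exp (Complex.I * x * t)‖ = 1 := by rw [Complex.norm_exp]; simp
  rw [norm_mul, e, one_mul]
  refine tsum_of_norm_bounded hs.hasSum fun n => ?_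
  rw [norm_mul, norm_pow, norm_cexp_neg_two_mul]
  gcongr
  · exact norm_jostCoeff_le (by norm_num) hQ (half_mul_le_norm_sub_I_mul (by simp)) n
  · linarith

/-- The connection formula is singular at x = 0. It is therefore used only for x > 1, where the
c-function is bounded; for x ≤ 1 continuity on a compact rectangle suffices. -/
theorem exists_norm_jacobiY_le {α β : ℝ} (hβα : β < α) (hβ : -(1 / 2) < β) (hα : 1 / 2 < α)
    (R : ℝ) : ∃ C : ℝ, ∀ x t : ℝ, 0 < x → t ∈ Icc 1 R → ‖jacobiY α β x t‖ ≤ C := by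
  obtain ⟨C₁, h1⟩ := norm_jacobiC_le hβα hβ hα
  obtain ⟨C₂, h2⟩ := exists_norm_jost_le α β
  have hC := jacobiConst_pos (α := α) (by linarith)
  have hcont : ContinuousOn (fun p : ℝ × ℝ => jacobiY α β p.1 p.2) (Icc 0 1 ×ˢ Icc 1 R) := by
    intro p hp
    have := continuousAt_jacobiY (α := α) (β := β) (by linarith) ((p.1 : ℂ), p.2)
      (by linarith [hp.2.1] : (0 : ℝ) < p.2)
    exact (ContinuousAt.comp (f := fun p : ℝ × ℝ => ((p.1 : ℂ), p.2)) this
      (by fun_prop)).continuousWithinAt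
  obtain ⟨C₃, h3⟩ := (isCompact_Icc.prod isCompact_Icc).exists_bound_of_continuousOn hcont
  refine ⟨max C₃ (jacobiConst α * C₁ * C₂ + jacobiConst α * C₁ * C₂), fun x t hx ht => ?_⟩
  rcases le_or_gt x 1 with hx1 | hx1
  · exact (h3 (x, t) ⟨⟨hx.le, hx1⟩, ht⟩).trans (le_max_left _ _)
  · refine le_trans ?_ (le_max_right _ _)
    have hL : ∀ y : ℝ, 1 ≤ |y| → ‖jacobiLeading α β y‖ ≤ jacobiConst α * C₁ := fun y hy => by
      rw [jacobiLeading_eq, norm_mul, Complex.norm_real]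
      change ‖jacobiConst α‖ * _ ≤ _
      rw [Real.norm_of_nonneg hC.le]
      exact mul_le_mul_of_nonneg_left (h1 y hy) hC.le
    have hC1 : 0 ≤ C₁ := (norm_nonneg _).trans (h1 1 (by simp))
    rw [jacobiY_eq hβα hβ hα hx.ne' (by linarith [ht.1])]
    refine (norm_add_le _ _).trans ?_
    rw [norm_mul, norm_mul]
    have e := h2 (-x) t ht.1
    have e' := hL (-x) (by rw [abs_neg]; exact hx1.le.trans (le_abs_self x))
    push_cast at e e'
    exact add_le_add
      (mul_le_mul (hL x (hx1.le.trans (le_abs_self x))) (h2 x t ht.1) (norm_nonneg _) (by positivity))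
      (mul_le_mul e' e (norm_nonneg _) (by positivity))

theorem IsTestIci.continuous_mul_jacobiY {α β : ℝ} (hα : -1 < α) {G : ℝ → ℂ} (hG : IsTestIci G) :
    Continuous fun z : ℝ × ℝ => G z.2 * jacobiY α β z.1 z.2 := by
  refine continuous_iff_continuousAt.2 fun z => ?_
  rcases lt_or_ge 0 z.2 with ht | ht
  · refine (hG.continuous.comp continuous_snd).continuousAt.mul ?_
    exact ContinuousAt.comp (f := fun p : ℝ × ℝ => ((p.1 : ℂ), p.2))
      (continuousAt_jacobiY hα ((z.1 : ℂ), z.2) ht) (by fun_prop)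
  · refine (continuousAt_const (y := (0 : ℂ))).congr ?_
    filter_upwards [continuous_snd.continuousAt.eventually (gt_mem_nhds (ht.trans_lt one_pos))]
      with w hw
    rw [hG.eq_zero _ hw, zero_mul]

/-- If the integral defining the inverse Jacobi transform converges absolutely, it represents the
transform in the sense of distributions. -/
theorem isInverseJacobiMul_inverseJacobi {α β : ℝ} (hβα : β < α) (hβ : -(1 / 2) < β)
    (hα : 1 / 2 < α) {m : ℂ → ℂ}
    (hm : IntegrableOn (fun ξ : ℝ => m ξ * plancherelDensity α β ξ) (Ioi (0 : ℝ)))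
    {χ : ℝ → ℝ} (hχ : ContDiff ℝ ∞ χ) {r : ℝ} (hr : 1 < r)
    (hχ0 : ∀ t, 0 < t → t ≤ r → χ t = 0) :
    IsInverseJacobiMul α β m χ fun t => inverseJacobi α β m t * χ t := by
  intro f hf hc
  have hg : ContDiff ℝ ∞ fun t => (χ t : ℂ) * f t := (Complex.ofRealCLM.contDiff.comp hχ).mul hf
  have hg0 : ∀ t, 0 < t → t ≤ r → (χ t : ℂ) * f t = 0 := fun t ht htr => by
    rw [hχ0 t ht htr]; simp
  have hG := isTestIci_sqrtWeightCut α β hg hc.mul_left hr hg0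
  set G := sqrtWeightCut α β fun t => (χ t : ℂ) * f t with hGdef
  obtain ⟨R, hR⟩ := hG.hasCompactSupport.isCompact.bddAbove
  obtain ⟨C, hC⟩ := exists_norm_jacobiY_le hβα hβ hα R
  have hGi : Integrable G := hG.continuous.integrable_of_hasCompactSupport hG.hasCompactSupport
  -- Fubini's theorem applies because √Δ φ is bounded uniformly in the spectral parameter on the
  -- compact support of G.
  have hint : Integrable (Function.uncurry fun ξ t : ℝ =>
      (m ξ * plancherelDensity α β ξ) * (G t * jacobiY α β ξ t))
      ((volume.restrict (Ioi 0)).prod volume) := by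
    refine ((Integrable.mul_prod hm hGi).norm.const_mul C).mono' ?_ ?_
    · exact (hm.aestronglyMeasurable.comp_fst).mul
        (hG.continuous_mul_jacobiY (by linarith)).aestronglyMeasurable
    · filter_upwards [Measure.quasiMeasurePreserving_fst.ae (ae_restrict_mem measurableSet_Ioi)]
        with z hz
      simp only [Function.uncurry]
      have : ‖G z.2 * jacobiY α β z.1 z.2‖ ≤ ‖G z.2‖ * C := by
        by_cases h : G z.2 = 0
        · simp [h]
        · rw [norm_mul]
          refine mul_le_mul_of_nonneg_left (hC z.1 z.2 hz ⟨?_, ?_⟩) (norm_nonneg _)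
          · by_contra h1
            exact h (hG.eq_zero _ (not_le.1 h1))
          · exact hR (subset_tsupport _ h)
      rw [norm_mul, norm_mul (_ * _) (G z.2)]
      calc _ ≤ _ := mul_le_mul_of_nonneg_left this (norm_nonneg _)
        _ = _ := by ring
  have e1 : ∀ ξ : ℝ, ∫ t, (m ξ * plancherelDensity α β ξ) * (G t * jacobiY α β ξ t) =
      m ξ * jacobiTransform α β (fun t => (χ t : ℂ) * f t) ξ * plancherelDensity α β ξ := fun ξ => by
    rw [integral_const_mul, jacobiTransform_eq α β fun t ht ht1 => hg0 t ht (ht1.trans hr.le)]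
    ring
  have e2 : ∀ t : ℝ, ∫ ξ in Ioi (0 : ℝ),
      (m ξ * plancherelDensity α β ξ) * (G t * jacobiY α β ξ t) =
      (Real.sqrt (jacobiWeight α β t) : ℂ) * inverseJacobi α β m t * G t := fun t => by
    rcases lt_or_ge t 1 with ht | ht
    · simp [hG.eq_zero t ht]
    · unfold inverseJacobi
      rw [← integral_const_mul, ← integral_mul_const]
      refine integral_congr_ae (Eventually.of_forall fun ξ => ?_)
      simp only
      rw [← jacobiPhi_eq ξ ht]
      ring
  have e3 : (fun t => (if 1 < t then (Real.sqrt (jacobiWeight α β t) : ℂ) * inverseJacobi α β m t *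
      (Real.sqrt (jacobiWeight α β t) : ℂ)⁻¹ else 0) * ((χ t : ℂ) * f t)) =ᵐ[jacobiMeasure α β]
      fun t => inverseJacobi α β m t * χ t * f t := by
    refine ae_jacobiMeasure (Eventually.of_forall fun t ht => ?_)
    simp only
    split_ifs with h1
    · have hw : (Real.sqrt (jacobiWeight α β t) : ℂ) ≠ 0 := by
        exact_mod_cast (Real.sqrt_pos.2 (jacobiWeight_pos α β ht)).ne'
      field_simp
    · rw [mul_assoc, hg0 t ht ((not_lt.1 h1).trans hr.le)]; simp
  refine ⟨?_, (integrable_jacobiMeasure_cut α β ?_).congr e3, ?_⟩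
  · exact hint.integral_prod_left.congr (Eventually.of_forall e1)
  · exact hint.integral_prod_right.congr (Eventually.of_forall e2)
  · rw [← integral_congr_ae e3, integral_jacobiMeasure_cut]
    have := integral_integral_swap hint
    simp_rw [e1, e2] at this
    exact this.symm

/-! ### Conclusion -/

theorem mainTheorem7 (α β : ℝ) (hα : 1 / 2 < α) (hαβ : β < α) (hβ : -(1 / 2) < β)
    (R₀ : ℝ) (hR₀ : 1 < R₀)
    (ψ : ℝ → ℝ) (hψ_smooth : ContDiff ℝ ∞ ψ) (hψ_even : ∀ t, ψ (-t) = ψ t)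
    (hψ_range : ∀ t, 0 ≤ ψ t ∧ ψ t ≤ 1)
    (hψ_one : ∀ t, |t| ≤ Real.sqrt R₀ → ψ t = 1) (hψ_zero : ∀ t, R₀ ≤ |t| → ψ t = 0)
    (m : ℂ → ℂ) (hm_even : ∀ ξ ∈ stripOmegaOne α β, m (-ξ) = m ξ)
    (hm_hol : DifferentiableOn ℂ m (stripOmegaOne α β))
    (hm_bdd : ∀ η < jacobiRho α β, ∃ C : ℝ, ∀ ξ : ℂ, |ξ.im| ≤ η → ‖m ξ‖ ≤ C)
    (hm_deriv : ∀ a : ℕ, a ≤ ⌈α + 3 / 2⌉₊ → ∀ y : ℝ, |y| < jacobiRho α β →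
      ∃ C : ℝ, ∀ x : ℝ,
        ‖iteratedDeriv a (fun u : ℝ => m ((u : ℂ) + (y : ℂ) * Complex.I)) x‖
          ≤ C * ((1 + |x|) ^ a)⁻¹) :
    (∃ k : ℝ → ℂ, IsInverseJacobiMul α β m (fun t => 1 - ψ t) k ∧
      ∀ s : ℝ, 1 < s → s < 2 → MemLp k (ENNReal.ofReal s) (jacobiMeasure α β)) ∧
    (IntegrableOn (fun ξ : ℝ => m ξ * plancherelDensity α β ξ) (Ioi (0 : ℝ)) →
      ∀ s : ℝ, 1 < s → s < 2 →
        MemLp (fun t : ℝ => inverseJacobi α β m t * ((1 - ψ t : ℝ) : ℂ))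
          (ENNReal.ofReal s) (jacobiMeasure α β)) := by

  have hρ : 0 < jacobiRho α β := by unfold jacobiRho; linarith
  have hr : 1 < Real.sqrt R₀ := by rw [Real.lt_sqrt zero_le_one]; simpa using hR₀
  have hχ : ContDiff ℝ ∞ fun t => 1 - ψ t := contDiff_const.sub hψ_smooth
  have hχ1 : ∀ t, |1 - ψ t| ≤ 1 := fun t => by
    rw [abs_le]; constructor <;> linarith [hψ_range t]
  have hχ0 : ∀ t, 0 < t → t ≤ Real.sqrt R₀ → 1 - ψ t = 0 := fun t ht htr => by
    rw [hψ_one t (by rwa [abs_of_pos ht]), sub_self]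
  have key : ∀ η, 0 < η → η < jacobiRho α β → ∃ k : ℝ → ℂ,
      IsInverseJacobiMul α β m (fun t => 1 - ψ t) k ∧ ∀ s : ℝ, 0 < s → s < 2 →
      (2 / s - 1) * jacobiRho α β < η → MemLp k (ENNReal.ofReal s) (jacobiMeasure α β) :=
    fun η h0 h1 => exists_isInverseJacobiMul_memLp hαβ hβ hα hm_even hm_hol hm_bdd
      (Nat.le_ceil (α + 3 / 2)) h0 h1
      (fun a ha => hm_deriv a ha η (by rwa [abs_of_pos h0])) hχ hχ1 hr hχ0
  -- The height η may depend on s: by uniqueness a given k agrees almost everywhere with the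
  -- function built at that height, and it inherits the integrability.
  have hLs : ∀ k : ℝ → ℂ, IsInverseJacobiMul α β m (fun t => 1 - ψ t) k →
      ∀ s : ℝ, 1 < s → s < 2 → MemLp k (ENNReal.ofReal s) (jacobiMeasure α β) := by
    intro k hk s hs hs2
    have h2 : 0 < 2 / s - 1 := by rw [sub_pos, one_lt_div (by linarith)]; exact hs2
    have h3 : 2 / s - 1 < 1 := by
      rw [sub_lt_iff_lt_add, div_lt_iff₀ (by linarith)]; linarith
    -- Room for η exists exactly because 2/s - 1 < 1, that is, s > 1.
    obtain ⟨η, h4, h5⟩ := exists_between (show (2 / s - 1) * jacobiRho α β < jacobiRho α β by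
      nlinarith)
    obtain ⟨k', hk', hk's⟩ := key η (lt_trans (by positivity) h4) h5
    exact (hk's s (by linarith) hs2 h4).ae_eq (hk'.ae_eq hk)
  refine ⟨?_, fun hm s hs hs2 => ?_⟩
  · obtain ⟨k, hk, -⟩ := key (jacobiRho α β / 2) (by linarith) (by linarith)
    exact ⟨k, hk, hLs k hk⟩
  · exact hLs _ (isInverseJacobiMul_inverseJacobi hαβ hβ hα hm hχ hr hχ0) s hs hs2
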